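/- Identify functions on $\mathbb{R}/2\pi$ with $2\pi$-periodic functions on $\mathbb{R}$. Let $T>0$ and let $\hat X\in C^{2,1}(\mathbb{R}/2\pi\times[0,T],\mathbb{R}^2)$ (i.e. $\hat X,\hat X_\theta,\hat X_{\theta\theta},\hat X_t$ are continuous on $\mathbb{R}/2\pi\times[0,T]$) satisfy $\hat X(\cdot,0)=X_0$, $$\hat X_t\in L^\infty((0,T),H^{1,2}(\mathbb{R}/2\pi,\mathbb{R}^2))\cap L^2((0,T),H^{2,2}(\mathbb{R}/2\pi,\mathbb{R}^2)),\qquad |\hat X_\theta|\ge c_0>0\ \text{ in }\mathbb{R}/2\pi\times[0,T].$$ For $N\ge 1$ and $h=2\pi/N$ consider a uniform mesh $\theta_1,\dots,\theta_N\in[0,2\pi)$, $\theta_{j+1}-\theta_j=h$, $\theta_{N+1}=\theta_1+2\pi$. Let $\mathcal S_h$ be the space of continuous functions on $\mathbb{R}/2\pi$ that are linear on each $[\theta_j,\theta_{j+1}]$, and $I_h$ the linear Lagrange interpolation at the nodes. For $\hat X_h\in\mathcal S_h^2$, a unit normal field to $\hat X_h$ is a field $\nu_h$, constant on each $[\theta_j,\theta_{j+1})$,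 with $|\nu_h|=1$ and $\nu_h\cdot(\hat X_h(\theta_{j+1})-\hat X_h(\theta_j))=0$ there. Then there are constants $C,M>0$, depending only on $\hat X$ and $T$, such that for every $\alpha\in(0,1]$ for which $\hat X$ solves $$\alpha\hat X_t+(1-\alpha)(\nu\cdot\hat X_t)\nu=|\hat X_\theta|^{-2}\hat X_{\theta\theta}\quad\text{in }\mathbb{R}/2\pi\times(0,T),$$ where $\nu$ is the unit normal to $\hat X$, there is $h_0>0$, depending only on $\hat X$, $T$ and $\alpha$, with the following property. For every such mesh with $0<h\le h_0$ there is a unique solution $\hat X_h\in H^{1,2}((0,T),\mathcal S_h^2)$ (identified with its continuous version on $[0,T]$) of $$\int_0^{2\pi}\big(\alpha\hat X_{ht}\cdot\varphi_h+(1-\alpha)(\hat X_{ht}\cdot\nu_h)(\nu_h\cdot\varphi_h)\big)|\hat X_{h\theta}|^2\,d\theta+\int_0^{2\pi}\hat X_{h\theta}\cdot\varphi_{h\theta}\,d\theta=0\qquad\forall\varphi_h\in\mathcal S_h^2,$$ with $\nu_h$ a unit normal field to $\hat X_h(\cdot,t)$, and with $\hat X_h(\cdot,0)=I_hX_0$.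 The equation holds for every $0<t<T$ with $\hat X_{ht}$ a classical time derivative, and uniqueness holds among all functions in $H^{1,2}((0,T),\mathcal S_h^2)$ that satisfy it for almost every $t\in(0,T)$. Moreover, for every unit normal field $\nu_h$ to $\hat X_h$, $$\alpha\int_0^T\|(\hat X_t-\hat X_{ht})(t)\|^2_{L^2(0,2\pi)}dt+(1-\alpha)\int_0^T\|\nu_h\cdot(\hat X_t-\hat X_{ht})(t)\|^2_{L^2(0,2\pi)}dt+\max_{t\in[0,T]}\|(\hat X-\hat X_h)(t)\|^2_{H^{1,2}(0,2\pi)}\le C\,e^{\frac M\alpha T}h^2 .$$ -/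

import Mathlib

open MeasureTheory Set
open scoped ENNReal ContDiff RealInnerProductSpace

noncomputable section

namespace CurveFlow

/-- The Euclidean plane. -/
abbrev Plane : Type := EuclideanSpace ℝ (Fin 2)

/-! ### Evolving closed curves

A family of closed curves is a map `X : ℝ → ℝ → Plane`; `X t θ` is the point with parameter `θ`
at time `t`. Functions on the circle `ℝ / 2π` are `2π`-periodic functions on `ℝ`. -/

/-- The time derivative `X_t` on `[0, T]` (one-sided at the end points). -/
def timeDeriv (T : ℝ) (X : ℝ → ℝ → Plane) (t θ : ℝ) : Plane :=
  derivWithin (fun s => X s θ) (Icc 0 T) t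

/-- `X ∈ C^{2,1}(ℝ/2π × [0,T], ℝ²)`: the derivatives `X_θ`, `X_θθ`, `X_t` exist and are continuous
up to `t = 0` and `t = T`. -/
structure IsC21 (T : ℝ) (X : ℝ → ℝ → Plane) : Prop where
  periodic : ∀ t ∈ Icc 0 T, Function.Periodic (X t) (2 * Real.pi)
  differentiable : ∀ t ∈ Icc 0 T, Differentiable ℝ (X t)
  differentiable_deriv : ∀ t ∈ Icc 0 T, Differentiable ℝ (deriv (X t))
  differentiableOn_time : ∀ θ, DifferentiableOn ℝ (fun s => X s θ) (Icc 0 T)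
  continuousOn : ContinuousOn (fun p : ℝ × ℝ => X p.1 p.2) (Icc 0 T ×ˢ univ)
  continuousOn_deriv : ContinuousOn (fun p : ℝ × ℝ => deriv (X p.1) p.2) (Icc 0 T ×ˢ univ)
  continuousOn_deriv2 :
    ContinuousOn (fun p : ℝ × ℝ => deriv (deriv (X p.1)) p.2) (Icc 0 T ×ˢ univ)
  continuousOn_timeDeriv :
    ContinuousOn (fun p : ℝ × ℝ => timeDeriv T X p.1 p.2) (Icc 0 T ×ˢ univ)

/-- The unit normal belonging to a (nonzero) tangent vector `v`: `v / |v|` rotated by `90°`. -/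
def unitNormal (v : Plane) : Plane := ‖v‖⁻¹ • !₂[-(v 1), v 0]

/-- The reparametrized curve shortening flow
`α X_t + (1 - α) (ν · X_t) ν = |X_θ|⁻² X_θθ` in `ℝ/2π × (0,T)`. -/
def SolvesFlow (α T : ℝ) (X : ℝ → ℝ → Plane) : Prop :=
  ∀ t ∈ Ioo 0 T, ∀ θ : ℝ,
    α • timeDeriv T X t θ
        + (1 - α) • (⟪unitNormal (deriv (X t) θ), timeDeriv T X t θ⟫
            • unitNormal (deriv (X t) θ))
      = (‖deriv (X t) θ‖ ^ 2)⁻¹ • deriv (deriv (X t)) θ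

/-! ### Sobolev spaces on the circle and Bochner spaces -/

/-- Lebesgue measure on one period. -/
def circleMeasure : Measure ℝ := volume.restrict (Ioo 0 (2 * Real.pi))

/-- `g` is the weak derivative of `f` on the circle `ℝ/2π`. -/
def HasWeakDerivCircle (f g : ℝ → Plane) : Prop :=
  ∀ ψ : ℝ → ℝ, ContDiff ℝ ∞ ψ → Function.Periodic ψ (2 * Real.pi) →
    ∫ θ, deriv ψ θ • f θ ∂circleMeasure = -∫ θ, ψ θ • g θ ∂circleMeasure

/-- `u ∈ L^p((0,T), H^{k,2}(ℝ/2π, ℝ²))`. As `H^{k,2}` carries the norm of the `(k+1)`-tuple of the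
weak derivatives of orders `0, …, k` in `L²`, this means that these weak derivatives `v 0, …, v k`
exist for almost every time and are (strongly measurable) functions in `L^p((0,T), L²)`. -/
def MemBochnerSobolev (k : ℕ) (p : ℝ≥0∞) (T : ℝ) (u : ℝ → ℝ → Plane) : Prop :=
  ∃ v : Fin (k + 1) → ℝ → Lp Plane 2 circleMeasure,
    (∀ j, MemLp (v j) p (volume.restrict (Ioo 0 T))) ∧
    ∀ᵐ t ∂volume.restrict (Ioo 0 T),
      u t =ᵐ[circleMeasure] v 0 t ∧
      ∀ j : Fin k, HasWeakDerivCircle (v j.castSucc t) (v j.succ t)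

/-- `u ∈ H^{1,2}((0,T), ℝ²)` with weak derivative `g`. -/
def MemH1Time (T : ℝ) (u g : ℝ → Plane) : Prop :=
  MemLp u 2 (volume.restrict (Ioo 0 T)) ∧ MemLp g 2 (volume.restrict (Ioo 0 T)) ∧
    ∀ ψ : ℝ → ℝ, ContDiff ℝ ∞ ψ → HasCompactSupport ψ → tsupport ψ ⊆ Ioo 0 T →
      ∫ t in Ioo 0 T, deriv ψ t • u t = -∫ t in Ioo 0 T, ψ t • g t

/-- The squared norm `‖f‖²` of `L²(0,2π)`. -/
def l2NormSq {E : Type*} [NormedAddCommGroup E] (f : ℝ → E) : ℝ≥0∞ :=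
  ∫⁻ θ, ‖f θ‖ₑ ^ 2 ∂circleMeasure

/-- The squared norm `‖f‖²` of `H^{1,2}(0,2π)`, for `f` continuous and piecewise `C¹` (the weak
derivative of such an `f` is its almost everywhere defined classical derivative). -/
def h1NormSq (f : ℝ → Plane) : ℝ≥0∞ := l2NormSq f + l2NormSq (deriv f)

/-! ### Piecewise linear finite elements -/

/-- A mesh `θ_1, …, θ_N ∈ [0, 2π)` of the circle with `θ_{j+1} - θ_j = h` for `j = 1, …, N`, where
`θ_{N+1} = θ_1 + 2π`; thus `h = 2π / N`. -/
structure Mesh where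
  /-- number of nodes -/
  N : ℕ
  /-- first node -/
  first : ℝ
  N_pos : 0 < N
  first_nonneg : 0 ≤ first
  first_lt : first < 2 * Real.pi / N

/-- The grid size. -/
def Mesh.h (𝒯 : Mesh) : ℝ := 2 * Real.pi / 𝒯.N

/-- The nodes, continued periodically to all `j ∈ ℤ`; `j = 0, …, N - 1` are those in `[0, 2π)`. -/
def Mesh.node (𝒯 : Mesh) (j : ℤ) : ℝ := 𝒯.first + j * 𝒯.h

/-- The space `S_h` of continuous functions on `ℝ/2π` that are linear between consecutive nodes. -/
def Mesh.space (𝒯 : Mesh) : Set (ℝ → ℝ) :=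
  {f | Continuous f ∧ Function.Periodic f (2 * Real.pi) ∧
    ∀ j : ℤ, ∃ a b : ℝ, ∀ θ ∈ Icc (𝒯.node j) (𝒯.node (j + 1)), f θ = a + b * θ}

/-- The space `S_h²`. -/
def Mesh.space2 (𝒯 : Mesh) : Set (ℝ → Plane) :=
  {f | ∀ i : Fin 2, (fun θ => f θ i) ∈ 𝒯.space}

/-- The linear Lagrange interpolation `I_h f`: on `[θ_j, θ_{j+1})`, where
`j = ⌊(θ - θ_1) / h⌋` (numbering from `0`), it is the linear function with the values `f θ_j` and
`f θ_{j+1}` at the end points. -/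
def Mesh.interp (𝒯 : Mesh) (f : ℝ → Plane) (θ : ℝ) : Plane :=
  (1 - Int.fract ((θ - 𝒯.first) / 𝒯.h)) • f (𝒯.node ⌊(θ - 𝒯.first) / 𝒯.h⌋)
    + Int.fract ((θ - 𝒯.first) / 𝒯.h) • f (𝒯.node (⌊(θ - 𝒯.first) / 𝒯.h⌋ + 1))

/-- `ν` is a (piecewise constant) unit normal vector field to the polygonal curve `Y ∈ S_h²`. -/
def Mesh.IsUnitNormalField (𝒯 : Mesh) (Y ν : ℝ → Plane) : Prop :=
  Function.Periodic ν (2 * Real.pi) ∧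
    ∀ j : ℤ, ∃ n : Plane, ‖n‖ = 1 ∧ ⟪n, Y (𝒯.node (j + 1)) - Y (𝒯.node j)⟫ = 0 ∧
      ∀ θ ∈ Ico (𝒯.node j) (𝒯.node (j + 1)), ν θ = n

/-- The equation of the semi-discrete scheme at one time, for the position `Y = X_h(t)` and the
velocity `V = X_ht(t)`. A unit normal field to `Y` always exists; it is unique up to the sign where
`Y_θ ≠ 0`, and where `Y_θ = 0` it is multiplied by zero, so the choice of `ν` is immaterial. -/
def SchemeEquation (α : ℝ) (𝒯 : Mesh) (Y V : ℝ → Plane) : Prop :=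
  ∀ ν, 𝒯.IsUnitNormalField Y ν → ∀ φ ∈ 𝒯.space2,
    (∫ θ in (0)..(2 * Real.pi),
        (α * ⟪V θ, φ θ⟫ + (1 - α) * (⟪V θ, ν θ⟫ * ⟪ν θ, φ θ⟫)) * ‖deriv Y θ‖ ^ 2)
      + ∫ θ in (0)..(2 * Real.pi), ⟪deriv Y θ, deriv φ θ⟫ = 0

/-- `X_h ∈ H^{1,2}((0,T), S_h²)`, represented by its continuous version on `[0,T]` and with weak time
derivative `V = X_ht`, solves the semi-discrete problem with initial value `I_h X₀`. As `S_h²` is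
finite-dimensional, membership in `H^{1,2}((0,T), S_h²)` is tested by evaluation at points `θ`. -/
structure IsSemidiscreteSolution (α T : ℝ) (𝒯 : Mesh) (X₀ : ℝ → Plane)
    (Xh V : ℝ → ℝ → Plane) : Prop where
  mem : ∀ t ∈ Icc 0 T, Xh t ∈ 𝒯.space2
  mem_deriv : ∀ t ∈ Ioo 0 T, V t ∈ 𝒯.space2
  continuousOn : ∀ θ, ContinuousOn (fun t => Xh t θ) (Icc 0 T)
  memH1 : ∀ θ, MemH1Time T (fun t => Xh t θ) (fun t => V t θ)
  equation : ∀ᵐ t ∂volume.restrict (Ioo 0 T), SchemeEquation α 𝒯 (Xh t) (V t)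
  initial : Xh 0 = 𝒯.interp X₀

end CurveFlow

end

namespace CurveFlow

namespace Mesh

variable (𝒯 : Mesh)

/-! ### Nodal representation of piecewise linear functions -/

/-! A mesh function is its vector of nodal values, so the scheme is an ordinary differential
equation in `ZMod N → Plane`. In the plane, `|s|² (v · ν)(ν · w)` is the product of the cross
products of `s` with `v` and with `w`. The weighted form of the scheme is therefore a quadratic
polynomial in the slope `s` (`form_eq_of_unit_normal`): the normal and its sign disappear, and the
form dominates `α |s|² |v|²`. Where no edge vanishes, the mass matrix is thus invertible and the
scheme reads `Y' = velocity α Y` with a smooth right-hand side.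

The error is measured at the nodes, by `E = I_h X - X_h`. The flow equation, multiplied by `|X_θ|²`,
and the scheme are both tested with `z = E'`. In one dimension nodal interpolation is the projection
for the Dirichlet form (`integral_inner_deriv_slope`), so the stiffness term is exactly consistent.
The difference of the mass terms splits (`le_form_sub_form`) into a coercive part, the interpolation
error of `X_t`, and a perturbation of the slope that is absorbed by coercivity at the price of a
factor `1/α`. With the energy `(‖E‖² + ‖E_θ‖²)/2` this gives `energy' + mass(z,z)/4 ≤ (M/α) energy +
C h²/α` (`energy_inequality`), and Gronwall bounds the energy and the accumulated dissipation by
`(C/M) h² (exp(M t/α) - 1)`. The prefactor is free of `α`; only the exponent and the admissible mesh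
size see it. Interpolation estimates turn this into the stated bounds.

The argument needs two-sided bounds on the discrete slopes. They come from the inverse estimate `h
|E_θ|² ≤ 2 energy`: since the energy is `O(h²)`, for small `h` the bound `2 energy ≤ m² h` implies
its own strict version, and continuous induction (`le_of_bootstrap`) propagates it. To have a
trajectory on all of `[0,T]` beforehand, `velocity` is replaced by a globally Lipschitz field that
agrees with it on a compact set of regular polygons, and the trajectory is shown to stay there
(`exists_discrete_flow`).

For uniqueness, a weak solution is the integral of its weak derivative
(`MemH1Time.sub_eq_integral`), hence an integral curve of the same field while it stays close to the
constructed one. Gronwall gives equality there, and continuous induction removes the closeness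
assumption (`eq_of_ode`). -/

instance : NeZero 𝒯.N := ⟨𝒯.N_pos.ne'⟩

theorem h_pos : 0 < 𝒯.h :=
  div_pos (by positivity) (Nat.cast_pos.2 𝒯.N_pos)

theorem N_mul_h : (𝒯.N : ℝ) * 𝒯.h = 2 * Real.pi := by
  have : (𝒯.N : ℝ) ≠ 0 := Nat.cast_ne_zero.2 𝒯.N_pos.ne'
  unfold h; field_simp

/-- Nodal values of a piecewise linear function. -/
abbrev Nodal : Type := ZMod 𝒯.N → Plane

/-- The number of the mesh interval containing `θ`. -/
noncomputable def idx (θ : ℝ) : ℤ := ⌊(θ - 𝒯.first) / 𝒯.h⌋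

/-- The slope of a piecewise linear function on the `j`-th mesh interval. -/
noncomputable def edge (Y : 𝒯.Nodal) (j : ZMod 𝒯.N) : Plane := 𝒯.h⁻¹ • (Y (j + 1) - Y j)

/-- The piecewise linear function with given nodal values. -/
noncomputable def lift (Y : 𝒯.Nodal) (θ : ℝ) : Plane :=
  Y (𝒯.idx θ : ZMod 𝒯.N) + (θ - 𝒯.node (𝒯.idx θ)) • 𝒯.edge Y (𝒯.idx θ : ZMod 𝒯.N)

/-- The (right) derivative of the piecewise linear function with given nodal values. -/
noncomputable def slope (Y : 𝒯.Nodal) (θ : ℝ) : Plane := 𝒯.edge Y (𝒯.idx θ : ZMod 𝒯.N)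

/-- The nodal values of a function. -/
noncomputable def sample (f : ℝ → Plane) : 𝒯.Nodal := fun j => f (𝒯.node (j.val : ℤ))

theorem node_succ (j : ℤ) : 𝒯.node (j + 1) = 𝒯.node j + 𝒯.h := by
  simp [node]; ring

theorem node_lt_succ (j : ℤ) : 𝒯.node j < 𝒯.node (j + 1) := by
  rw [node_succ]; linarith [𝒯.h_pos]

theorem node_add_N (j : ℤ) : 𝒯.node (j + 𝒯.N) = 𝒯.node j + 2 * Real.pi := by
  simp [node, add_mul, 𝒯.N_mul_h]; ring

theorem node_add_mul_N (j k : ℤ) : 𝒯.node (j + k * 𝒯.N) = 𝒯.node j + k * (2 * Real.pi) := by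
  simp [node, add_mul, mul_assoc, 𝒯.N_mul_h]; ring

theorem idx_eq_of_mem {j : ℤ} {θ : ℝ} (hθ : θ ∈ Ico (𝒯.node j) (𝒯.node (j + 1))) :
    𝒯.idx θ = j := by
  have h := 𝒯.h_pos
  rw [idx, Int.floor_eq_iff, le_div_iff₀ h, div_lt_iff₀ h]
  have h1 := hθ.1
  have h2 := hθ.2
  simp only [node] at h1 h2
  push_cast at h2
  constructor <;> linarith

theorem mem_Ico_idx (θ : ℝ) : θ ∈ Ico (𝒯.node (𝒯.idx θ)) (𝒯.node (𝒯.idx θ + 1)) := by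
  have h := 𝒯.h_pos
  have h1 := Int.floor_le ((θ - 𝒯.first) / 𝒯.h)
  have h2 := Int.lt_floor_add_one ((θ - 𝒯.first) / 𝒯.h)
  rw [le_div_iff₀ h] at h1
  rw [div_lt_iff₀ h] at h2
  simp only [mem_Ico, node, idx]
  push_cast
  constructor <;> linarith

theorem idx_node (j : ℤ) : 𝒯.idx (𝒯.node j) = j :=
  𝒯.idx_eq_of_mem ⟨le_rfl, 𝒯.node_lt_succ j⟩

theorem idx_add_period (θ : ℝ) : 𝒯.idx (θ + 2 * Real.pi) = 𝒯.idx θ + 𝒯.N := by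
  apply idx_eq_of_mem
  have h := 𝒯.mem_Ico_idx θ
  rw [show 𝒯.idx θ + 𝒯.N + 1 = (𝒯.idx θ + 1) + 𝒯.N by ring, node_add_N, node_add_N]
  exact ⟨by linarith [h.1], by linarith [h.2]⟩

theorem slope_periodic (Y : 𝒯.Nodal) : Function.Periodic (𝒯.slope Y) (2 * Real.pi) := by
  intro θ
  simp [slope, idx_add_period]

theorem lift_periodic (Y : 𝒯.Nodal) : Function.Periodic (𝒯.lift Y) (2 * Real.pi) := by
  intro θ
  simp [lift, idx_add_period, node_add_N]

theorem slope_eq_of_mem (Y : 𝒯.Nodal) {j : ℤ} {θ : ℝ}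
    (hθ : θ ∈ Ico (𝒯.node j) (𝒯.node (j + 1))) : 𝒯.slope Y θ = 𝒯.edge Y (j : ZMod 𝒯.N) := by
  rw [slope, 𝒯.idx_eq_of_mem hθ]

theorem h_smul_edge (Y : 𝒯.Nodal) (j : ZMod 𝒯.N) : 𝒯.h • 𝒯.edge Y j = Y (j + 1) - Y j := by
  rw [edge, smul_inv_smul₀ 𝒯.h_pos.ne']

theorem lift_node (Y : 𝒯.Nodal) (j : ℤ) : 𝒯.lift Y (𝒯.node j) = Y (j : ZMod 𝒯.N) := by
  simp [lift, idx_node]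

theorem lift_eq_of_mem (Y : 𝒯.Nodal) {j : ℤ} {θ : ℝ}
    (hθ : θ ∈ Icc (𝒯.node j) (𝒯.node (j + 1))) :
    𝒯.lift Y θ = Y (j : ZMod 𝒯.N) + (θ - 𝒯.node j) • 𝒯.edge Y (j : ZMod 𝒯.N) := by
  rcases hθ.2.eq_or_lt with h | h
  · rw [h, lift_node, node_succ, add_sub_cancel_left, h_smul_edge]
    push_cast
    abel
  · rw [lift, 𝒯.idx_eq_of_mem ⟨hθ.1, h⟩]

theorem edge_add (Y Z : 𝒯.Nodal) (j : ZMod 𝒯.N) :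
    𝒯.edge (Y + Z) j = 𝒯.edge Y j + 𝒯.edge Z j := by
  simp only [edge, Pi.add_apply, ← smul_add]; congr 1; abel

theorem edge_smul (c : ℝ) (Y : 𝒯.Nodal) (j : ZMod 𝒯.N) :
    𝒯.edge (c • Y) j = c • 𝒯.edge Y j := by
  simp only [edge, Pi.smul_apply, ← smul_sub]; rw [smul_comm]

theorem edge_sub (Y Z : 𝒯.Nodal) (j : ZMod 𝒯.N) :
    𝒯.edge (Y - Z) j = 𝒯.edge Y j - 𝒯.edge Z j := by
  simp only [edge, Pi.sub_apply, ← smul_sub]; congr 1; abel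

theorem slope_add (Y Z : 𝒯.Nodal) (θ : ℝ) : 𝒯.slope (Y + Z) θ = 𝒯.slope Y θ + 𝒯.slope Z θ :=
  𝒯.edge_add Y Z _

theorem slope_smul (c : ℝ) (Y : 𝒯.Nodal) (θ : ℝ) : 𝒯.slope (c • Y) θ = c • 𝒯.slope Y θ :=
  𝒯.edge_smul c Y _

theorem slope_sub (Y Z : 𝒯.Nodal) (θ : ℝ) : 𝒯.slope (Y - Z) θ = 𝒯.slope Y θ - 𝒯.slope Z θ :=
  𝒯.edge_sub Y Z _

theorem lift_add (Y Z : 𝒯.Nodal) (θ : ℝ) : 𝒯.lift (Y + Z) θ = 𝒯.lift Y θ + 𝒯.lift Z θ := by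
  simp only [lift, edge_add, Pi.add_apply, smul_add]; abel

theorem lift_smul (c : ℝ) (Y : 𝒯.Nodal) (θ : ℝ) : 𝒯.lift (c • Y) θ = c • 𝒯.lift Y θ := by
  simp only [lift, edge_smul, Pi.smul_apply, smul_add]; rw [smul_comm]

theorem lift_sub (Y Z : 𝒯.Nodal) (θ : ℝ) : 𝒯.lift (Y - Z) θ = 𝒯.lift Y θ - 𝒯.lift Z θ := by
  simp only [lift, edge_sub, Pi.sub_apply, smul_sub]; abel

theorem lift_eq_convex (Y : 𝒯.Nodal) (θ : ℝ) :
    𝒯.lift Y θ = (1 - Int.fract ((θ - 𝒯.first) / 𝒯.h)) • Y (𝒯.idx θ : ZMod 𝒯.N)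
      + Int.fract ((θ - 𝒯.first) / 𝒯.h) • Y ((𝒯.idx θ : ZMod 𝒯.N) + 1) := by
  have h := 𝒯.h_pos.ne'
  have e : θ - 𝒯.node (𝒯.idx θ) = Int.fract ((θ - 𝒯.first) / 𝒯.h) * 𝒯.h := by
    rw [← Int.self_sub_floor, sub_mul, div_mul_cancel₀ _ h, node, idx]
    ring
  rw [lift, e, mul_smul, h_smul_edge, sub_smul, smul_sub, one_smul]
  abel

theorem hasDerivAt_lift (Y : 𝒯.Nodal) {θ : ℝ} (hθ : θ ≠ 𝒯.node (𝒯.idx θ)) :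
    HasDerivAt (𝒯.lift Y) (𝒯.slope Y θ) θ := by
  have hm := 𝒯.mem_Ico_idx θ
  have h1 : HasDerivAt (fun x => Y (𝒯.idx θ : ZMod 𝒯.N)
      + (x - 𝒯.node (𝒯.idx θ)) • 𝒯.edge Y (𝒯.idx θ : ZMod 𝒯.N))
      ((1 : ℝ) • 𝒯.edge Y (𝒯.idx θ : ZMod 𝒯.N)) θ :=
    (((hasDerivAt_id θ).sub_const _).smul_const _).const_add _
  rw [one_smul] at h1
  refine h1.congr_of_eventuallyEq ?_
  filter_upwards [Ioo_mem_nhds (lt_of_le_of_ne hm.1 hθ.symm) hm.2] with x hx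
  exact 𝒯.lift_eq_of_mem Y ⟨hx.1.le, hx.2.le⟩

theorem hasDerivWithinAt_lift (Y : 𝒯.Nodal) (θ : ℝ) :
    HasDerivWithinAt (𝒯.lift Y) (𝒯.slope Y θ) (Ioi θ) θ := by
  have hm := 𝒯.mem_Ico_idx θ
  have h1 : HasDerivAt (fun x => Y (𝒯.idx θ : ZMod 𝒯.N)
      + (x - 𝒯.node (𝒯.idx θ)) • 𝒯.edge Y (𝒯.idx θ : ZMod 𝒯.N))
      ((1 : ℝ) • 𝒯.edge Y (𝒯.idx θ : ZMod 𝒯.N)) θ :=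
    (((hasDerivAt_id θ).sub_const _).smul_const _).const_add _
  rw [one_smul] at h1
  refine h1.hasDerivWithinAt.congr_of_eventuallyEq ?_ (𝒯.lift_eq_of_mem Y ⟨hm.1, hm.2.le⟩)
  filter_upwards [Ioo_mem_nhdsGT hm.2] with x hx
  exact 𝒯.lift_eq_of_mem Y ⟨hm.1.trans hx.1.le, hx.2.le⟩

theorem continuous_lift (Y : 𝒯.Nodal) : Continuous (𝒯.lift Y) := by
  have key : ∀ j : ℤ, ContinuousOn (𝒯.lift Y) (Icc (𝒯.node j) (𝒯.node (j + 1))) := fun j =>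
    ContinuousOn.congr (f := fun θ => Y (j : ZMod 𝒯.N)
      + (θ - 𝒯.node j) • 𝒯.edge Y (j : ZMod 𝒯.N)) (by fun_prop) fun θ hθ => 𝒯.lift_eq_of_mem Y hθ
  refine continuous_iff_continuousAt.2 fun θ => continuousAt_iff_continuous_left'_right'.2 ⟨?_, ?_⟩
  · have hm := 𝒯.mem_Ico_idx θ
    rcases hm.1.eq_or_lt with h | h
    -- At a node the left-hand limit belongs to the previous mesh interval, because `idx` assigns a
    -- node to the interval on its right.
    · have hk := key (𝒯.idx θ - 1)
      rw [sub_add_cancel, h] at hk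
      have hlt := 𝒯.node_lt_succ (𝒯.idx θ - 1)
      rw [sub_add_cancel, h] at hlt
      exact (hk θ ⟨hlt.le, le_rfl⟩).mono_of_mem_nhdsWithin (Icc_mem_nhdsLT hlt)
    · exact (key _ θ ⟨hm.1, hm.2.le⟩).mono_of_mem_nhdsWithin
        (Filter.mem_of_superset (Ioo_mem_nhdsLT h) fun x hx => ⟨hx.1.le, hx.2.le.trans hm.2.le⟩)
  · exact (𝒯.hasDerivWithinAt_lift Y θ).continuousWithinAt

theorem ae_ne_node : ∀ᵐ θ : ℝ, θ ≠ 𝒯.node (𝒯.idx θ) := by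
  have : (range 𝒯.node).Countable := countable_range _
  filter_upwards [this.ae_notMem volume] with θ hθ h
  exact hθ ⟨_, h.symm⟩

theorem ae_deriv_lift (Y : 𝒯.Nodal) : ∀ᵐ θ : ℝ, deriv (𝒯.lift Y) θ = 𝒯.slope Y θ := by
  filter_upwards [𝒯.ae_ne_node] with θ hθ
  exact (𝒯.hasDerivAt_lift Y hθ).deriv

theorem lift_mem_space2 (Y : 𝒯.Nodal) : 𝒯.lift Y ∈ 𝒯.space2 := by
  refine fun i => ⟨?_, fun θ => by simp only [𝒯.lift_periodic Y θ], fun j => ?_⟩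
  · have := 𝒯.continuous_lift Y
    fun_prop
  · refine ⟨Y (j : ZMod 𝒯.N) i - 𝒯.node j * 𝒯.edge Y (j : ZMod 𝒯.N) i,
      𝒯.edge Y (j : ZMod 𝒯.N) i, fun θ hθ => ?_⟩
    simp only [𝒯.lift_eq_of_mem Y hθ, PiLp.add_apply, PiLp.smul_apply, smul_eq_mul]
    ring

/-- `sample` reads off only the nodes with index `0, …, N - 1`. Periodicity extends this to all
integers, so that `j + 1` in `ZMod N` wraps around correctly at the last interval. -/
theorem sample_intCast {f : ℝ → Plane} (hf : Function.Periodic f (2 * Real.pi)) (j : ℤ) :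
    𝒯.sample f (j : ZMod 𝒯.N) = f (𝒯.node j) := by
  have h1 : (((j : ZMod 𝒯.N).val : ℕ) : ℤ) = j % 𝒯.N := ZMod.val_intCast j
  have h2 : j = j % 𝒯.N + j / 𝒯.N * 𝒯.N := by
    have := Int.emod_add_mul_ediv j 𝒯.N
    linarith [mul_comm (j / 𝒯.N) (𝒯.N : ℤ)]
  rw [sample, h1]
  conv_rhs => rw [h2, node_add_mul_N]
  exact (hf.int_mul _ _).symm

theorem interp_eq_lift {f : ℝ → Plane} (hf : Function.Periodic f (2 * Real.pi)) :
    𝒯.interp f = 𝒯.lift (𝒯.sample f) := by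
  funext θ
  rw [lift_eq_convex, sample_intCast 𝒯 hf, interp]
  congr 2
  rw [show ((𝒯.idx θ : ZMod 𝒯.N) + 1) = ((𝒯.idx θ + 1 : ℤ) : ZMod 𝒯.N) by push_cast; rfl,
    sample_intCast 𝒯 hf]
  rfl

theorem sample_lift (Y : 𝒯.Nodal) : 𝒯.sample (𝒯.lift Y) = Y := by
  funext j
  rw [sample, lift_node]
  simp

theorem periodic_of_mem_space2 {f : ℝ → Plane} (hf : f ∈ 𝒯.space2) :
    Function.Periodic f (2 * Real.pi) := by
  intro θ
  ext i
  exact (hf i).2.1 θ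

/-- With `lift_mem_space2`, this identifies `S_h²` with the nodal vectors, so test functions and
solutions may be replaced by elements of `Nodal`. -/
theorem eq_lift_of_mem_space2 {f : ℝ → Plane} (hf : f ∈ 𝒯.space2) :
    f = 𝒯.lift (𝒯.sample f) := by
  have hp := 𝒯.periodic_of_mem_space2 hf
  funext θ
  have hm := 𝒯.mem_Ico_idx θ
  have hlt := 𝒯.node_lt_succ (𝒯.idx θ)
  have hh := 𝒯.h_pos
  have e1 : ((𝒯.idx θ : ZMod 𝒯.N) + 1) = ((𝒯.idx θ + 1 : ℤ) : ZMod 𝒯.N) := by push_cast; rfl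
  rw [lift, edge, e1, 𝒯.sample_intCast hp, 𝒯.sample_intCast hp]
  ext i
  obtain ⟨a, b, hab⟩ := (hf i).2.2 (𝒯.idx θ)
  have h1 := hab θ ⟨hm.1, hm.2.le⟩
  have h2 := hab _ ⟨le_rfl, hlt.le⟩
  have h3 := hab _ ⟨hlt.le, le_rfl⟩
  simp only [PiLp.add_apply, PiLp.smul_apply, PiLp.sub_apply, smul_eq_mul]
  simp only at h1 h2 h3
  rw [h1, h2, h3, node_succ]
  field_simp
  ring

end Mesh

/-! ### Bounded measurable functions -/

/-- Bounded measurable functions. -/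
def BddMeas {E : Type*} [NormedAddCommGroup E] [MeasurableSpace E] (f : ℝ → E) : Prop :=
  Measurable f ∧ ∃ C : ℝ, ∀ θ, ‖f θ‖ ≤ C

namespace BddMeas

theorem const {E : Type*} [NormedAddCommGroup E] [MeasurableSpace E] (c : E) :
    BddMeas fun _ : ℝ => c := ⟨measurable_const, ‖c‖, fun _ => le_rfl⟩

theorem add {E : Type*} [NormedAddCommGroup E] [MeasurableSpace E] [BorelSpace E]
    [SecondCountableTopology E] {f g : ℝ → E} (hf : BddMeas f) (hg : BddMeas g) :
    BddMeas fun θ => f θ + g θ := by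
  obtain ⟨A, hA⟩ := hf.2
  obtain ⟨B, hB⟩ := hg.2
  exact ⟨hf.1.add hg.1, A + B, fun θ => (norm_add_le _ _).trans (add_le_add (hA θ) (hB θ))⟩

theorem sub {E : Type*} [NormedAddCommGroup E] [MeasurableSpace E] [BorelSpace E]
    [SecondCountableTopology E] {f g : ℝ → E} (hf : BddMeas f) (hg : BddMeas g) :
    BddMeas fun θ => f θ - g θ := by
  obtain ⟨A, hA⟩ := hf.2
  obtain ⟨B, hB⟩ := hg.2
  exact ⟨hf.1.sub hg.1, A + B, fun θ => (norm_sub_le _ _).trans (add_le_add (hA θ) (hB θ))⟩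

theorem mul {f g : ℝ → ℝ} (hf : BddMeas f) (hg : BddMeas g) : BddMeas fun θ => f θ * g θ := by
  obtain ⟨A, hA⟩ := hf.2
  obtain ⟨B, hB⟩ := hg.2
  exact ⟨hf.1.mul hg.1, A * B, fun θ => (norm_mul_le _ _).trans
    (mul_le_mul (hA θ) (hB θ) (norm_nonneg _) ((norm_nonneg _).trans (hA θ)))⟩

theorem inner {f g : ℝ → Plane} (hf : BddMeas f) (hg : BddMeas g) :
    BddMeas fun θ => (⟪f θ, g θ⟫ : ℝ) := by
  obtain ⟨A, hA⟩ := hf.2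
  obtain ⟨B, hB⟩ := hg.2
  exact ⟨hf.1.inner hg.1, A * B, fun θ => (norm_inner_le_norm _ _).trans
    (mul_le_mul (hA θ) (hB θ) (norm_nonneg _) ((norm_nonneg _).trans (hA θ)))⟩

theorem norm {E : Type*} [NormedAddCommGroup E] [MeasurableSpace E] [BorelSpace E]
    {f : ℝ → E} (hf : BddMeas f) : BddMeas fun θ => ‖f θ‖ := by
  obtain ⟨A, hA⟩ := hf.2
  exact ⟨hf.1.norm, A, fun θ => by simpa using hA θ⟩

theorem norm_sq {E : Type*} [NormedAddCommGroup E] [MeasurableSpace E] [BorelSpace E]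
    {f : ℝ → E} (hf : BddMeas f) : BddMeas fun θ => ‖f θ‖ ^ 2 := by
  simpa only [sq] using hf.norm.mul hf.norm

theorem coord {f : ℝ → Plane} (hf : BddMeas f) (i : Fin 2) : BddMeas fun θ => f θ i := by
  obtain ⟨A, hA⟩ := hf.2
  have := hf.1
  exact ⟨by fun_prop, A, fun θ => (PiLp.norm_apply_le (f θ) i).trans (hA θ)⟩

theorem integrable {E : Type*} [NormedAddCommGroup E] [MeasurableSpace E] [BorelSpace E]
    [SecondCountableTopology E] {f : ℝ → E} (hf : BddMeas f) (μ : Measure ℝ)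
    [IsFiniteMeasure μ] : Integrable f μ := by
  obtain ⟨A, hA⟩ := hf.2
  exact Integrable.of_bound hf.1.aestronglyMeasurable A (ae_of_all _ hA)

theorem intervalIntegrable {E : Type*} [NormedAddCommGroup E] [MeasurableSpace E] [BorelSpace E]
    [SecondCountableTopology E] {f : ℝ → E} (hf : BddMeas f) (a b : ℝ) :
    IntervalIntegrable f volume a b :=
  ⟨hf.integrable _, hf.integrable _⟩

theorem of_periodic {E : Type*} [NormedAddCommGroup E] [MeasurableSpace E] [BorelSpace E]
    {f : ℝ → E} (hf : Continuous f) (hp : Function.Periodic f (2 * Real.pi)) : BddMeas f := by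
  obtain ⟨C, hC⟩ := isCompact_Icc.exists_bound_of_continuousOn
    (hf.continuousOn (s := Icc 0 (2 * Real.pi)))
  refine ⟨hf.measurable, C, fun θ => ?_⟩
  obtain ⟨y, hy, he⟩ := hp.exists_mem_Ico₀ Real.two_pi_pos θ
  rw [he]
  exact hC y ⟨hy.1, hy.2.le⟩

end BddMeas

instance : IsFiniteMeasure circleMeasure := by
  unfold circleMeasure; infer_instance

theorem integral_circle {E : Type*} [NormedAddCommGroup E] [NormedSpace ℝ E] (f : ℝ → E) :
    ∫ θ in (0)..(2 * Real.pi), f θ = ∫ θ, f θ ∂circleMeasure := by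
  rw [intervalIntegral.integral_of_le Real.two_pi_pos.le, integral_Ioc_eq_integral_Ioo,
    circleMeasure]

theorem ae_circle {p : ℝ → Prop} (h : ∀ᵐ θ : ℝ, p θ) : ∀ᵐ θ ∂circleMeasure, p θ :=
  ae_restrict_of_ae h

theorem integral_circle_const (c : ℝ) : ∫ _, c ∂circleMeasure = 2 * Real.pi * c := by
  rw [← integral_circle]; simp

/-! ### The bilinear form of the scheme -/

/-- The cross product in the plane. -/
def cross (s v : Plane) : ℝ := s 0 * v 1 - s 1 * v 0

/-- The form `(α v · w + (1 - α) (v · ν) (ν · w)) |s|²`, where `ν` is a unit normal to `s`. -/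
noncomputable def form (α : ℝ) (s v w : Plane) : ℝ :=
  α * ‖s‖ ^ 2 * ⟪v, w⟫ + (1 - α) * (cross s v * cross s w)

theorem inner_plane (v w : Plane) : (⟪v, w⟫ : ℝ) = v 0 * w 0 + v 1 * w 1 := by
  rw [PiLp.inner_apply, Fin.sum_univ_two]; simp [mul_comm]

theorem norm_sq_plane (v : Plane) : ‖v‖ ^ 2 = v 0 ^ 2 + v 1 ^ 2 := by
  rw [EuclideanSpace.norm_sq_eq, Fin.sum_univ_two]; simp

/-- Separates the slope from the test data: a quadratic polynomial in `s` whose coefficients are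
products of coordinates of `v` and `w`. The algebraic rules and the smoothness of the mass matrix
are read off from it. -/
theorem form_eq (α : ℝ) (s v w : Plane) :
    form α s v w = s 0 ^ 2 * (α * (v 0 * w 0) + v 1 * w 1) + s 1 ^ 2 * (v 0 * w 0 + α * (v 1 * w 1))
      - s 0 * s 1 * ((1 - α) * (v 0 * w 1 + v 1 * w 0)) := by
  rw [form, inner_plane, norm_sq_plane, cross, cross]; ring

theorem BddMeas.form {s v w : ℝ → Plane} (α : ℝ) (hs : BddMeas s) (hv : BddMeas v)
    (hw : BddMeas w) : BddMeas fun θ => form α (s θ) (v θ) (w θ) := by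
  have hc : ∀ {f : ℝ → Plane}, BddMeas f → BddMeas fun θ => cross (s θ) (f θ) := fun hf =>
    ((hs.coord 0).mul (hf.coord 1)).sub ((hs.coord 1).mul (hf.coord 0))
  exact (((BddMeas.const α).mul hs.norm_sq).mul (hv.inner hw)).add
    ((BddMeas.const (1 - α)).mul ((hc hv).mul (hc hw)))

theorem form_add_left (α : ℝ) (s v v' w : Plane) :
    form α s (v + v') w = form α s v w + form α s v' w := by
  simp only [form_eq, PiLp.add_apply]; ring

theorem form_add_right (α : ℝ) (s v w w' : Plane) :
    form α s v (w + w') = form α s v w + form α s v w' := by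
  simp only [form_eq, PiLp.add_apply]; ring

theorem form_sub_left (α : ℝ) (s v v' w : Plane) :
    form α s (v - v') w = form α s v w - form α s v' w := by
  simp only [form_eq, PiLp.sub_apply]; ring

theorem form_smul_left (α c : ℝ) (s v w : Plane) :
    form α s (c • v) w = c * form α s v w := by
  simp only [form_eq, PiLp.smul_apply, smul_eq_mul]; ring

theorem form_smul_right (α c : ℝ) (s v w : Plane) :
    form α s v (c • w) = c * form α s v w := by
  simp only [form_eq, PiLp.smul_apply, smul_eq_mul]; ring

/-- The form of the scheme in terms of a unit normal. -/
theorem form_eq_of_unit_normal {s n : Plane} (hn : ‖n‖ = 1) (hs : (⟪n, s⟫ : ℝ) = 0) (α : ℝ)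
    (v w : Plane) :
    (α * ⟪v, w⟫ + (1 - α) * (⟪v, n⟫ * ⟪n, w⟫)) * ‖s‖ ^ 2 = form α s v w := by
  have hn2 : n 0 ^ 2 + n 1 ^ 2 = 1 := by rw [← norm_sq_plane, hn]; norm_num
  rw [inner_plane] at hs
  -- Being orthogonal to the unit vector `n`, `s` is a multiple of the rotated `n`. The factor `s 1
  -- * n 0 - s 0 * n 1` is `±|s|`; it enters squared, so its sign is irrelevant.
  have key : ∀ u : Plane, cross s u = (s 1 * n 0 - s 0 * n 1) * -(⟪n, u⟫ : ℝ) := by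
    intro u
    rw [inner_plane, cross]
    linear_combination (u 1 * n 0 - u 0 * n 1) * hs - (s 0 * u 1 - s 1 * u 0) * hn2
  have hsq : ‖s‖ ^ 2 = (s 1 * n 0 - s 0 * n 1) ^ 2 := by
    rw [norm_sq_plane]
    linear_combination (n 0 * s 0 + n 1 * s 1) * hs - (s 0 ^ 2 + s 1 ^ 2) * hn2
  rw [form, key v, key w, real_inner_comm n v, hsq]
  ring

/-! ### Mass, Dirichlet and Gram forms on nodal vectors -/

namespace Mesh

variable (𝒯 : Mesh)

theorem bddMeas_slope (Y : 𝒯.Nodal) : BddMeas (𝒯.slope Y) := by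
  refine ⟨?_, ∑ j, ‖𝒯.edge Y j‖, fun θ => ?_⟩
  · have h1 : Measurable 𝒯.idx :=
      Int.measurable_floor.comp ((measurable_id.sub_const _).div_const _)
    exact (Measurable.of_discrete (f := fun j : ℤ => 𝒯.edge Y (j : ZMod 𝒯.N))).comp h1
  · exact Finset.single_le_sum (f := fun j => ‖𝒯.edge Y j‖) (fun _ _ => norm_nonneg _)
      (Finset.mem_univ _)

theorem bddMeas_lift (Y : 𝒯.Nodal) : BddMeas (𝒯.lift Y) :=
  .of_periodic (𝒯.continuous_lift Y) (𝒯.lift_periodic Y)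

theorem integral_circle_eq_sum {F : ℝ → ℝ} (hF : ∀ a b, IntervalIntegrable F volume a b)
    (hp : Function.Periodic F (2 * Real.pi)) :
    ∫ θ, F θ ∂circleMeasure
      = ∑ j ∈ Finset.range 𝒯.N, ∫ θ in (𝒯.node j)..(𝒯.node (j + 1)), F θ := by
  rw [← integral_circle]
  have h1 := hp.intervalIntegral_add_eq 0 (𝒯.node 0)
  rw [zero_add] at h1
  have h2 := intervalIntegral.sum_integral_adjacent_intervals (f := F) (μ := volume)
    (a := fun j : ℕ => 𝒯.node j) (n := 𝒯.N) fun k _ => hF _ _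
  rw [h1]
  push_cast at h2
  rw [h2, ← 𝒯.node_add_N]
  simp

/-- The weighted mass form of the scheme. -/
noncomputable def mass (α : ℝ) (Y V W : 𝒯.Nodal) : ℝ :=
  ∫ θ, form α (𝒯.slope Y θ) (𝒯.lift V θ) (𝒯.lift W θ) ∂circleMeasure

/-- The Dirichlet form. -/
noncomputable def stiff (V W : 𝒯.Nodal) : ℝ := ∫ θ, ⟪𝒯.slope V θ, 𝒯.slope W θ⟫ ∂circleMeasure

/-- The `L²` inner product. -/
noncomputable def gram (V W : 𝒯.Nodal) : ℝ := ∫ θ, ⟪𝒯.lift V θ, 𝒯.lift W θ⟫ ∂circleMeasure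

theorem integrable_form (α : ℝ) (Y V W : 𝒯.Nodal) :
    Integrable (fun θ => form α (𝒯.slope Y θ) (𝒯.lift V θ) (𝒯.lift W θ)) circleMeasure :=
  (BddMeas.form α (𝒯.bddMeas_slope Y) (𝒯.bddMeas_lift V) (𝒯.bddMeas_lift W)).integrable _

theorem isBilinearMap_mass (α : ℝ) (Y : 𝒯.Nodal) : IsBilinearMap ℝ (𝒯.mass α Y) where
  add_left V V' W := by
    simp only [mass, lift_add, form_add_left]
    exact integral_add (𝒯.integrable_form α Y V W) (𝒯.integrable_form α Y V' W)
  smul_left c V W := by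
    simp only [mass, lift_smul, form_smul_left, smul_eq_mul]
    exact integral_const_mul _ _
  add_right V W W' := by
    simp only [mass, lift_add, form_add_right]
    exact integral_add (𝒯.integrable_form α Y V W) (𝒯.integrable_form α Y V W')
  smul_right c V W := by
    simp only [mass, lift_smul, form_smul_right, smul_eq_mul]
    exact integral_const_mul _ _

theorem isBilinearMap_stiff : IsBilinearMap ℝ 𝒯.stiff where
  add_left V V' W := by
    simp only [stiff, slope_add, inner_add_left]
    exact integral_add (((𝒯.bddMeas_slope V).inner (𝒯.bddMeas_slope W)).integrable _)
      (((𝒯.bddMeas_slope V').inner (𝒯.bddMeas_slope W)).integrable _)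
  smul_left c V W := by
    simp only [stiff, slope_smul, real_inner_smul_left, smul_eq_mul]
    exact integral_const_mul _ _
  add_right V W W' := by
    simp only [stiff, slope_add, inner_add_right]
    exact integral_add (((𝒯.bddMeas_slope V).inner (𝒯.bddMeas_slope W)).integrable _)
      (((𝒯.bddMeas_slope V).inner (𝒯.bddMeas_slope W')).integrable _)
  smul_right c V W := by
    simp only [stiff, slope_smul, real_inner_smul_right, smul_eq_mul]
    exact integral_const_mul _ _

theorem isBilinearMap_gram : IsBilinearMap ℝ 𝒯.gram where
  add_left V V' W := by
    simp only [gram, lift_add, inner_add_left]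
    exact integral_add (((𝒯.bddMeas_lift V).inner (𝒯.bddMeas_lift W)).integrable _)
      (((𝒯.bddMeas_lift V').inner (𝒯.bddMeas_lift W)).integrable _)
  smul_left c V W := by
    simp only [gram, lift_smul, real_inner_smul_left, smul_eq_mul]
    exact integral_const_mul _ _
  add_right V W W' := by
    simp only [gram, lift_add, inner_add_right]
    exact integral_add (((𝒯.bddMeas_lift V).inner (𝒯.bddMeas_lift W)).integrable _)
      (((𝒯.bddMeas_lift V).inner (𝒯.bddMeas_lift W')).integrable _)
  smul_right c V W := by
    simp only [gram, lift_smul, real_inner_smul_right, smul_eq_mul]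
    exact integral_const_mul _ _

/-- `mass` as a continuous bilinear map. -/
noncomputable def massL (α : ℝ) (Y : 𝒯.Nodal) : 𝒯.Nodal →L[ℝ] 𝒯.Nodal →L[ℝ] ℝ :=
  (𝒯.isBilinearMap_mass α Y).toContinuousBilinearMap

/-- `stiff` as a continuous bilinear map. -/
noncomputable def stiffL : 𝒯.Nodal →L[ℝ] 𝒯.Nodal →L[ℝ] ℝ :=
  𝒯.isBilinearMap_stiff.toContinuousBilinearMap

/-- `gram` as a continuous bilinear map. -/
noncomputable def gramL : 𝒯.Nodal →L[ℝ] 𝒯.Nodal →L[ℝ] ℝ :=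
  𝒯.isBilinearMap_gram.toContinuousBilinearMap

theorem massL_apply (α : ℝ) (Y V W : 𝒯.Nodal) : 𝒯.massL α Y V W = 𝒯.mass α Y V W := rfl

theorem stiffL_apply (V W : 𝒯.Nodal) : 𝒯.stiffL V W = 𝒯.stiff V W := rfl

theorem gramL_apply (V W : 𝒯.Nodal) : 𝒯.gramL V W = 𝒯.gram V W := rfl

/-- The slope of `Y` is constant on each mesh interval, so the integral is a finite sum of quadratic
polynomials in the edges, whose coefficients are the numbers `I i k j` independent of `Y`. -/
theorem contDiff_mass (α : ℝ) (V W : 𝒯.Nodal) : ContDiff ℝ ∞ fun Y => 𝒯.mass α Y V W := by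
  have hV := 𝒯.bddMeas_lift V
  have hW := 𝒯.bddMeas_lift W
  have h1 : ∀ i j, ∀ a b : ℝ,
      IntervalIntegrable (fun θ => 𝒯.lift V θ i * 𝒯.lift W θ j) volume a b := fun i j =>
    ((hV.coord i).mul (hW.coord j)).intervalIntegrable
  set I : Fin 2 → Fin 2 → ℕ → ℝ := fun i k j =>
    ∫ θ in (𝒯.node j)..(𝒯.node (j + 1)), 𝒯.lift V θ i * 𝒯.lift W θ k with hI
  have h2 : ∀ Y, 𝒯.mass α Y V W = ∑ j ∈ Finset.range 𝒯.N,
      (𝒯.edge Y j 0 ^ 2 * (α * I 0 0 j + I 1 1 j) + 𝒯.edge Y j 1 ^ 2 * (I 0 0 j + α * I 1 1 j)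
        - 𝒯.edge Y j 0 * 𝒯.edge Y j 1 * ((1 - α) * (I 0 1 j + I 1 0 j))) := by
    intro Y
    rw [mass, 𝒯.integral_circle_eq_sum
      (BddMeas.form α (𝒯.bddMeas_slope Y) hV hW).intervalIntegrable
      (fun θ => by simp only [𝒯.slope_periodic Y θ, 𝒯.lift_periodic V θ, 𝒯.lift_periodic W θ])]
    refine Finset.sum_congr rfl fun j _ => ?_
    have h3 : ∫ θ in (𝒯.node j)..(𝒯.node (j + 1)),
          form α (𝒯.slope Y θ) (𝒯.lift V θ) (𝒯.lift W θ)
        = ∫ θ in (𝒯.node j)..(𝒯.node (j + 1)),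
          form α (𝒯.edge Y j) (𝒯.lift V θ) (𝒯.lift W θ) := by
      refine intervalIntegral.integral_congr_Ioo_of_le (𝒯.node_lt_succ j).le fun θ hθ => ?_
      simp only [𝒯.slope_eq_of_mem Y ⟨hθ.1.le, hθ.2⟩, Int.cast_natCast]
    rw [h3]
    simp only [form_eq]
    rw [intervalIntegral.integral_sub, intervalIntegral.integral_add]
    · simp only [intervalIntegral.integral_const_mul]
      rw [intervalIntegral.integral_add, intervalIntegral.integral_add,
        intervalIntegral.integral_add]
      · simp only [intervalIntegral.integral_const_mul, hI]
      · exact h1 0 1 _ _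
      · exact h1 1 0 _ _
      · exact h1 0 0 _ _
      · exact (h1 1 1 _ _).const_mul _
      · exact (h1 0 0 _ _).const_mul _
      · exact h1 1 1 _ _
    · exact (((h1 0 0 _ _).const_mul _).add (h1 1 1 _ _)).const_mul _
    · exact ((h1 0 0 _ _).add ((h1 1 1 _ _).const_mul _)).const_mul _
    · exact ((((h1 0 0 _ _).const_mul _).add (h1 1 1 _ _)).const_mul _).add
        (((h1 0 0 _ _).add ((h1 1 1 _ _).const_mul _)).const_mul _)
    · exact (((h1 0 1 _ _).add (h1 1 0 _ _)).const_mul _).const_mul _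
  simp only [h2, edge]
  fun_prop

theorem contDiff_massL (α : ℝ) : ContDiff ℝ ∞ (𝒯.massL α) :=
  contDiff_clm_apply_iff.2 fun V => contDiff_clm_apply_iff.2 fun W => 𝒯.contDiff_mass α V W

/-! ### Inverse estimates and coercivity -/

theorem integral_elem_le {F : ℝ → ℝ} (hF : ∀ a b, IntervalIntegrable F volume a b)
    (hp : Function.Periodic F (2 * Real.pi)) (h0 : ∀ θ, 0 ≤ F θ) (j : ZMod 𝒯.N) :
    ∫ θ in (𝒯.node (j.val : ℤ))..(𝒯.node ((j.val : ℤ) + 1)), F θ ≤ ∫ θ, F θ ∂circleMeasure := by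
  rw [𝒯.integral_circle_eq_sum hF hp]
  exact Finset.single_le_sum (f := fun k : ℕ => ∫ θ in (𝒯.node k)..(𝒯.node (k + 1)), F θ)
    (fun k _ => intervalIntegral.integral_nonneg (𝒯.node_lt_succ k).le fun θ _ => h0 θ)
    (Finset.mem_range.2 (ZMod.val_lt j))

/-- Inverse estimate: the slope is constant on the interval of length `h` containing `θ`, whose
share of the Dirichlet integral is the left-hand side. It converts energy smallness into a pointwise
bound on slopes. -/
theorem h_mul_norm_slope_sq_le (V : 𝒯.Nodal) (θ : ℝ) :
    𝒯.h * ‖𝒯.slope V θ‖ ^ 2 ≤ 𝒯.stiff V V := by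
  have h1 := 𝒯.integral_elem_le (F := fun θ => ⟪𝒯.slope V θ, 𝒯.slope V θ⟫)
    ((𝒯.bddMeas_slope V).inner (𝒯.bddMeas_slope V)).intervalIntegrable
    (fun x => by simp only [𝒯.slope_periodic V x]) (fun x => real_inner_self_nonneg)
    (𝒯.idx θ : ZMod 𝒯.N)
  refine le_trans (le_of_eq ?_) h1
  rw [intervalIntegral.integral_congr_Ioo_of_le (g := fun _ => ‖𝒯.slope V θ‖ ^ 2)
    (𝒯.node_lt_succ _).le]
  · rw [intervalIntegral.integral_const, node_succ, smul_eq_mul]; ring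
  · intro x hx
    simp only [𝒯.slope_eq_of_mem V ⟨hx.1.le, hx.2⟩, real_inner_self_eq_norm_sq]
    simp [slope]

/-- On one interval, `∫ |V j + s e|² ds` over `0 ≤ s ≤ h` is a quadratic form in the value `V j` and
the edge `e`. Completing the square in `h e` leaves `h |V j|² / 4`. -/
theorem h_mul_norm_sq_le (V : 𝒯.Nodal) (j : ZMod 𝒯.N) :
    𝒯.h * ‖V j‖ ^ 2 ≤ 4 * 𝒯.gram V V := by
  have h1 := 𝒯.integral_elem_le (F := fun θ => ⟪𝒯.lift V θ, 𝒯.lift V θ⟫)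
    ((𝒯.bddMeas_lift V).inner (𝒯.bddMeas_lift V)).intervalIntegrable
    (fun x => by simp only [𝒯.lift_periodic V x]) (fun x => real_inner_self_nonneg) j
  have hh := 𝒯.h_pos
  have h2 : ∫ θ in (𝒯.node (j.val : ℤ))..(𝒯.node ((j.val : ℤ) + 1)),
      (⟪𝒯.lift V θ, 𝒯.lift V θ⟫ : ℝ) = 𝒯.h * ‖V j‖ ^ 2
        + 𝒯.h ^ 2 * ⟪V j, 𝒯.edge V j⟫ + 𝒯.h ^ 3 / 3 * ‖𝒯.edge V j‖ ^ 2 := by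
    rw [intervalIntegral.integral_congr_Ioo_of_le (g := fun θ =>
      (fun s : ℝ => ‖V j‖ ^ 2 + (2 * ⟪V j, 𝒯.edge V j⟫) * s + ‖𝒯.edge V j‖ ^ 2 * s ^ 2)
        (θ - 𝒯.node (j.val : ℤ))) (𝒯.node_lt_succ _).le]
    · rw [intervalIntegral.integral_comp_sub_right (fun s : ℝ =>
        ‖V j‖ ^ 2 + (2 * ⟪V j, 𝒯.edge V j⟫) * s + ‖𝒯.edge V j‖ ^ 2 * s ^ 2), sub_self, node_succ, add_sub_cancel_left,
        intervalIntegral.integral_add, intervalIntegral.integral_add,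
        intervalIntegral.integral_const_mul, intervalIntegral.integral_const_mul, integral_pow,
        integral_id, intervalIntegral.integral_const]
      · norm_num
        ring
      all_goals exact Continuous.intervalIntegrable (by fun_prop) _ _
    · intro x hx
      have hj : ((j.val : ℤ) : ZMod 𝒯.N) = j := by
        rw [Int.cast_natCast, ZMod.natCast_zmod_val]
      simp only [𝒯.lift_eq_of_mem V ⟨hx.1.le, hx.2.le⟩, inner_plane, norm_sq_plane, hj,
        PiLp.add_apply, PiLp.smul_apply, smul_eq_mul]
      ring
  have h3 : 0 ≤ 𝒯.h / 3 * ((3 / 2 * V j 0 + 𝒯.h * 𝒯.edge V j 0) ^ 2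
      + (3 / 2 * V j 1 + 𝒯.h * 𝒯.edge V j 1) ^ 2) := by positivity
  rw [h2] at h1
  have h4 : 𝒯.h * ‖V j‖ ^ 2 + 𝒯.h ^ 2 * ⟪V j, 𝒯.edge V j⟫ + 𝒯.h ^ 3 / 3 * ‖𝒯.edge V j‖ ^ 2
      = 𝒯.h * ‖V j‖ ^ 2 / 4 + 𝒯.h / 3 * ((3 / 2 * V j 0 + 𝒯.h * 𝒯.edge V j 0) ^ 2
      + (3 / 2 * V j 1 + 𝒯.h * 𝒯.edge V j 1) ^ 2) := by
    rw [inner_plane, norm_sq_plane, norm_sq_plane]; ring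
  change _ ≤ 𝒯.gram V V at h1
  linarith

theorem stiff_self_nonneg (V : 𝒯.Nodal) : 0 ≤ 𝒯.stiff V V :=
  integral_nonneg fun _ => real_inner_self_nonneg

theorem gram_self_nonneg (V : 𝒯.Nodal) : 0 ≤ 𝒯.gram V V :=
  integral_nonneg fun _ => real_inner_self_nonneg

end Mesh

/-- Coercivity, by dropping the square of the cross product. Tangential velocities are controlled
only with the factor `α`, which is the origin of `1/α` in the exponent of the estimate. -/
theorem le_form_self {α : ℝ} (h1 : α ≤ 1) (s v : Plane) :
    α * ‖s‖ ^ 2 * ‖v‖ ^ 2 ≤ form α s v v := by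
  rw [form, real_inner_self_eq_norm_sq]
  nlinarith [mul_self_nonneg (cross s v)]

theorem form_self_nonneg {α : ℝ} (h0 : 0 ≤ α) (h1 : α ≤ 1) (s v : Plane) : 0 ≤ form α s v v :=
  le_trans (by positivity) (le_form_self h1 s v)

namespace Mesh

variable (𝒯 : Mesh)

theorem mass_self_nonneg {α : ℝ} (h0 : 0 ≤ α) (h1 : α ≤ 1) (Y V : 𝒯.Nodal) :
    0 ≤ 𝒯.mass α Y V V :=
  integral_nonneg fun _ => form_self_nonneg h0 h1 _ _

theorem le_mass_self {α : ℝ} (h0 : 0 ≤ α) (h1 : α ≤ 1) (Y V : 𝒯.Nodal) {m : ℝ} (hm : 0 ≤ m)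
    (hY : ∀ j, m ≤ ‖𝒯.edge Y j‖) : α * m ^ 2 * 𝒯.gram V V ≤ 𝒯.mass α Y V V := by
  rw [gram, ← integral_const_mul]
  refine integral_mono ((((𝒯.bddMeas_lift V).inner (𝒯.bddMeas_lift V)).integrable _).const_mul _)
    (𝒯.integrable_form α Y V V) fun θ => ?_
  refine le_trans ?_ (le_form_self h1 _ _)
  rw [real_inner_self_eq_norm_sq]
  have := hY (𝒯.idx θ)
  change m ≤ ‖𝒯.slope Y θ‖ at this
  gcongr

/-! ### The vector field of the scheme -/

/-- Polygons without degenerate edges. -/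
def nondegenerate : Set 𝒯.Nodal := {Y | ∀ j, 𝒯.edge Y j ≠ 0}

theorem continuous_edge (j : ZMod 𝒯.N) : Continuous fun Y : 𝒯.Nodal => 𝒯.edge Y j := by
  unfold edge; fun_prop

theorem isOpen_nondegenerate : IsOpen 𝒯.nondegenerate := by
  have : 𝒯.nondegenerate = ⋂ j, (fun Y : 𝒯.Nodal => 𝒯.edge Y j) ⁻¹' {0}ᶜ := by
    ext Y; simp [nondegenerate]
  rw [this]
  exact isOpen_iInter_of_finite fun j => isOpen_compl_singleton.preimage (𝒯.continuous_edge j)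

/-- There are finitely many edges, so the shortest has positive length and the mass form is
definite. Injectivity into the dual suffices because the dimensions agree. -/
theorem massL_isInvertible {α : ℝ} (h0 : 0 < α) (h1 : α ≤ 1) {Y : 𝒯.Nodal}
    (hY : Y ∈ 𝒯.nondegenerate) : (𝒯.massL α Y).IsInvertible := by
  obtain ⟨j₀, hj₀⟩ := Finite.exists_min fun j => ‖𝒯.edge Y j‖
  have hm : 0 < ‖𝒯.edge Y j₀‖ := norm_pos_iff.2 (hY j₀)
  have hinj : Function.Injective (𝒯.massL α Y : 𝒯.Nodal →ₗ[ℝ] 𝒯.Nodal →L[ℝ] ℝ) := by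
    refine (injective_iff_map_eq_zero _).2 fun V hV => ?_
    have h2 : 𝒯.mass α Y V V = 0 := by
      rw [← massL_apply]
      simpa using DFunLike.congr_fun hV V
    have h3 := 𝒯.le_mass_self h0.le h1 Y V hm.le hj₀
    rw [h2] at h3
    have h4 : 𝒯.gram V V ≤ 0 := by
      by_contra! h
      have : 0 < α * ‖𝒯.edge Y j₀‖ ^ 2 * 𝒯.gram V V := by positivity
      linarith
    funext j
    have h5 := 𝒯.h_mul_norm_sq_le V j
    have h6 : ‖V j‖ ^ 2 ≤ 0 := by
      by_contra! h
      have := mul_pos 𝒯.h_pos h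
      linarith
    simpa using le_antisymm h6 (sq_nonneg _)
  have hdim : Module.finrank ℝ 𝒯.Nodal = Module.finrank ℝ (𝒯.Nodal →L[ℝ] ℝ) := by
    rw [← (LinearMap.toContinuousLinearMap (𝕜 := ℝ) (E := 𝒯.Nodal) (F' := ℝ)).finrank_eq]
    exact (Subspace.dual_finrank_eq (K := ℝ) (V := 𝒯.Nodal)).symm
  let e := (LinearMap.linearEquivOfInjective _ hinj hdim).toContinuousLinearEquiv
  exact ⟨e, by ext; rfl⟩

/-- The velocity that the scheme assigns to a polygon. -/
noncomputable def velocity (α : ℝ) (Y : 𝒯.Nodal) : 𝒯.Nodal :=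
  -(𝒯.massL α Y).inverse (𝒯.stiffL Y)

theorem velocity_spec {α : ℝ} (h0 : 0 < α) (h1 : α ≤ 1) {Y : 𝒯.Nodal}
    (hY : Y ∈ 𝒯.nondegenerate) (V : 𝒯.Nodal) :
    (∀ W, 𝒯.mass α Y V W + 𝒯.stiff Y W = 0) ↔ V = 𝒯.velocity α Y := by
  obtain ⟨e, he⟩ := 𝒯.massL_isInvertible h0 h1 hY
  have h2 : (∀ W, 𝒯.mass α Y V W + 𝒯.stiff Y W = 0) ↔ e V = -𝒯.stiffL Y := by
    constructor
    · intro h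
      ext1 W
      change (e : 𝒯.Nodal →L[ℝ] 𝒯.Nodal →L[ℝ] ℝ) V W = _
      rw [he, massL_apply, neg_apply, stiffL_apply]
      linarith [h W]
    · intro h W
      have := DFunLike.congr_fun h W
      change (e : 𝒯.Nodal →L[ℝ] 𝒯.Nodal →L[ℝ] ℝ) V W = _ at this
      rw [he, massL_apply, neg_apply, stiffL_apply] at this
      linarith
  rw [h2, velocity, ← he, ContinuousLinearMap.inverse_equiv, ← e.eq_symm_apply, map_neg]
  rfl

theorem contDiffAt_velocity {α : ℝ} (h0 : 0 < α) (h1 : α ≤ 1) {Y : 𝒯.Nodal}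
    (hY : Y ∈ 𝒯.nondegenerate) : ContDiffAt ℝ ∞ (𝒯.velocity α) Y := by
  have h2 : ContDiffAt ℝ ∞ (fun Z => (𝒯.massL α Z).inverse) Y :=
    ContDiffAt.comp (g := ContinuousLinearMap.inverse) Y
      (𝒯.massL_isInvertible h0 h1 hY).contDiffAt_map_inverse (𝒯.contDiff_massL α).contDiffAt
  exact (h2.clm_apply 𝒯.stiffL.contDiff.contDiffAt).neg

/-- A unit normal field to a polygon. -/
theorem exists_isUnitNormalField (Y : 𝒯.Nodal) : ∃ ν, 𝒯.IsUnitNormalField (𝒯.lift Y) ν := by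
  have h1 : ∀ s : Plane, ∃ n : Plane, ‖n‖ = 1 ∧ (⟪n, s⟫ : ℝ) = 0 := by
    intro s
    by_cases hs : s = 0
    · exact ⟨EuclideanSpace.single 0 1, by simp, by simp [hs]⟩
    · refine ⟨‖s‖⁻¹ • !₂[-(s 1), s 0], ?_, ?_⟩
      · have : ‖(!₂[-(s 1), s 0] : Plane)‖ = ‖s‖ := by
          rw [← sq_eq_sq₀ (norm_nonneg _) (norm_nonneg _), norm_sq_plane, norm_sq_plane]
          simp [add_comm]
        rw [norm_smul, this, norm_inv, norm_norm, inv_mul_cancel₀ (norm_ne_zero_iff.2 hs)]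
      · rw [real_inner_smul_left, inner_plane]
        simp; right; ring
  choose n hn1 hn2 using h1
  refine ⟨fun θ => n (𝒯.slope Y θ), fun θ => by simp only [𝒯.slope_periodic Y θ], fun j =>
    ⟨n (𝒯.edge Y j), hn1 _, ?_, fun θ hθ => by simp only [𝒯.slope_eq_of_mem Y hθ]⟩⟩
  rw [lift_node, lift_node, Int.cast_add, Int.cast_one, ← h_smul_edge, real_inner_smul_right, hn2,
    mul_zero]

theorem IsUnitNormalField.norm_inner {Y : 𝒯.Nodal} {ν : ℝ → Plane}
    (hν : 𝒯.IsUnitNormalField (𝒯.lift Y) ν) (θ : ℝ) :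
    ‖ν θ‖ = 1 ∧ (⟪ν θ, 𝒯.slope Y θ⟫ : ℝ) = 0 := by
  obtain ⟨n, h1, h2, h3⟩ := hν.2 (𝒯.idx θ)
  rw [h3 θ (𝒯.mem_Ico_idx θ)]
  refine ⟨h1, ?_⟩
  rw [lift_node, lift_node, Int.cast_add, Int.cast_one, ← h_smul_edge, real_inner_smul_right] at h2
  exact (mul_eq_zero.1 h2).resolve_left 𝒯.h_pos.ne'

/-- For every unit normal field the integrand is the same `form`, since the almost everywhere
derivative of a mesh function is its slope. Existence of one such field is what makes the
universally quantified equation informative. -/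
theorem schemeEquation_iff (α : ℝ) (Y V : 𝒯.Nodal) :
    SchemeEquation α 𝒯 (𝒯.lift Y) (𝒯.lift V) ↔ ∀ W, 𝒯.mass α Y V W + 𝒯.stiff Y W = 0 := by
  have key : ∀ ν, 𝒯.IsUnitNormalField (𝒯.lift Y) ν → ∀ W : 𝒯.Nodal,
      (∫ θ in (0)..(2 * Real.pi),
        (α * ⟪𝒯.lift V θ, 𝒯.lift W θ⟫ + (1 - α) * (⟪𝒯.lift V θ, ν θ⟫ * ⟪ν θ, 𝒯.lift W θ⟫))
          * ‖deriv (𝒯.lift Y) θ‖ ^ 2)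
      + ∫ θ in (0)..(2 * Real.pi), ⟪deriv (𝒯.lift Y) θ, deriv (𝒯.lift W) θ⟫
      = 𝒯.mass α Y V W + 𝒯.stiff Y W := by
    intro ν hν W
    rw [integral_circle, integral_circle, mass, stiff]
    congr 1
    · refine integral_congr_ae ?_
      filter_upwards [ae_circle (𝒯.ae_deriv_lift Y)] with θ hθ
      obtain ⟨h1, h2⟩ := IsUnitNormalField.norm_inner 𝒯 hν θ
      rw [hθ, form_eq_of_unit_normal h1 h2]
    · refine integral_congr_ae ?_
      filter_upwards [ae_circle (𝒯.ae_deriv_lift Y), ae_circle (𝒯.ae_deriv_lift W)] with θ h1 h2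
      rw [h1, h2]
  constructor
  · intro h W
    obtain ⟨ν, hν⟩ := 𝒯.exists_isUnitNormalField Y
    rw [← key ν hν W]
    exact h ν hν _ (𝒯.lift_mem_space2 W)
  · intro h ν hν φ hφ
    rw [𝒯.eq_lift_of_mem_space2 hφ, key ν hν]
    exact h _

end Mesh

/-! ### Ordinary differential equations -/

open Topology in
/-- A vector field that is smooth near a compact set agrees there with a globally Lipschitz and
bounded one. -/
theorem exists_lipschitz_extension {E : Type*} [NormedAddCommGroup E] [NormedSpace ℝ E]
    [FiniteDimensional ℝ E] {F : E → E} {K U : Set E} (hK : IsCompact K) (hU : IsOpen U)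
    (hKU : K ⊆ U) (hF : ∀ x ∈ U, ContDiffAt ℝ ∞ F x) :
    ∃ G : E → E, EqOn G F K ∧ (∃ L, LipschitzWith L G) ∧ ∃ B, ∀ x, ‖G x‖ ≤ B := by
  obtain ⟨K', hK', hKK', hK'U⟩ := exists_compact_between hK hU hKU
  obtain ⟨f, hf1, hf0, -⟩ := exists_contMDiffMap_one_nhds_of_subset_interior
    (n := ⊤) (modelWithCornersSelf ℝ E) hK.isClosed hKK'
  have hfs : ContDiff ℝ ∞ f := f.contMDiff.contDiff
  -- The cut-off `f` is one near `K` and vanishes off the compact `K' ⊆ U`. The product is smooth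
  -- with compact support, hence Lipschitz and bounded, whatever `F` does outside `U`.
  set G : E → E := fun x => f x • F x with hG
  have hsupp : tsupport G ⊆ K' := by
    refine closure_minimal (fun x hx => ?_) hK'.isClosed
    by_contra h
    exact hx (by simp [hG, hf0 x h])
  have hcs : HasCompactSupport G := hK'.of_isClosed_subset (isClosed_tsupport _) hsupp
  have hGs : ContDiff ℝ ∞ G := by
    refine contDiff_iff_contDiffAt.2 fun x => ?_
    by_cases hx : x ∈ U
    · exact hfs.contDiffAt.smul (hF x hx)
    · have : G =ᶠ[𝓝 x] fun _ => 0 := by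
        filter_upwards [(isClosed_tsupport G).isOpen_compl.mem_nhds
          (fun h => hx (hK'U (hsupp h)))] with y hy
        exact image_eq_zero_of_notMem_tsupport hy
      exact contDiffAt_const.congr_of_eventuallyEq this
  refine ⟨G, fun x hx => ?_, ContDiff.lipschitzWith_of_hasCompactSupport hcs hGs (by simp),
    hcs.exists_bound_of_continuous hGs.continuous⟩
  simp [hG, hf1.self_of_nhdsSet x hx]

/-- As `‖G‖ ≤ B` everywhere, a solution cannot leave the ball of radius `B T`. Picard–Lindelöf on
that ball therefore covers the whole interval, with no smallness of `T`. -/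
theorem exists_ode_solution {E : Type*} [NormedAddCommGroup E] [NormedSpace ℝ E] [CompleteSpace E]
    {G : E → E} {L : NNReal} (hL : LipschitzWith L G) {B : ℝ} (hB : ∀ x, ‖G x‖ ≤ B) {T : ℝ}
    (hT : 0 ≤ T) (y₀ : E) :
    ∃ y : ℝ → E, y 0 = y₀ ∧ ∀ t ∈ Icc 0 T, HasDerivWithinAt y (G (y t)) (Icc 0 T) t := by
  have hB0 : 0 ≤ B := (norm_nonneg _).trans (hB y₀)
  lift B to NNReal using hB0
  lift T to NNReal using hT
  have h : IsPicardLindelof (fun _ => G) (tmin := 0) (tmax := T) ⟨0, le_rfl, T.2⟩ y₀ (B * T) 0 B L :=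
    .of_time_independent (fun x _ => hB x) hL.lipschitzOnWith (by simp)
  exact h.exists_eq_forall_mem_Icc_hasDerivWithinAt₀

/-- The function `exp(-a s) (Z s + b/a)` has nonpositive derivative. -/
theorem gronwall {Z Z' : ℝ → ℝ} {a b t : ℝ} (ha : 0 < a) (ht : 0 ≤ t)
    (hc : ContinuousOn Z (Icc 0 t)) (hd : ∀ s ∈ Ioo 0 t, HasDerivAt Z (Z' s) s)
    (hle : ∀ s ∈ Ioo 0 t, Z' s ≤ a * Z s + b) :
    Z t ≤ (Z 0 + b / a) * Real.exp (a * t) - b / a := by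
  set g : ℝ → ℝ := fun s => Real.exp (-a * s) * (Z s + b / a) with hg
  have hd' : ∀ s ∈ Ioo 0 t, HasDerivAt g
      (Real.exp (-a * s) * (-a * 1) * (Z s + b / a) + Real.exp (-a * s) * Z' s) s := fun s hs =>
    (((hasDerivAt_id s).const_mul (-a)).exp).mul ((hd s hs).add_const _)
  have hanti : AntitoneOn g (Icc 0 t) := by
    refine antitoneOn_of_deriv_nonpos (convex_Icc 0 t) (by fun_prop) ?_ ?_
    · rw [interior_Icc]
      exact fun s hs => (hd' s hs).differentiableAt.differentiableWithinAt
    · rw [interior_Icc]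
      intro s hs
      rw [(hd' s hs).deriv]
      have e : Real.exp (-a * s) * (-a * 1) * (Z s + b / a) + Real.exp (-a * s) * Z' s
          = -(Real.exp (-a * s) * (a * Z s + b - Z' s)) := by field_simp; ring
      rw [e]
      have := hle s hs
      exact neg_nonpos.2 (mul_nonneg (Real.exp_pos _).le (by linarith))
  have h1 := hanti ⟨le_rfl, ht⟩ ⟨ht, le_rfl⟩ ht
  simp only [hg, mul_zero, Real.exp_zero, one_mul] at h1
  have h2 : Real.exp (a * t) * Real.exp (-a * t) = 1 := by
    rw [← Real.exp_add]; simp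
  have h3 := mul_le_mul_of_nonneg_left h1 (Real.exp_pos (a * t)).le
  rw [← mul_assoc, h2, one_mul] at h3
  linarith

/-- Continuous induction: a bound that improves itself is preserved. -/
theorem le_of_bootstrap {f : ℝ → ℝ} {T ε : ℝ} (hc : ContinuousOn f (Icc 0 T)) (h0 : f 0 ≤ ε)
    (h : ∀ t ∈ Icc 0 T, (∀ s ∈ Icc 0 t, f s ≤ ε) → f t < ε) : ∀ t ∈ Icc 0 T, f t ≤ ε := by
  set S : Set ℝ := {t | t ∈ Icc 0 T → f t ≤ ε} with hS
  have hcl : IsClosed (S ∩ Icc 0 T) := by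
    have : S ∩ Icc 0 T = Icc 0 T ∩ f ⁻¹' Iic ε := by
      ext t; simp only [hS, mem_inter_iff, mem_ofPred_eq, mem_preimage, mem_Iic]; tauto
    rw [this]
    exact hc.preimage_isClosed_of_isClosed isClosed_Icc isClosed_Iic
  have hsub := hcl.Icc_subset_of_forall_mem_nhdsGT_of_Icc_subset (fun _ => h0) fun t ht hts => by
    have h1 : f t < ε := h t ⟨ht.1, ht.2.le⟩ fun s hs => hts hs ⟨hs.1, hs.2.trans ht.2.le⟩
    have h2 := (hc t ⟨ht.1, ht.2.le⟩).eventually (gt_mem_nhds h1)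
    rw [eventually_nhdsWithin_iff] at h2
    filter_upwards [mem_nhdsWithin_of_mem_nhds h2] with s hs hsT
    exact (hs hsT).le
  exact fun t ht => hsub ht ht

/-! ### Weak derivatives in one variable -/

/-- Integration by parts for absolutely continuous functions: the primitive of `g` is absolutely
continuous and differentiable almost everywhere with derivative `g`. -/
theorem integral_deriv_mul_primitive {ψ g : ℝ → ℝ} {L : ℝ} (hψ : ContDiff ℝ ∞ ψ)
    (hg : IntervalIntegrable g volume 0 L) :
    ∫ x in (0)..L, deriv ψ x * (∫ s in (0)..x, g s)
      = ψ L * (∫ s in (0)..L, g s) - ∫ x in (0)..L, ψ x * g x := by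
  have hG := hg.absolutelyContinuousOnInterval_intervalIntegral (c := 0) (by simp)
  have hψ' : AbsolutelyContinuousOnInterval ψ 0 L :=
    (hψ.of_le (m := 1) (by simp)).contDiffOn.absolutelyContinuousOnInterval
  have h := hψ'.integral_mul_deriv_eq_deriv_mul hG
  have h2 : ∫ x in (0)..L, ψ x * deriv (fun x => ∫ s in (0)..x, g s) x
      = ∫ x in (0)..L, ψ x * g x := by
    refine intervalIntegral.integral_congr_ae ?_
    filter_upwards [hg.ae_hasDerivAt_integral] with x hx hx'
    rw [(hx (uIoc_subset_uIcc hx') 0 (by simp)).deriv]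
  rw [h2] at h
  simp only [intervalIntegral.integral_same, mul_zero, sub_zero] at h
  linarith

/-- The primitive from `0` vanishes to the left of the support of `η`, and by the zero mean also to
the right of it. So the test functions that are derivatives of test functions are exactly those of
mean zero. -/
theorem exists_test_primitive {η : ℝ → ℝ} {T : ℝ} (hη : ContDiff ℝ ∞ η)
    (hs : HasCompactSupport η) (hsT : tsupport η ⊆ Ioo 0 T) (h0 : ∫ x in (0)..T, η x = 0) :
    ∃ ψ : ℝ → ℝ, ContDiff ℝ ∞ ψ ∧ HasCompactSupport ψ ∧ tsupport ψ ⊆ Ioo 0 T ∧ deriv ψ = η := by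
  rcases eq_empty_or_nonempty (tsupport η) with he | hne
  · have : η = 0 := tsupport_eq_empty_iff.1 he
    exact ⟨0, contDiff_const, HasCompactSupport.zero, by simp [tsupport], by simp [this]⟩
  obtain ⟨a, ha, hamin⟩ := hs.isCompact.exists_isMinOn hne continuousOn_id
  obtain ⟨b, hb, hbmax⟩ := hs.isCompact.exists_isMaxOn hne continuousOn_id
  have hz : ∀ x, x ∉ Icc a b → η x = 0 := fun x hx =>
    image_eq_zero_of_notMem_tsupport fun h => hx ⟨hamin h, hbmax h⟩
  set ψ : ℝ → ℝ := fun x => ∫ s in (0)..x, η s with hψ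
  have hd : ∀ x, HasDerivAt ψ (η x) x := fun x =>
    intervalIntegral.integral_hasDerivAt_right (hη.continuous.intervalIntegrable _ _)
      (hη.continuous.stronglyMeasurableAtFilter _ _) hη.continuous.continuousAt
  have hderiv : deriv ψ = η := funext fun x => (hd x).deriv
  have ha0 := (hsT ha).1
  have hbT := (hsT hb).2
  have hsupp : Function.support ψ ⊆ Icc a b := by
    intro x hx
    by_contra h
    refine hx ?_
    rcases lt_or_ge x a with hxa | hxa
    · refine (intervalIntegral.integral_congr (g := fun _ => 0) fun s hs => hz s fun h => ?_).trans
        (by simp)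
      rcases le_max_iff.1 hs.2 with h3 | h3 <;> linarith [h.1]
    · have hxb : b < x := by
        by_contra! h'
        exact h ⟨hxa, h'⟩
      have h3 := intervalIntegral.integral_add_adjacent_intervals
        (hη.continuous.intervalIntegrable (μ := volume) 0 T)
        (hη.continuous.intervalIntegrable (μ := volume) T x)
      rw [hψ]
      simp only
      rw [← h3, h0, zero_add]
      refine (intervalIntegral.integral_congr (g := fun _ => 0) fun s hs => hz s fun h => ?_).trans
        (by simp)
      rcases min_le_iff.1 hs.1 with h3 | h3 <;> linarith [h.2]
  have hts : tsupport ψ ⊆ Icc a b := closure_minimal hsupp isClosed_Icc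
  refine ⟨ψ, contDiff_infty_iff_deriv.2 ⟨fun x => (hd x).differentiableAt, hderiv ▸ hη⟩,
    isCompact_Icc.of_isClosed_subset (isClosed_tsupport _) hts, fun x hx => ?_, hderiv⟩
  have := hts hx
  exact ⟨ha0.trans_le this.1, this.2.trans_lt hbT⟩

/-- The lemma of du Bois-Reymond for continuous functions. -/
theorem eq_of_integral_deriv_mul_eq_zero {w : ℝ → ℝ} {T : ℝ} (hT : 0 < T)
    (hw : ContinuousOn w (Icc 0 T))
    (h : ∀ ψ : ℝ → ℝ, ContDiff ℝ ∞ ψ → HasCompactSupport ψ → tsupport ψ ⊆ Ioo 0 T →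
      ∫ x in (0)..T, deriv ψ x * w x = 0) :
    ∀ t ∈ Icc 0 T, w t = w 0 := by
  let χ : ContDiffBump (T / 2) := ⟨T / 8, T / 4, by positivity, by linarith⟩
  set χ' : ℝ → ℝ := χ.normed volume with hχ'
  have hχs : tsupport χ' ⊆ Ioo 0 T := by
    rw [hχ', χ.tsupport_normed_eq]
    intro x hx
    rw [Real.closedBall_eq_Icc] at hx
    have h1 : T / 2 - T / 4 ≤ x := hx.1
    have h2 : x ≤ T / 2 + T / 4 := hx.2
    constructor <;> linarith
  have full : ∀ f : ℝ → ℝ, tsupport f ⊆ Ioo 0 T → ∫ x in (0)..T, f x = ∫ x, f x := by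
    intro f hf
    refine intervalIntegral.integral_eq_integral_of_support_subset fun x hx => ?_
    have := hf (subset_tsupport f hx)
    exact ⟨this.1, this.2.le⟩
  have hwi : IntervalIntegrable w volume 0 T := by
    refine ContinuousOn.intervalIntegrable ?_
    rwa [uIcc_of_le hT.le]
  set c : ℝ := ∫ x in (0)..T, χ' x * w x with hc
  have key : ∀ φ : ℝ → ℝ, ContDiff ℝ ∞ φ → HasCompactSupport φ → tsupport φ ⊆ Ioo 0 T →
      ∫ x, φ x • (w x - c) = 0 := by
    intro φ hφ hφc hφT
    -- Subtracting the right multiple of the normalized bump `χ'` makes the mean zero, so `η` is the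
    -- derivative of a test function. The hypothesis on it says that `w - c` is orthogonal to `φ`.
    set η : ℝ → ℝ := fun x => φ x - (∫ y in (0)..T, φ y) * χ' x with hη
    have hχd : ContDiff ℝ ∞ χ' := χ.contDiff_normed
    have hηt : tsupport η ⊆ tsupport φ ∪ tsupport χ' := by
      refine closure_minimal (fun x hx => ?_) ((isClosed_tsupport _).union (isClosed_tsupport _))
      by_contra hn
      simp only [mem_union, not_or] at hn
      exact hx (by simp [hη, image_eq_zero_of_notMem_tsupport hn.1,
        image_eq_zero_of_notMem_tsupport hn.2])
    have hηT : tsupport η ⊆ Ioo 0 T := hηt.trans (union_subset hφT hχs)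
    have hηc : HasCompactSupport η :=
      (hφc.isCompact.union χ.hasCompactSupport_normed.isCompact).of_isClosed_subset
        (isClosed_tsupport _) hηt
    have hφi := hφ.continuous.intervalIntegrable (μ := volume) 0 T
    have hχi := hχd.continuous.intervalIntegrable (μ := volume) 0 T
    have h0 : ∫ x in (0)..T, η x = 0 := by
      rw [hη]
      simp only
      rw [intervalIntegral.integral_sub hφi (hχi.const_mul _), intervalIntegral.integral_const_mul,
        full χ' hχs, hχ', χ.integral_normed]
      ring
    obtain ⟨ψ, h1, h2, h3, h4⟩ := exists_test_primitive (hφ.sub (contDiff_const.mul hχd)) hηc hηT h0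
    have h5 := h ψ h1 h2 h3
    have h6 : ∫ x in (0)..T, φ x * w x = (∫ y in (0)..T, φ y) * c := by
      rw [h4] at h5
      have h7 : IntervalIntegrable (fun x => φ x * w x) volume 0 T :=
        hwi.continuousOn_mul hφ.continuous.continuousOn
      have h8 : IntervalIntegrable (fun x => χ' x * w x) volume 0 T :=
        hwi.continuousOn_mul hχd.continuous.continuousOn
      simp only [sub_mul, mul_assoc] at h5
      rw [intervalIntegral.integral_sub h7 (h8.const_mul _), intervalIntegral.integral_const_mul]
        at h5
      linarith
    rw [← full]
    · simp only [smul_eq_mul, mul_sub]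
      rw [intervalIntegral.integral_sub (hwi.continuousOn_mul hφ.continuous.continuousOn)
        (hφi.mul_const _), intervalIntegral.integral_mul_const, h6, sub_self]
    · exact (tsupport_smul_subset_left _ _).trans hφT
  have hae := isOpen_Ioo.ae_eq_zero_of_integral_contDiff_smul_eq_zero (μ := volume)
    (f := fun x => w x - c)
    (((hw.mono Ioo_subset_Icc_self).sub continuousOn_const).locallyIntegrableOn measurableSet_Ioo)
    key
  have heq : EqOn w (fun _ => c) (Icc 0 T) := by
    refine Measure.eqOn_of_ae_eq (μ := volume) ?_ hw continuousOn_const ?_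
    · rw [← restrict_Ioo_eq_restrict_Icc]
      refine (ae_restrict_iff' measurableSet_Ioo).2 ?_
      filter_upwards [hae] with x hx hx'
      exact sub_eq_zero.1 (hx hx')
    · rw [interior_Icc, closure_Ioo hT.ne]
  intro t ht
  rw [heq ht, heq ⟨le_rfl, hT.le⟩]

/-- In each coordinate, `u` minus the primitive of `g` is continuous with zero weak derivative,
hence constant. This gives weak solutions an integral equation valid at every time. -/
theorem MemH1Time.sub_eq_integral {T : ℝ} (hT : 0 < T) {u g : ℝ → Plane} (hu : MemH1Time T u g)
    (hc : ContinuousOn u (Icc 0 T)) {t : ℝ} (ht : t ∈ Icc 0 T) :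
    u t - u 0 = ∫ s in (0)..t, g s := by
  have hgi : IntegrableOn g (Ioo 0 T) := by
    have := hu.2.1.mono_exponent (p := 1) (by norm_num)
    exact memLp_one_iff_integrable.1 this
  have hgI : IntervalIntegrable g volume 0 T := by
    rw [intervalIntegrable_iff_integrableOn_Ioo_of_le hT.le]; exact hgi
  have huI : IntervalIntegrable u volume 0 T := by
    refine ContinuousOn.intervalIntegrable ?_
    rwa [uIcc_of_le hT.le]
  have coordI : ∀ {f : ℝ → Plane} {a b : ℝ}, IntervalIntegrable f volume a b → ∀ i : Fin 2,
      IntervalIntegrable (fun s => f s i) volume a b ∧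
      (∫ s in a..b, f s) i = ∫ s in a..b, f s i := by
    intro f a b hf i
    exact ⟨⟨(EuclideanSpace.proj (𝕜 := ℝ) i).integrable_comp hf.1,
      (EuclideanSpace.proj (𝕜 := ℝ) i).integrable_comp hf.2⟩,
      ((EuclideanSpace.proj (𝕜 := ℝ) i).intervalIntegral_comp_comm hf).symm⟩
  ext i
  have hgi' := (coordI hgI i).1
  set G : ℝ → ℝ := fun x => ∫ s in (0)..x, g s i with hG
  have hGc : ContinuousOn G (Icc 0 T) := by
    have := (hgi'.absolutelyContinuousOnInterval_intervalIntegral (c := 0) (by simp)).continuousOn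
    rwa [uIcc_of_le hT.le] at this
  have huc : ContinuousOn (fun x => u x i) (Icc 0 T) := by fun_prop
  have hw := eq_of_integral_deriv_mul_eq_zero hT (huc.sub hGc) fun ψ h1 h2 h3 => by
    have hψ' : Continuous (deriv ψ) := h1.continuous_deriv (by simp)
    have e1 := hu.2.2 ψ h1 h2 h3
    rw [← integral_Ioc_eq_integral_Ioo, ← integral_Ioc_eq_integral_Ioo,
      ← intervalIntegral.integral_of_le hT.le, ← intervalIntegral.integral_of_le hT.le] at e1
    have i1 : IntervalIntegrable (fun s => deriv ψ s • u s) volume 0 T :=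
      huI.continuousOn_smul hψ'.continuousOn
    have i2 : IntervalIntegrable (fun s => ψ s • g s) volume 0 T :=
      hgI.continuousOn_smul h1.continuous.continuousOn
    have e2 := congrArg (fun v : Plane => v i) e1
    simp only [PiLp.neg_apply] at e2
    rw [(coordI i1 i).2, (coordI i2 i).2] at e2
    simp only [PiLp.smul_apply, smul_eq_mul] at e2
    have hT0 : ψ T = 0 := image_eq_zero_of_notMem_tsupport fun h => lt_irrefl _ (h3 h).2
    have e3 := integral_deriv_mul_primitive h1 hgi'
    simp only [Pi.sub_apply, mul_sub]
    rw [intervalIntegral.integral_sub, e2, e3, hT0]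
    · ring
    · exact (coordI huI i).1.continuousOn_mul hψ'.continuousOn
    · refine ContinuousOn.intervalIntegrable ?_
      rw [uIcc_of_le hT.le]
      exact hψ'.continuousOn.mul hGc
  have h4 := hw t ht
  simp only [Pi.sub_apply, hG, intervalIntegral.integral_same, sub_zero] at h4
  have hgt : IntervalIntegrable g volume 0 t := by
    refine hgI.mono_set ?_
    rw [uIcc_of_le ht.1, uIcc_of_le hT.le]
    exact Icc_subset_Icc_right ht.2
  rw [PiLp.sub_apply, (coordI hgt i).2]
  linarith

theorem memH1Time_of_hasDerivAt {T : ℝ} (hT : 0 < T) {u g : ℝ → Plane}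
    (hu : ContinuousOn u (Icc 0 T)) (hg : ContinuousOn g (Icc 0 T))
    (hd : ∀ t ∈ Ioo 0 T, HasDerivAt u (g t) t) : MemH1Time T u g := by
  have hmem : ∀ {f : ℝ → Plane}, ContinuousOn f (Icc 0 T) →
      MemLp f 2 (volume.restrict (Ioo 0 T)) := by
    intro f hf
    obtain ⟨C, hC⟩ := isCompact_Icc.exists_bound_of_continuousOn hf
    refine MemLp.of_bound ((hf.mono Ioo_subset_Icc_self).aestronglyMeasurable measurableSet_Ioo) C ?_
    exact (ae_restrict_iff' measurableSet_Ioo).2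
      (ae_of_all _ fun x hx => hC x (Ioo_subset_Icc_self hx))
  refine ⟨hmem hu, hmem hg, fun ψ h1 _ h3 => ?_⟩
  rw [← integral_Ioc_eq_integral_Ioo, ← integral_Ioc_eq_integral_Ioo,
    ← intervalIntegral.integral_of_le hT.le, ← intervalIntegral.integral_of_le hT.le]
  have hψ' : Continuous (deriv ψ) := h1.continuous_deriv (by simp)
  have hψd : Differentiable ℝ ψ := h1.differentiable (by simp)
  have i1 : IntervalIntegrable (fun s => deriv ψ s • u s) volume 0 T := by
    refine ContinuousOn.intervalIntegrable ?_
    rw [uIcc_of_le hT.le]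
    exact hψ'.continuousOn.smul hu
  have i2 : IntervalIntegrable (fun s => ψ s • g s) volume 0 T := by
    refine ContinuousOn.intervalIntegrable ?_
    rw [uIcc_of_le hT.le]
    exact h1.continuous.continuousOn.smul hg
  have h4 := intervalIntegral.integral_eq_sub_of_hasDerivAt_of_le hT.le
    (h1.continuous.continuousOn.smul hu)
    (fun t ht => (hψd t).hasDerivAt.smul (hd t ht)) (i2.add i1)
  have hT0 : ψ T = 0 := image_eq_zero_of_notMem_tsupport fun h => lt_irrefl _ (h3 h).2
  have h00 : ψ 0 = 0 := image_eq_zero_of_notMem_tsupport fun h => lt_irrefl _ (h3 h).1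
  rw [intervalIntegral.integral_add i2 i1] at h4
  simp only [Pi.smul_apply', hT0, h00, zero_smul, sub_zero] at h4
  exact eq_neg_of_add_eq_zero_right h4

/-! ### Weak derivatives on the circle -/

theorem integral_coord {f : ℝ → Plane} {a b : ℝ} (hf : IntervalIntegrable f volume a b)
    (i : Fin 2) : IntervalIntegrable (fun s => f s i) volume a b ∧
      (∫ s in a..b, f s) i = ∫ s in a..b, f s i :=
  ⟨⟨(EuclideanSpace.proj (𝕜 := ℝ) i).integrable_comp hf.1,
    (EuclideanSpace.proj (𝕜 := ℝ) i).integrable_comp hf.2⟩,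
    ((EuclideanSpace.proj (𝕜 := ℝ) i).intervalIntegral_comp_comm hf).symm⟩

/-- A continuous periodic function with vanishing weak derivative is constant. -/
theorem eq_of_integral_deriv_mul_eq_zero_circle {w : ℝ → ℝ} (hw : Continuous w)
    (hp : Function.Periodic w (2 * Real.pi))
    (h : ∀ ψ : ℝ → ℝ, ContDiff ℝ ∞ ψ → Function.Periodic ψ (2 * Real.pi) →
      ∫ x in (0)..(2 * Real.pi), deriv ψ x * w x = 0) (t s : ℝ) : w t = w s := by
  have : Fact (0 < 2 * Real.pi) := ⟨Real.two_pi_pos⟩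
  have hpc : Function.Periodic (fun x => (w x : ℂ)) (2 * Real.pi) := fun x => by simp only [hp x]
  let F : C(AddCircle (2 * Real.pi), ℂ) :=
    ⟨hpc.lift, continuous_coinduced_dom.2 (Complex.continuous_ofReal.comp hw)⟩
  have hF : ∀ x : ℝ, F (x : AddCircle (2 * Real.pi)) = (w x : ℂ) := fun x => hpc.lift_coe x
  -- The real and imaginary parts of `exp(-i n x)` are derivatives of the periodic test functions
  -- `sin(n x)/n` and `cos(n x)/n`, so each coefficient with `n ≠ 0` vanishes. The Fourier series of
  -- `w` then consists of its constant term alone and converges pointwise.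
  have hcoef : ∀ n : ℤ, n ≠ 0 → fourierCoeff F n = 0 := by
    intro n hn
    rw [fourierCoeff_eq_intervalIntegral _ n 0, zero_add]
    have hn' : (n : ℝ) ≠ 0 := Int.cast_ne_zero.2 hn
    have e1 : ∀ x : ℝ, (fourier (-n) (x : AddCircle (2 * Real.pi)) : ℂ) • F x
        = ((Real.cos (n * x) * w x : ℝ) : ℂ) + ((-(Real.sin (n * x)) * w x : ℝ) : ℂ) * Complex.I := by
      intro x
      rw [fourier_coe_apply, hF]
      have : (2 * Real.pi * Complex.I * (-n : ℤ) * x / (2 * Real.pi : ℝ) : ℂ)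
          = ((-(n * x) : ℝ) : ℂ) * Complex.I := by
        have : (Real.pi : ℂ) ≠ 0 := Complex.ofReal_ne_zero.2 Real.pi_ne_zero
        push_cast
        field_simp
      rw [this, Complex.exp_mul_I, ← Complex.ofReal_cos, ← Complex.ofReal_sin, Real.cos_neg,
        Real.sin_neg, smul_eq_mul]
      push_cast
      ring
    have hs : ∫ x in (0)..(2 * Real.pi), Real.cos (n * x) * w x = 0 := by
      have hd : ∀ x, HasDerivAt (fun x : ℝ => (n : ℝ)⁻¹ * Real.sin (n * x)) (Real.cos (n * x)) x := by
        intro x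
        refine ((((hasDerivAt_id x).const_mul (n : ℝ)).sin).const_mul (n : ℝ)⁻¹).congr_deriv ?_
        simp only [id, mul_one]
        field_simp
      have := h (fun x : ℝ => (n : ℝ)⁻¹ * Real.sin (n * x)) (by fun_prop) (fun x => by
        simp only [mul_add]
        rw [Real.sin_add_int_mul_two_pi])
      simpa only [(hd _).deriv] using this
    have hc : ∫ x in (0)..(2 * Real.pi), -Real.sin (n * x) * w x = 0 := by
      have hd : ∀ x, HasDerivAt (fun x : ℝ => (n : ℝ)⁻¹ * Real.cos (n * x)) (-Real.sin (n * x)) x := by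
        intro x
        refine ((((hasDerivAt_id x).const_mul (n : ℝ)).cos).const_mul (n : ℝ)⁻¹).congr_deriv ?_
        simp only [id, mul_one]
        field_simp
      have := h (fun x : ℝ => (n : ℝ)⁻¹ * Real.cos (n * x)) (by fun_prop) (fun x => by
        simp only [mul_add]
        rw [Real.cos_add_int_mul_two_pi])
      simpa only [(hd _).deriv] using this
    simp only [e1]
    rw [intervalIntegral.integral_add, intervalIntegral.integral_mul_const,
      intervalIntegral.integral_ofReal, intervalIntegral.integral_ofReal, hs, hc]
    · simp
    all_goals exact Continuous.intervalIntegrable (by fun_prop) _ _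
  have hsum : Summable (fourierCoeff F) :=
    summable_of_ne_finset_zero (s := {0}) fun n hn => hcoef n (by simpa using hn)
  have hconst : ∀ x : ℝ, (w x : ℂ) = fourierCoeff F 0 := by
    intro x
    have h1 := has_pointwise_sum_fourier_series_of_summable hsum (x : AddCircle (2 * Real.pi))
    have h2 := hasSum_single (f := fun i => fourierCoeff F i • (fourier i
      (x : AddCircle (2 * Real.pi)) : ℂ)) 0 fun n hn => by rw [hcoef n hn, zero_smul]
    rw [← hF x, h1.unique h2]
    simp
  have := (hconst t).trans (hconst s).symm
  exact_mod_cast this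

/-- A continuous periodic function with a weak derivative in `L²` is the primitive of a periodic
function. -/
theorem HasWeakDerivCircle.exists_primitive {u : ℝ → Plane} (hu : Continuous u)
    (hp : Function.Periodic u (2 * Real.pi)) {g : Lp Plane 2 circleMeasure}
    (h : HasWeakDerivCircle u g) :
    ∃ G : ℝ → Plane, Function.Periodic G (2 * Real.pi) ∧
      (∀ a b, IntervalIntegrable G volume a b) ∧
      (∀ a b, IntervalIntegrable (fun x => ‖G x‖ ^ 2) volume a b) ∧
      (∀ a b, u b - u a = ∫ x in a..b, G x) ∧
      ∫ x, ‖G x‖ ^ 2 ∂circleMeasure = ‖g‖ ^ 2 := by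
  -- Periodic extension of a representative of `g`, which is determined only on one period. It makes
  -- integrals over mesh intervals crossing `2π` meaningful.
  set G : ℝ → Plane := fun x => g (toIcoMod Real.two_pi_pos 0 x) with hG
  have hGp : Function.Periodic G (2 * Real.pi) := fun x => by simp only [hG, toIcoMod_add_right]
  have hGg : ∀ x ∈ Ioo 0 (2 * Real.pi), G x = g x := fun x hx => by
    have : toIcoMod Real.two_pi_pos 0 x = x :=
      (toIcoMod_eq_self Real.two_pi_pos).2 ⟨hx.1.le, by simpa using hx.2⟩
    simp only [hG, this]
  have hGae : G =ᵐ[circleMeasure] g :=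
    (ae_restrict_iff' measurableSet_Ioo).2 (ae_of_all _ hGg)
  have hgm : MemLp g 2 circleMeasure := Lp.memLp g
  have hI : IntervalIntegrable G volume 0 (2 * Real.pi) := by
    rw [intervalIntegrable_iff_integrableOn_Ioo_of_le Real.two_pi_pos.le]
    exact (memLp_one_iff_integrable.1 (hgm.mono_exponent (p := 1) (by norm_num))).congr hGae.symm
  have hI2 : IntervalIntegrable (fun x => ‖G x‖ ^ 2) volume 0 (2 * Real.pi) := by
    rw [intervalIntegrable_iff_integrableOn_Ioo_of_le Real.two_pi_pos.le]
    have h1 : Integrable (fun x => ‖g x‖ ^ 2) circleMeasure := hgm.integrable_norm_pow (by norm_num)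
    exact h1.congr (hGae.symm.mono fun x hx => by simp only [hx])
  have hIall := fun a b => hGp.intervalIntegrable₀ Real.two_pi_pos.ne' hI a b
  refine ⟨G, hGp, hIall, fun a b => ?_, fun a b => ?_, ?_⟩
  · exact Function.Periodic.intervalIntegrable₀ (fun x => by simp only [hGp x])
      Real.two_pi_pos.ne' hI2 a b
  · have hmean : ∀ ψ : ℝ → ℝ, ContDiff ℝ ∞ ψ → Function.Periodic ψ (2 * Real.pi) → ∀ i : Fin 2,
        ∫ x in (0)..(2 * Real.pi), deriv ψ x * u x i
          = -∫ x in (0)..(2 * Real.pi), ψ x * G x i := by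
      intro ψ h1 h2 i
      have h3 := h ψ h1 h2
      have hψ' : Continuous (deriv ψ) := h1.continuous_deriv (by simp)
      have h4 : ∫ θ, ψ θ • g θ ∂circleMeasure = ∫ θ, ψ θ • G θ ∂circleMeasure :=
        integral_congr_ae (hGae.symm.mono fun x hx => by simp only [hx])
      rw [h4, ← integral_circle, ← integral_circle] at h3
      have h5 := congrArg (fun v : Plane => v i) h3
      simp only [PiLp.neg_apply] at h5
      rw [(integral_coord (f := fun θ => deriv ψ θ • u θ)
          ((hψ'.smul hu).intervalIntegrable _ _) i).2,
        (integral_coord (f := fun θ => ψ θ • G θ)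
          (hI.continuousOn_smul h1.continuous.continuousOn) i).2] at h5
      simpa using h5
    ext i
    rw [PiLp.sub_apply, (integral_coord (hIall a b) i).2]
    have hIi := fun a b => (integral_coord (hIall a b) i).1
    -- Testing with the constant `1` forces zero mean, and this is what makes the primitive `U`
    -- periodic.
    have h0 : ∫ x in (0)..(2 * Real.pi), G x i = 0 := by
      have := hmean (fun _ => 1) contDiff_const (fun _ => rfl) i
      simpa using this
    set U : ℝ → ℝ := fun x => ∫ s in (0)..x, G s i with hU
    have hUc : Continuous U := intervalIntegral.continuous_primitive hIi 0
    have hUp : Function.Periodic U (2 * Real.pi) := by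
      intro x
      have h1 : Function.Periodic (fun s => G s i) (2 * Real.pi) := fun s => by simp only [hGp s]
      have h2 := h1.intervalIntegral_add_eq x 0
      rw [zero_add, h0] at h2
      have h3 := intervalIntegral.integral_add_adjacent_intervals (hIi 0 x)
        (hIi x (x + 2 * Real.pi))
      simp only [hU]
      rw [← h3, h2, add_zero]
    have hui : Continuous fun x => u x i := by fun_prop
    have h6 := eq_of_integral_deriv_mul_eq_zero_circle (w := fun x => u x i - U x)
      (hui.sub hUc) (fun x => by simp only [hp x, hUp x]) (fun ψ h1 h2 => by
        have hψ' : Continuous (deriv ψ) := h1.continuous_deriv (by simp)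
        simp only [mul_sub]
        have i1 : IntervalIntegrable (fun x => deriv ψ x * u x i) volume 0 (2 * Real.pi) :=
          (hψ'.mul hui).intervalIntegrable _ _
        have i2 : IntervalIntegrable (fun x => deriv ψ x * U x) volume 0 (2 * Real.pi) :=
          (hψ'.mul hUc).intervalIntegrable _ _
        rw [intervalIntegral.integral_sub i1 i2, hmean ψ h1 h2 i,
          integral_deriv_mul_primitive h1 (hIi 0 _), h0]
        ring) b a
    have h7 := intervalIntegral.integral_add_adjacent_intervals (hIi 0 a) (hIi a b)
    simp only [hU] at h6
    linarith
  · rw [← real_inner_self_eq_norm_sq, L2.inner_def]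
    refine integral_congr_ae (hGae.mono fun x hx => ?_)
    simp only [hx, real_inner_self_eq_norm_sq]

/-! ### Interpolation -/

/-- Cauchy–Schwarz against the constant one, from the nonnegativity of the variance of `f` on the
interval. -/
theorem sq_integral_le {f : ℝ → ℝ} {a b : ℝ} (hab : a < b) (hf : IntervalIntegrable f volume a b)
    (hf2 : IntervalIntegrable (fun x => f x ^ 2) volume a b) :
    (∫ x in a..b, f x) ^ 2 ≤ (b - a) * ∫ x in a..b, f x ^ 2 := by
  set I := ∫ x in a..b, f x with hI
  have hba : 0 < b - a := sub_pos.2 hab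
  have h1 : 0 ≤ ∫ x in a..b, (f x - I / (b - a)) ^ 2 :=
    intervalIntegral.integral_nonneg hab.le fun x _ => sq_nonneg _
  have h2 : ∫ x in a..b, (f x - I / (b - a)) ^ 2 = (∫ x in a..b, f x ^ 2) - I ^ 2 / (b - a) := by
    have e : ∀ x, (f x - I / (b - a)) ^ 2
        = f x ^ 2 - (2 * (I / (b - a))) * f x + (I / (b - a)) ^ 2 := fun x => by ring
    simp only [e]
    rw [intervalIntegral.integral_add (hf2.sub (hf.const_mul _)) intervalIntegrable_const,
      intervalIntegral.integral_sub hf2 (hf.const_mul _), intervalIntegral.integral_const_mul,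
      intervalIntegral.integral_const, ← hI, smul_eq_mul]
    field_simp
    ring
  rw [h2] at h1
  have h3 : I ^ 2 / (b - a) ≤ ∫ x in a..b, f x ^ 2 := by linarith
  rw [div_le_iff₀ hba] at h3
  linarith

namespace Mesh

variable (𝒯 : Mesh)

theorem norm_sub_lift_sample_le {u : ℝ → Plane} (hp : Function.Periodic u (2 * Real.pi)) {j : ℤ}
    {θ R : ℝ} (hθ : θ ∈ Ico (𝒯.node j) (𝒯.node (j + 1))) (h1 : ‖u θ - u (𝒯.node j)‖ ≤ R)
    (h2 : ‖u θ - u (𝒯.node (j + 1))‖ ≤ R) : ‖u θ - 𝒯.lift (𝒯.sample u) θ‖ ≤ R := by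
  rw [lift_eq_convex, 𝒯.idx_eq_of_mem hθ,
    show ((j : ZMod 𝒯.N) + 1) = ((j + 1 : ℤ) : ZMod 𝒯.N) by push_cast; rfl,
    sample_intCast 𝒯 hp, sample_intCast 𝒯 hp]
  set f := Int.fract ((θ - 𝒯.first) / 𝒯.h)
  have hf0 : 0 ≤ f := Int.fract_nonneg _
  have hf1 : 0 ≤ 1 - f := sub_nonneg.2 (Int.fract_lt_one _).le
  have e : u θ - ((1 - f) • u (𝒯.node j) + f • u (𝒯.node (j + 1)))
      = (1 - f) • (u θ - u (𝒯.node j)) + f • (u θ - u (𝒯.node (j + 1))) := by module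
  rw [e]
  refine (norm_add_le _ _).trans ?_
  rw [norm_smul, norm_smul, Real.norm_of_nonneg hf0, Real.norm_of_nonneg hf1]
  have h3 := mul_le_mul_of_nonneg_left h1 hf1
  have h4 := mul_le_mul_of_nonneg_left h2 hf0
  linarith

/-- On one interval `u - I_h u` is a convex combination of differences of values of `u`, each at
most `∫ |G|`. Cauchy–Schwarz gives one factor `h`, integration over the interval the other. -/
theorem integral_sub_lift_sample_sq_le {u G : ℝ → Plane} (hu : Continuous u)
    (hp : Function.Periodic u (2 * Real.pi)) (hGp : Function.Periodic G (2 * Real.pi))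
    (hG : ∀ a b, IntervalIntegrable G volume a b)
    (hG2 : ∀ a b, IntervalIntegrable (fun x => ‖G x‖ ^ 2) volume a b)
    (hGu : ∀ a b, u b - u a = ∫ x in a..b, G x) :
    ∫ θ, ‖u θ - 𝒯.lift (𝒯.sample u) θ‖ ^ 2 ∂circleMeasure
      ≤ 𝒯.h ^ 2 * ∫ θ, ‖G θ‖ ^ 2 ∂circleMeasure := by
  have hd : Continuous fun θ => ‖u θ - 𝒯.lift (𝒯.sample u) θ‖ ^ 2 :=
    ((hu.sub (𝒯.continuous_lift _)).norm).pow 2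
  rw [𝒯.integral_circle_eq_sum (fun a b => hd.intervalIntegrable a b)
    (fun x => by simp only [hp x, 𝒯.lift_periodic _ x]),
    𝒯.integral_circle_eq_sum hG2 (fun x => by simp only [hGp x]), Finset.mul_sum]
  refine Finset.sum_le_sum fun j _ => ?_
  have hlt := 𝒯.node_lt_succ j
  set I := ∫ x in (𝒯.node j)..(𝒯.node (j + 1)), ‖G x‖ with hI
  have hsub : ∀ a b, a ∈ Icc (𝒯.node j) (𝒯.node (j + 1)) → b ∈ Icc (𝒯.node j) (𝒯.node (j + 1)) →
      a ≤ b → ‖u b - u a‖ ≤ I := by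
    intro a b ha hb hab
    rw [hGu a b]
    refine (intervalIntegral.norm_integral_le_integral_norm hab).trans ?_
    exact intervalIntegral.integral_mono_interval ha.1 hab hb.2
      (ae_of_all _ fun x => norm_nonneg _) (hG _ _).norm
  have hI0 : 0 ≤ I := intervalIntegral.integral_nonneg hlt.le fun _ _ => norm_nonneg _
  have h1 : ∫ θ in (𝒯.node j)..(𝒯.node (j + 1)), ‖u θ - 𝒯.lift (𝒯.sample u) θ‖ ^ 2
      ≤ ∫ _ in (𝒯.node j)..(𝒯.node (j + 1)), I ^ 2 := by
    refine intervalIntegral.integral_mono_on_of_le_Ioo hlt.le (hd.intervalIntegrable _ _)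
      intervalIntegrable_const fun θ hθ => ?_
    have := 𝒯.norm_sub_lift_sample_le hp ⟨hθ.1.le, hθ.2⟩
      (hsub _ θ ⟨le_rfl, hlt.le⟩ ⟨hθ.1.le, hθ.2.le⟩ hθ.1.le)
      (by rw [norm_sub_rev]; exact hsub θ _ ⟨hθ.1.le, hθ.2.le⟩ ⟨hlt.le, le_rfl⟩ hθ.2.le)
    gcongr
  have h2 := sq_integral_le hlt (hG _ _).norm (hG2 _ _)
  rw [node_succ, add_sub_cancel_left, ← node_succ] at h2
  rw [intervalIntegral.integral_const, node_succ, add_sub_cancel_left, ← node_succ,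
    smul_eq_mul] at h1
  calc _ ≤ 𝒯.h * I ^ 2 := h1
    _ ≤ 𝒯.h * (𝒯.h * ∫ x in (𝒯.node j)..(𝒯.node (j + 1)), ‖G x‖ ^ 2) :=
      mul_le_mul_of_nonneg_left h2 𝒯.h_pos.le
    _ = _ := by ring

end Mesh

theorem integral_circle_continuousOn {T : ℝ} {f : ℝ → ℝ → ℝ} {C : ℝ}
    (hm : ∀ t ∈ Icc 0 T, AEStronglyMeasurable (f t) circleMeasure)
    (hb : ∀ t ∈ Icc 0 T, ∀ θ, ‖f t θ‖ ≤ C)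
    (hc : ∀ θ, ContinuousOn (fun t => f t θ) (Icc 0 T)) :
    ContinuousOn (fun t => ∫ θ, f t θ ∂circleMeasure) (Icc 0 T) :=
  continuousOn_of_dominated (bound := fun _ => C) hm (fun t ht => ae_of_all _ (hb t ht))
    (integrable_const _) (ae_of_all _ hc)

/-! ### The smooth solution -/

theorem exists_bound_of_periodic {T : ℝ} {f : ℝ → ℝ → Plane}
    (hp : ∀ t ∈ Icc 0 T, Function.Periodic (f t) (2 * Real.pi))
    (hc : ContinuousOn (fun p : ℝ × ℝ => f p.1 p.2) (Icc 0 T ×ˢ univ)) :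
    ∃ K : ℝ, 0 ≤ K ∧ ∀ t ∈ Icc 0 T, ∀ θ, ‖f t θ‖ ≤ K := by
  obtain ⟨C, hC⟩ := (isCompact_Icc.prod (isCompact_Icc (a := (0 : ℝ)) (b := 2 * Real.pi)))
    |>.exists_bound_of_continuousOn (hc.mono (prod_mono_right (subset_univ _)))
  refine ⟨max C 0, le_max_right _ _, fun t ht θ => ?_⟩
  obtain ⟨y, hy, he⟩ := (hp t ht).exists_mem_Ico₀ Real.two_pi_pos θ
  rw [he]
  exact (hC (t, y) ⟨ht, hy.1, hy.2.le⟩).trans (le_max_left _ _)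

theorem continuous_slice {T : ℝ} {f : ℝ → ℝ → Plane}
    (hc : ContinuousOn (fun p : ℝ × ℝ => f p.1 p.2) (Icc 0 T ×ˢ univ)) {t : ℝ}
    (ht : t ∈ Icc 0 T) : Continuous (f t) :=
  hc.comp_continuous (f := fun θ => (t, θ)) (by fun_prop) fun _ => ⟨ht, mem_univ _⟩

theorem continuousOn_slice {T : ℝ} {f : ℝ → ℝ → Plane}
    (hc : ContinuousOn (fun p : ℝ × ℝ => f p.1 p.2) (Icc 0 T ×ˢ univ)) (θ : ℝ) :
    ContinuousOn (fun t => f t θ) (Icc 0 T) :=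
  hc.comp (f := fun t => (t, θ)) (by fun_prop) fun _ ht => ⟨ht, mem_univ _⟩

theorem periodic_deriv {f : ℝ → Plane} (hf : Function.Periodic f (2 * Real.pi)) :
    Function.Periodic (deriv f) (2 * Real.pi) := by
  intro x
  rw [← deriv_comp_add_const]
  congr 1
  exact funext hf

namespace IsC21

variable {T : ℝ} {X : ℝ → ℝ → Plane}

theorem periodic_timeDeriv (hX : IsC21 T X) (t : ℝ) (ht : t ∈ Icc 0 T) :
    Function.Periodic (timeDeriv T X t) (2 * Real.pi) := fun θ =>
  derivWithin_congr (fun s hs => hX.periodic s hs θ) (hX.periodic t ht θ)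

theorem hasDerivAt (hX : IsC21 T X) {t : ℝ} (ht : t ∈ Ioo 0 T) (θ : ℝ) :
    HasDerivAt (fun s => X s θ) (timeDeriv T X t θ) t :=
  ((hX.differentiableOn_time θ t (Ioo_subset_Icc_self ht)).hasDerivWithinAt).hasDerivAt
    (Icc_mem_nhds ht.1 ht.2)

end IsC21

/-! ### Interpolation of the smooth solution and exact consistency of the Dirichlet form -/

namespace Mesh

variable (𝒯 : Mesh)

theorem continuous_lift_apply (θ : ℝ) : Continuous fun Y : 𝒯.Nodal => 𝒯.lift Y θ := by
  unfold lift edge; fun_prop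

theorem continuous_slope_apply (θ : ℝ) : Continuous fun Y : 𝒯.Nodal => 𝒯.slope Y θ :=
  𝒯.continuous_edge _

theorem continuousOn_sample {T : ℝ} {f : ℝ → ℝ → Plane}
    (hc : ContinuousOn (fun p : ℝ × ℝ => f p.1 p.2) (Icc 0 T ×ˢ univ)) :
    ContinuousOn (fun t => 𝒯.sample (f t)) (Icc 0 T) :=
  continuousOn_pi.2 fun _ => continuousOn_slice hc _

theorem norm_sub_lift_sample_le_of_lipschitz {u : ℝ → Plane}
    (hp : Function.Periodic u (2 * Real.pi)) {K : ℝ} (hK : 0 ≤ K)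
    (hu : ∀ a b, ‖u b - u a‖ ≤ K * |b - a|) (θ : ℝ) :
    ‖u θ - 𝒯.lift (𝒯.sample u) θ‖ ≤ K * 𝒯.h := by
  have hm := 𝒯.mem_Ico_idx θ
  have hs := 𝒯.node_succ (𝒯.idx θ)
  have h2 := hm.2
  refine 𝒯.norm_sub_lift_sample_le hp hm ((hu _ _).trans ?_) ((hu _ _).trans ?_)
  · refine mul_le_mul_of_nonneg_left ?_ hK
    rw [abs_of_nonneg (by linarith [hm.1])]; linarith [hm.2]
  · refine mul_le_mul_of_nonneg_left ?_ hK
    rw [abs_of_nonpos (by linarith [hm.2])]; linarith [hm.1]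

/-- Mean value inequality for `x ↦ u x - x • deriv u θ`, whose derivative is at most `K h` on the
interval containing `θ`. -/
theorem norm_deriv_sub_slope_sample_le {u : ℝ → Plane} (hu : Differentiable ℝ u)
    (hp : Function.Periodic u (2 * Real.pi)) {K : ℝ} (hK : 0 ≤ K)
    (hK' : ∀ a b, ‖deriv u b - deriv u a‖ ≤ K * |b - a|) (θ : ℝ) :
    ‖deriv u θ - 𝒯.slope (𝒯.sample u) θ‖ ≤ K * 𝒯.h := by
  have hh := 𝒯.h_pos
  have hm := 𝒯.mem_Ico_idx θ
  have hlt := 𝒯.node_lt_succ (𝒯.idx θ)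
  have hs := 𝒯.node_succ (𝒯.idx θ)
  set a := 𝒯.node (𝒯.idx θ)
  set b := 𝒯.node (𝒯.idx θ + 1)
  have hd : ∀ x ∈ Icc a b, HasDerivWithinAt (fun x => u x - x • deriv u θ)
      (deriv u x - (1 : ℝ) • deriv u θ) (Icc a b) x := fun x _ =>
    ((hu x).hasDerivAt.sub ((hasDerivAt_id x).smul_const _)).hasDerivWithinAt
  have h1 := (convex_Icc a b).norm_image_sub_le_of_norm_hasDerivWithin_le (C := K * 𝒯.h) hd
    (fun x hx => by
      rw [one_smul]
      refine (hK' _ _).trans (mul_le_mul_of_nonneg_left ?_ hK)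
      rw [abs_le]
      constructor <;> linarith [hx.1, hx.2, hm.1, hm.2]) ⟨le_rfl, hlt.le⟩ ⟨hlt.le, le_rfl⟩
  have e : deriv u θ - 𝒯.slope (𝒯.sample u) θ
      = -(𝒯.h⁻¹ • (u b - b • deriv u θ - (u a - a • deriv u θ))) := by
    rw [slope, edge, show ((𝒯.idx θ : ZMod 𝒯.N) + 1) = ((𝒯.idx θ + 1 : ℤ) : ZMod 𝒯.N) by
      push_cast; rfl, sample_intCast 𝒯 hp, sample_intCast 𝒯 hp]
    change deriv u θ - 𝒯.h⁻¹ • (u b - u a) = _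
    have e2 : deriv u θ = 𝒯.h⁻¹ • ((b - a) • deriv u θ) := by
      rw [hs, add_sub_cancel_left, inv_smul_smul₀ hh.ne']
    conv_lhs => rw [e2]
    module
  rw [e, norm_neg, norm_smul, norm_inv, Real.norm_of_nonneg hh.le]
  rw [Real.norm_of_nonneg (by linarith), show b - a = 𝒯.h by linarith] at h1
  rw [inv_mul_le_iff₀ hh]
  linarith

theorem hasDerivAt_sample {T : ℝ} {X : ℝ → ℝ → Plane} (hX : IsC21 T X) {t : ℝ}
    (ht : t ∈ Ioo 0 T) :
    HasDerivAt (fun s => 𝒯.sample (X s)) (𝒯.sample (timeDeriv T X t)) t :=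
  hasDerivAt_pi.2 fun _ => hX.hasDerivAt ht _

/-- The slope of the test function is constant on each interval, so only the increments of `u`
between nodes matter, and interpolation preserves these. -/
theorem integral_inner_deriv_slope {u : ℝ → Plane} (hu : Differentiable ℝ u)
    (hu' : Continuous (deriv u)) (hp : Function.Periodic u (2 * Real.pi)) (W : 𝒯.Nodal) :
    ∫ θ, ⟪deriv u θ, 𝒯.slope W θ⟫ ∂circleMeasure = 𝒯.stiff (𝒯.sample u) W := by
  have hub : BddMeas (deriv u) := .of_periodic hu' (periodic_deriv hp)
  have hW := 𝒯.bddMeas_slope W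
  rw [stiff, 𝒯.integral_circle_eq_sum (hub.inner hW).intervalIntegrable
      (fun x => by simp only [periodic_deriv hp x, 𝒯.slope_periodic W x]),
    𝒯.integral_circle_eq_sum ((𝒯.bddMeas_slope _).inner hW).intervalIntegrable
      (fun x => by simp only [𝒯.slope_periodic _ x])]
  refine Finset.sum_congr rfl fun j _ => ?_
  have hlt := 𝒯.node_lt_succ j
  have e1 : ∫ θ in (𝒯.node j)..(𝒯.node (j + 1)), (⟪deriv u θ, 𝒯.slope W θ⟫ : ℝ)
      = ∫ θ in (𝒯.node j)..(𝒯.node (j + 1)), (⟪𝒯.edge W (j : ℤ), deriv u θ⟫ : ℝ) := by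
    refine intervalIntegral.integral_congr_Ioo_of_le hlt.le fun θ hθ => ?_
    simp only [𝒯.slope_eq_of_mem W ⟨hθ.1.le, hθ.2⟩, real_inner_comm]
  have e2 : ∫ θ in (𝒯.node j)..(𝒯.node (j + 1)), (⟪𝒯.slope (𝒯.sample u) θ, 𝒯.slope W θ⟫ : ℝ)
      = ∫ _ in (𝒯.node j)..(𝒯.node (j + 1)),
        (⟪𝒯.edge (𝒯.sample u) (j : ℤ), 𝒯.edge W (j : ℤ)⟫ : ℝ) := by
    refine intervalIntegral.integral_congr_Ioo_of_le hlt.le fun θ hθ => ?_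
    simp only [𝒯.slope_eq_of_mem _ ⟨hθ.1.le, hθ.2⟩]
  have e4 := (innerSL ℝ (𝒯.edge W (j : ℤ))).intervalIntegral_comp_comm
    (hub.intervalIntegrable (𝒯.node j) (𝒯.node (j + 1)))
  simp only [innerSL_apply_apply] at e4
  rw [e1, e2, intervalIntegral.integral_const, e4,
    intervalIntegral.integral_deriv_eq_sub (fun x _ => hu x) (hub.intervalIntegrable _ _)]
  have e3 : u (𝒯.node (j + 1)) - u (𝒯.node j) = 𝒯.h • 𝒯.edge (𝒯.sample u) (j : ℤ) := by
    rw [h_smul_edge, show (((j : ℤ) : ZMod 𝒯.N) + 1) = ((j + 1 : ℤ) : ZMod 𝒯.N) by push_cast; rfl,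
      sample_intCast 𝒯 hp, sample_intCast 𝒯 hp]
  rw [e3, real_inner_smul_right, node_succ, add_sub_cancel_left, smul_eq_mul,
    real_inner_comm]

end Mesh

theorem norm_unitNormal {v : Plane} (hv : v ≠ 0) : ‖unitNormal v‖ = 1 := by
  have : ‖(!₂[-(v 1), v 0] : Plane)‖ = ‖v‖ := by
    rw [← sq_eq_sq₀ (norm_nonneg _) (norm_nonneg _), norm_sq_plane, norm_sq_plane]
    simp [add_comm]
  rw [unitNormal, norm_smul, this, norm_inv, norm_norm, inv_mul_cancel₀ (norm_ne_zero_iff.2 hv)]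

theorem inner_unitNormal (v : Plane) : (⟪unitNormal v, v⟫ : ℝ) = 0 := by
  rw [unitNormal, real_inner_smul_left, inner_plane]
  simp; right; ring

/-- The weak form of the flow equation. -/
theorem SolvesFlow.weak_form {α T : ℝ} {X : ℝ → ℝ → Plane} (hX : IsC21 T X)
    (hflow : SolvesFlow α T X) {t : ℝ} (ht : t ∈ Ioo 0 T) (hne : ∀ θ, deriv (X t) θ ≠ 0)
    (𝒯 : Mesh) (W : 𝒯.Nodal) :
    ∫ θ, form α (deriv (X t) θ) (timeDeriv T X t θ) (𝒯.lift W θ) ∂circleMeasure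
      + 𝒯.stiff (𝒯.sample (X t)) W = 0 := by
  have htc := Ioo_subset_Icc_self ht
  have hp := hX.periodic t htc
  have h1 : ∀ θ, form α (deriv (X t) θ) (timeDeriv T X t θ) (𝒯.lift W θ)
      = ⟪deriv (deriv (X t)) θ, 𝒯.lift W θ⟫ := by
    intro θ
    rw [← form_eq_of_unit_normal (norm_unitNormal (hne θ)) (inner_unitNormal _)]
    have h2 := congrArg (fun v => (⟪v, 𝒯.lift W θ⟫ : ℝ)) (hflow t ht θ)
    simp only [inner_add_left, real_inner_smul_left] at h2
    have h3 : ‖deriv (X t) θ‖ ^ 2 ≠ 0 := pow_ne_zero _ (norm_ne_zero_iff.2 (hne θ))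
    rw [real_inner_comm (unitNormal _) (timeDeriv T X t θ), h2, mul_comm, mul_inv_cancel_left₀ h3]
  simp only [h1]
  have hc1 := continuous_slice (f := fun t => deriv (X t)) hX.continuousOn_deriv htc
  have hc2 := continuous_slice (f := fun t => deriv (deriv (X t))) hX.continuousOn_deriv2 htc
  have hb1 := BddMeas.of_periodic hc1 (periodic_deriv hp)
  have hb2 := BddMeas.of_periodic hc2 (periodic_deriv (periodic_deriv hp))
  have i1 := hb2.inner (𝒯.bddMeas_lift W)
  have i2 := hb1.inner (𝒯.bddMeas_slope W)
  rw [← 𝒯.integral_inner_deriv_slope (hX.differentiable t htc) hc1 hp W,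
    ← integral_add (i1.integrable _) (i2.integrable _), ← integral_circle]
  -- Integration by parts with right derivatives: they exist at every point for a mesh function,
  -- including the nodes, and the boundary terms cancel by periodicity.
  rw [intervalIntegral.integral_eq_sub_of_hasDeriv_right
    (f := fun θ => (⟪deriv (X t) θ, 𝒯.lift W θ⟫ : ℝ))
    (hc1.inner (𝒯.continuous_lift W)).continuousOn (fun θ _ => ?_)
    ((i1.add i2).intervalIntegrable _ _)]
  · have e1 := 𝒯.lift_periodic W 0
    have e2 := periodic_deriv hp 0
    rw [zero_add] at e1 e2
    rw [e1, e2, sub_self]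
  · rw [add_comm]
    exact (hX.differentiable_deriv t htc θ).hasDerivAt.hasDerivWithinAt.inner ℝ
      (𝒯.hasDerivWithinAt_lift W θ)

/-- Interpolation error of the velocity. -/
theorem IsC21.exists_interp_bound {T : ℝ} {X : ℝ → ℝ → Plane} (hT : 0 < T) (hX : IsC21 T X)
    (hXt : MemBochnerSobolev 1 ∞ T (timeDeriv T X)) :
    ∃ B : ℝ, 0 ≤ B ∧ ∀ t ∈ Icc 0 T, ∀ 𝒯 : Mesh,
      ∫ θ, ‖timeDeriv T X t θ - 𝒯.lift (𝒯.sample (timeDeriv T X t)) θ‖ ^ 2 ∂circleMeasure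
        ≤ B * 𝒯.h ^ 2 := by
  obtain ⟨v, hv, hae⟩ := hXt
  obtain ⟨K, hK0, hK⟩ := exists_bound_of_periodic hX.periodic_timeDeriv hX.continuousOn_timeDeriv
  set R : ℝ := (eLpNorm (v 1) ∞ (volume.restrict (Ioo 0 T))).toReal with hR
  have hvR : ∀ᵐ t ∂volume.restrict (Ioo 0 T), ‖v 1 t‖ ≤ R := by
    have h1 := (hv 1).2.ne
    filter_upwards [ae_le_eLpNormEssSup (f := v 1) (μ := volume.restrict (Ioo 0 T))] with t ht
    rw [← eLpNorm_exponent_top] at ht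
    rw [hR, ← toReal_enorm]
    exact ENNReal.toReal_mono h1 ht
  refine ⟨R ^ 2, sq_nonneg _, fun t ht 𝒯 => ?_⟩
  set Φ : ℝ → ℝ := fun t =>
    ∫ θ, ‖timeDeriv T X t θ - 𝒯.lift (𝒯.sample (timeDeriv T X t)) θ‖ ^ 2 ∂circleMeasure with hΦ
  have hΦc : ContinuousOn Φ (Icc 0 T) := by
    refine integral_circle_continuousOn (C := (K + K) ^ 2) (fun t ht => ?_) (fun t ht θ => ?_)
      fun θ => ?_
    · have := continuous_slice hX.continuousOn_timeDeriv ht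
      have := 𝒯.continuous_lift (𝒯.sample (timeDeriv T X t))
      exact Continuous.aestronglyMeasurable (by fun_prop)
    · rw [norm_pow, norm_norm]
      have hb : ∀ a, ‖timeDeriv T X t θ - timeDeriv T X t a‖ ≤ K + K := fun a =>
        (norm_sub_le _ _).trans (add_le_add (hK t ht _) (hK t ht _))
      have := 𝒯.norm_sub_lift_sample_le (hX.periodic_timeDeriv t ht) (𝒯.mem_Ico_idx θ) (hb _) (hb _)
      gcongr
    · have h1 := continuousOn_slice hX.continuousOn_timeDeriv θ
      have h2 := (𝒯.continuous_lift_apply θ).comp_continuousOn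
        (𝒯.continuousOn_sample hX.continuousOn_timeDeriv)
      exact ((h1.sub h2).norm).pow 2
  have hΦae : ∀ᵐ t ∂volume.restrict (Ioo 0 T), Φ t ≤ R ^ 2 * 𝒯.h ^ 2 := by
    filter_upwards [hae, hvR, ae_restrict_mem measurableSet_Ioo] with t ht1 ht2 ht3
    have htc := Ioo_subset_Icc_self ht3
    have hc := continuous_slice hX.continuousOn_timeDeriv htc
    have hp := hX.periodic_timeDeriv t htc
    have hw : HasWeakDerivCircle (timeDeriv T X t) (v 1 t) := by
      intro ψ h1 h2
      rw [show v 1 t = v (Fin.succ (0 : Fin 1)) t from rfl, ← ht1.2 0 ψ h1 h2]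
      refine integral_congr_ae (ht1.1.mono fun x hx => ?_)
      simp only [hx]
      rfl
    obtain ⟨G, hG1, hG2, hG3, hG4, hG5⟩ := hw.exists_primitive hc hp
    refine (𝒯.integral_sub_lift_sample_sq_le hc hp hG1 hG2 hG3 hG4).trans ?_
    rw [hG5, mul_comm]
    gcongr
  -- The Bochner assumption gives the bound for almost every time only. Two continuous functions
  -- that agree almost everywhere agree, so it holds at every time.
  have heq : EqOn Φ (fun t => min (Φ t) (R ^ 2 * 𝒯.h ^ 2)) (Icc 0 T) := by
    refine Measure.eqOn_of_ae_eq (μ := volume) ?_ hΦc (hΦc.inf continuousOn_const) ?_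
    · rw [← restrict_Ioo_eq_restrict_Icc]
      filter_upwards [hΦae] with t ht
      exact (min_eq_left ht).symm
    · rw [interior_Icc, closure_Ioo hT.ne]
  have := heq ht
  simp only at this
  change Φ t ≤ _
  rw [this]
  exact min_le_right _ _

/-! ### Error estimate -/

theorem abs_cross_le (s v : Plane) : |cross s v| ≤ ‖s‖ * ‖v‖ := by
  refine abs_le_of_sq_le_sq ?_ (by positivity)
  rw [mul_pow, norm_sq_plane, norm_sq_plane, cross]
  nlinarith [sq_nonneg (s 0 * v 0 + s 1 * v 1)]

theorem form_self_le {α : ℝ} (h1 : α ≤ 1) (s v : Plane) :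
    form α s v v ≤ ‖s‖ ^ 2 * ‖v‖ ^ 2 := by
  have h2 : cross s v * cross s v ≤ ‖s‖ ^ 2 * ‖v‖ ^ 2 := by
    rw [← sq, ← sq_abs, ← mul_pow]
    exact pow_le_pow_left₀ (abs_nonneg _) (abs_cross_le s v) 2
  rw [form, real_inner_self_eq_norm_sq]
  nlinarith [mul_le_mul_of_nonneg_left h2 (sub_nonneg.2 h1)]

/-- Local Lipschitz continuity of a quadratic map of the slope: each of the two terms is a
difference of products, and the weights `α` and `1 - α` add up to one. -/
theorem abs_form_sub_form_le {α : ℝ} (h0 : 0 ≤ α) (h1 : α ≤ 1) {x y u : Plane} (z : Plane)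
    {R K : ℝ} (hx : ‖x‖ ≤ R) (hy : ‖y‖ ≤ R) (hu : ‖u‖ ≤ K) :
    |form α x u z - form α y u z| ≤ 2 * R * K * (‖x - y‖ * ‖z‖) := by
  have hR : 0 ≤ R := (norm_nonneg _).trans hx
  have hK : 0 ≤ K := (norm_nonneg _).trans hu
  have e : form α x u z - form α y u z = α * ((‖x‖ - ‖y‖) * (‖x‖ + ‖y‖) * ⟪u, z⟫)
      + (1 - α) * (cross (x - y) u * cross x z + cross y u * cross (x - y) z) := by
    simp only [form, cross, PiLp.sub_apply]; ring
  have a1 : |(‖x‖ - ‖y‖) * (‖x‖ + ‖y‖) * ⟪u, z⟫| ≤ 2 * R * K * (‖x - y‖ * ‖z‖) := by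
    rw [abs_mul, abs_mul, abs_of_nonneg (add_nonneg (norm_nonneg x) (norm_nonneg y))]
    calc |‖x‖ - ‖y‖| * (‖x‖ + ‖y‖) * |⟪u, z⟫| ≤ ‖x - y‖ * (R + R) * (K * ‖z‖) := by
          gcongr
          · exact abs_norm_sub_norm_le _ _
          · exact (abs_real_inner_le_norm u z).trans (by gcongr)
      _ = _ := by ring
  have a2 : |cross (x - y) u * cross x z + cross y u * cross (x - y) z|
      ≤ 2 * R * K * (‖x - y‖ * ‖z‖) := by
    refine (abs_add_le _ _).trans ?_
    rw [abs_mul, abs_mul]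
    calc _ ≤ (‖x - y‖ * K) * (R * ‖z‖) + (R * K) * (‖x - y‖ * ‖z‖) := by
          gcongr
          · exact (abs_cross_le _ _).trans (by gcongr)
          · exact (abs_cross_le _ _).trans (by gcongr)
          · exact (abs_cross_le _ _).trans (by gcongr)
          · exact abs_cross_le _ _
      _ = _ := by ring
  rw [e]
  refine (abs_add_le _ _).trans ?_
  rw [abs_mul α, abs_mul (1 - α), abs_of_nonneg h0, abs_of_nonneg (sub_nonneg.2 h1)]
  nlinarith [mul_le_mul_of_nonneg_left a1 h0, mul_le_mul_of_nonneg_left a2 (sub_nonneg.2 h1)]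

theorem mul_le_of_young {δ a b : ℝ} (hδ : 0 < δ) : a * b ≤ δ * b ^ 2 / 4 + a ^ 2 / δ := by
  have h : δ * b ^ 2 / 4 + a ^ 2 / δ - a * b = (δ * b / 2 - a) ^ 2 / δ := by
    field_simp; ring
  have := div_nonneg (sq_nonneg (δ * b / 2 - a)) hδ.le
  linarith

/-- Monotonicity of the scheme up to consistency errors. -/
theorem le_form_sub_form {α c R K : ℝ} (h0 : 0 < α) (h1 : α ≤ 1) (hc : 0 < c) {x y u : Plane}
    (p v : Plane) (hx : ‖x‖ ≤ R) (hcy : c ≤ ‖y‖) (hy : ‖y‖ ≤ R) (hu : ‖u‖ ≤ K) :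
    form α y (p - v) (p - v) / 2 - R ^ 2 * ‖u - p‖ ^ 2
        - 4 * R ^ 2 * K ^ 2 / (α * c ^ 2) * ‖x - y‖ ^ 2
      ≤ form α x u (p - v) - form α y v (p - v) := by
  set z := p - v with hz
  -- Slope error, velocity interpolation error, coercive term. The first two each consume a quarter
  -- of the third. For the slope error this costs `1/α`, through Young's inequality and coercivity;
  -- the interpolation error is treated by completing the square in `form` itself and costs no
  -- `1/α`.
  have e1 : form α x u z - form α y v z
      = (form α x u z - form α y u z) + form α y (u - p) z + form α y z z := by
    have : form α y v z = form α y p z - form α y z z := by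
      rw [← form_sub_left, hz, sub_sub_cancel]
    rw [this, form_sub_left α y u p z]
    ring
  have hα : 0 < α * c ^ 2 := by positivity
  have b1 : α * c ^ 2 * ‖z‖ ^ 2 ≤ form α y z z := by
    refine le_trans ?_ (le_form_self h1 y z)
    gcongr
  have b2 : -(form α y z z / 4) - R ^ 2 * ‖u - p‖ ^ 2 ≤ form α y (u - p) z := by
    have h2 := form_self_nonneg h0.le h1 y ((2 : ℝ)⁻¹ • z + (u - p))
    have h3 := form_self_le h1 y (u - p)
    have h4 : ‖y‖ ^ 2 * ‖u - p‖ ^ 2 ≤ R ^ 2 * ‖u - p‖ ^ 2 := by gcongr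
    have h5 : form α y ((2 : ℝ)⁻¹ • z + (u - p)) ((2 : ℝ)⁻¹ • z + (u - p))
        = form α y z z / 4 + form α y (u - p) z + form α y (u - p) (u - p) := by
      simp only [form_eq, PiLp.add_apply, PiLp.smul_apply, smul_eq_mul]; ring
    linarith
  have b3 := (abs_le.1 (abs_form_sub_form_le h0.le h1 z hx hy hu)).1
  have b4 := mul_le_of_young (a := 2 * R * K * ‖x - y‖) (b := ‖z‖) hα
  have e2 : (2 * R * K * ‖x - y‖) ^ 2 / (α * c ^ 2)
      = 4 * R ^ 2 * K ^ 2 / (α * c ^ 2) * ‖x - y‖ ^ 2 := by ring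
  rw [e1]
  linarith

namespace Mesh

variable (𝒯 : Mesh)

theorem integral_norm_sub_slope_sq_le {u : ℝ → Plane} (hu : BddMeas u) (P Y : 𝒯.Nodal) {κ : ℝ}
    (hP : ∀ θ, ‖u θ - 𝒯.slope P θ‖ ≤ κ) :
    ∫ θ, ‖u θ - 𝒯.slope Y θ‖ ^ 2 ∂circleMeasure
      ≤ 2 * 𝒯.stiff (P - Y) (P - Y) + 4 * Real.pi * κ ^ 2 := by
  have hE := 𝒯.bddMeas_slope (P - Y)
  have h1 : ∫ θ, ‖u θ - 𝒯.slope Y θ‖ ^ 2 ∂circleMeasure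
      ≤ ∫ θ, (2 * ⟪𝒯.slope (P - Y) θ, 𝒯.slope (P - Y) θ⟫ + 2 * κ ^ 2) ∂circleMeasure := by
    refine integral_mono ((hu.sub (𝒯.bddMeas_slope Y)).norm_sq.integrable _)
      ((((hE.inner hE).integrable _).const_mul _).add (integrable_const _)) fun θ => ?_
    have e : u θ - 𝒯.slope Y θ = (u θ - 𝒯.slope P θ) + 𝒯.slope (P - Y) θ := by
      rw [slope_sub]; abel
    simp only
    rw [e, real_inner_self_eq_norm_sq]
    have h2 := norm_add_le (u θ - 𝒯.slope P θ) (𝒯.slope (P - Y) θ)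
    have h3 : ‖u θ - 𝒯.slope P θ + 𝒯.slope (P - Y) θ‖ ≤ κ + ‖𝒯.slope (P - Y) θ‖ :=
      h2.trans (add_le_add_left (hP θ) _)
    have h4 := pow_le_pow_left₀ (norm_nonneg _) h3 2
    nlinarith [sq_nonneg (κ - ‖𝒯.slope (P - Y) θ‖)]
  refine h1.trans (le_of_eq ?_)
  rw [integral_add (((hE.inner hE).integrable _).const_mul _) (integrable_const _),
    integral_const_mul, integral_circle_const, stiff]
  ring

/-- Young's inequality with weight `α c²`. It pays for the `L²` part of the energy, whose derivative
has no counterpart in the scheme, with another quarter of the dissipation. -/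
theorem gram_le (E Y z : 𝒯.Nodal) {α c : ℝ} (h0 : 0 < α) (h1 : α ≤ 1) (hc : 0 < c)
    (hY : ∀ θ, c ≤ ‖𝒯.slope Y θ‖) :
    𝒯.gram E z ≤ 𝒯.mass α Y z z / 4 + 𝒯.gram E E / (α * c ^ 2) := by
  have hE := 𝒯.bddMeas_lift E
  have hz := 𝒯.bddMeas_lift z
  have hα : 0 < α * c ^ 2 := by positivity
  have h2 : 𝒯.gram E z ≤ ∫ θ, (form α (𝒯.slope Y θ) (𝒯.lift z θ) (𝒯.lift z θ) / 4
      + ⟪𝒯.lift E θ, 𝒯.lift E θ⟫ / (α * c ^ 2)) ∂circleMeasure := by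
    refine integral_mono ((hE.inner hz).integrable _) (((𝒯.integrable_form α Y z z).div_const _).add
      (((hE.inner hE).integrable _).div_const _)) fun θ => ?_
    simp only
    have h3 := real_inner_le_norm (𝒯.lift E θ) (𝒯.lift z θ)
    have h4 := mul_le_of_young (a := ‖𝒯.lift E θ‖) (b := ‖𝒯.lift z θ‖) hα
    have h5 : α * c ^ 2 * ‖𝒯.lift z θ‖ ^ 2 ≤ form α (𝒯.slope Y θ) (𝒯.lift z θ) (𝒯.lift z θ) := by
      refine le_trans ?_ (le_form_self h1 _ _)
      have := hY θ
      gcongr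
    rw [real_inner_self_eq_norm_sq]
    linarith
  refine h2.trans (le_of_eq ?_)
  rw [integral_add ((𝒯.integrable_form α Y z z).div_const _)
    (((hE.inner hE).integrable _).div_const _), integral_div, integral_div, mass, gram]

/-- The energy inequality of the error at a fixed time. -/
theorem energy_inequality {α c R K B κ h : ℝ} (h0 : 0 < α) (h1 : α ≤ 1) (hc : 0 < c)
    {u x : ℝ → Plane} (hu : BddMeas u) (hx : BddMeas x) {P Q Y V : 𝒯.Nodal}
    (hweak : ∀ W, ∫ θ, form α (x θ) (u θ) (𝒯.lift W θ) ∂circleMeasure + 𝒯.stiff P W = 0)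
    (hscheme : ∀ W, 𝒯.mass α Y V W + 𝒯.stiff Y W = 0)
    (hxR : ∀ θ, ‖x θ‖ ≤ R) (hcY : ∀ θ, c ≤ ‖𝒯.slope Y θ‖) (hYR : ∀ θ, ‖𝒯.slope Y θ‖ ≤ R)
    (huK : ∀ θ, ‖u θ‖ ≤ K) (hQ : ∫ θ, ‖u θ - 𝒯.lift Q θ‖ ^ 2 ∂circleMeasure ≤ B * h ^ 2)
    (hP : ∀ θ, ‖x θ - 𝒯.slope P θ‖ ≤ κ * h) (hB : 0 ≤ B) :
    𝒯.stiff (P - Y) (Q - V) + 𝒯.gram (P - Y) (Q - V) + 𝒯.mass α Y (Q - V) (Q - V) / 4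
      ≤ ((16 * R ^ 2 * K ^ 2 + 2) / c ^ 2) / α
          * ((𝒯.stiff (P - Y) (P - Y) + 𝒯.gram (P - Y) (P - Y)) / 2)
        + (R ^ 2 * B + 16 * Real.pi * R ^ 2 * K ^ 2 * κ ^ 2 / c ^ 2) * h ^ 2 / α := by
  set E := P - Y with hE
  set z := Q - V with hz
  have hα : 0 < α * c ^ 2 := by positivity
  set β := 4 * R ^ 2 * K ^ 2 / (α * c ^ 2) with hβ
  have hβ0 : 0 ≤ β := by positivity
  have i1 : Integrable (fun θ => form α (x θ) (u θ) (𝒯.lift z θ)) circleMeasure :=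
    (BddMeas.form α hx hu (𝒯.bddMeas_lift z)).integrable _
  have i2 := 𝒯.integrable_form α Y V z
  have i3 := 𝒯.integrable_form α Y z z
  have i4 : Integrable (fun θ => ‖u θ - 𝒯.lift Q θ‖ ^ 2) circleMeasure :=
    (hu.sub (𝒯.bddMeas_lift Q)).norm_sq.integrable _
  have i5 : Integrable (fun θ => ‖x θ - 𝒯.slope Y θ‖ ^ 2) circleMeasure :=
    (hx.sub (𝒯.bddMeas_slope Y)).norm_sq.integrable _
  have a1 : 𝒯.mass α Y z z / 2 - R ^ 2 * (∫ θ, ‖u θ - 𝒯.lift Q θ‖ ^ 2 ∂circleMeasure)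
      - β * (∫ θ, ‖x θ - 𝒯.slope Y θ‖ ^ 2 ∂circleMeasure)
      ≤ ∫ θ, form α (x θ) (u θ) (𝒯.lift z θ) ∂circleMeasure - 𝒯.mass α Y V z := by
    have i6 : Integrable (fun θ => form α (𝒯.slope Y θ) (𝒯.lift z θ) (𝒯.lift z θ) / 2
        - R ^ 2 * ‖u θ - 𝒯.lift Q θ‖ ^ 2) circleMeasure := (i3.div_const _).sub (i4.const_mul _)
    rw [mass, mass, ← integral_const_mul, ← integral_const_mul, ← integral_div,
      ← integral_sub (i3.div_const _) (i4.const_mul _), ← integral_sub i6 (i5.const_mul _),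
      ← integral_sub i1 i2]
    refine integral_mono (i6.sub (i5.const_mul _)) (i1.sub i2) fun θ => ?_
    have := le_form_sub_form h0 h1 hc (𝒯.lift Q θ) (𝒯.lift V θ) (hxR θ) (hcY θ) (hYR θ) (huK θ)
    rw [← lift_sub] at this
    exact this
  have a2 : 𝒯.stiff E z = 𝒯.stiff P z - 𝒯.stiff Y z :=
    DFunLike.congr_fun (map_sub 𝒯.stiffL P Y) z
  have a3 := 𝒯.integral_norm_sub_slope_sq_le hx P Y hP
  have a4 := 𝒯.gram_le E Y z h0 h1 hc hcY
  have a5 := hweak z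
  have a6 := hscheme z
  have a7 := mul_le_mul_of_nonneg_left hQ (sq_nonneg R)
  have a8 := mul_le_mul_of_nonneg_left a3 hβ0
  have a9 : R ^ 2 * B * h ^ 2 ≤ R ^ 2 * B * h ^ 2 / α := by
    rw [le_div_iff₀ h0]
    exact mul_le_of_le_one_right (by positivity) h1
  have s0 := 𝒯.stiff_self_nonneg E
  have g0 := 𝒯.gram_self_nonneg E
  -- The needed terms are `2 β stiff`, where `β = 4 R² K² / (α c²)`, and `gram / (α c²)`. Using one
  -- coefficient for both halves of the energy leaves the nonnegative surplus `p1`.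
  have e1 : ((16 * R ^ 2 * K ^ 2 + 2) / c ^ 2) / α * ((𝒯.stiff E E + 𝒯.gram E E) / 2)
      = β * (2 * 𝒯.stiff E E) + 𝒯.gram E E / (α * c ^ 2)
        + (𝒯.stiff E E / (α * c ^ 2) + β * (2 * 𝒯.gram E E)) := by
    rw [hβ]; field_simp; ring
  have e2 : (R ^ 2 * B + 16 * Real.pi * R ^ 2 * K ^ 2 * κ ^ 2 / c ^ 2) * h ^ 2 / α
      = R ^ 2 * B * h ^ 2 / α + β * (4 * Real.pi * (κ * h) ^ 2) := by
    rw [hβ]; field_simp; ring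
  have p1 : 0 ≤ 𝒯.stiff E E / (α * c ^ 2) + β * (2 * 𝒯.gram E E) := by positivity
  rw [e1, e2]
  linarith

/-- The energy of the nodal error. -/
noncomputable def energy (E : 𝒯.Nodal) : ℝ := (𝒯.stiff E E + 𝒯.gram E E) / 2

theorem energy_nonneg (E : 𝒯.Nodal) : 0 ≤ 𝒯.energy E := by
  have := 𝒯.stiff_self_nonneg E
  have := 𝒯.gram_self_nonneg E
  unfold energy; positivity

theorem continuous_energy : Continuous 𝒯.energy := by
  have h1 : Continuous fun E : 𝒯.Nodal => 𝒯.stiffL E E := by fun_prop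
  have h2 : Continuous fun E : 𝒯.Nodal => 𝒯.gramL E E := by fun_prop
  exact (h1.add h2).div_const _

theorem hasDerivAt_energy {E : ℝ → 𝒯.Nodal} {z : 𝒯.Nodal} {t : ℝ} (hE : HasDerivAt E z t) :
    HasDerivAt (fun s => 𝒯.energy (E s)) (𝒯.stiff (E t) z + 𝒯.gram (E t) z) t := by
  have sym1 : ∀ V W, 𝒯.stiff V W = 𝒯.stiff W V := fun V W => by
    simp only [stiff, real_inner_comm]
  have sym2 : ∀ V W, 𝒯.gram V W = 𝒯.gram W V := fun V W => by
    simp only [gram, real_inner_comm]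
  have h1 := 𝒯.stiffL.hasDerivAt_of_bilinear (fun _ => hE) (fun _ => hE)
  have h2 := 𝒯.gramL.hasDerivAt_of_bilinear (fun _ => hE) (fun _ => hE)
  refine ((h1.add h2).div_const 2).congr_deriv ?_
  simp only [stiffL_apply, gramL_apply, sym1 z, sym2 z]
  ring

theorem continuousOn_mass (α : ℝ) {s : Set ℝ} {Y z : ℝ → 𝒯.Nodal} (hY : ContinuousOn Y s)
    (hz : ContinuousOn z s) : ContinuousOn (fun t => 𝒯.mass α (Y t) (z t) (z t)) s := by
  have h1 : ContinuousOn (fun t => 𝒯.massL α (Y t)) s :=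
    (𝒯.contDiff_massL α).continuous.comp_continuousOn hY
  exact (h1.clm_apply hz).clm_apply hz

/-- The integrated energy estimate. -/
theorem energy_estimate {α M C h t : ℝ} (h0 : 0 < α) (hM : 0 < M) (ht : 0 ≤ t)
    {E z Y : ℝ → 𝒯.Nodal} (hE : ContinuousOn E (Icc 0 t)) (hz : ContinuousOn z (Icc 0 t))
    (hY : ContinuousOn Y (Icc 0 t)) (hd : ∀ s ∈ Ioo 0 t, HasDerivAt E (z s) s) (hE0 : E 0 = 0)
    (hle : ∀ s ∈ Ioo 0 t, 𝒯.stiff (E s) (z s) + 𝒯.gram (E s) (z s)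
      + 𝒯.mass α (Y s) (z s) (z s) / 4 ≤ M / α * 𝒯.energy (E s) + C * h ^ 2 / α)
    (hα1 : α ≤ 1) :
    𝒯.energy (E t) + (∫ s in (0)..t, 𝒯.mass α (Y s) (z s) (z s) / 4)
      ≤ C / M * h ^ 2 * (Real.exp (M / α * t) - 1) := by
  set D : ℝ → ℝ := fun s => 𝒯.mass α (Y s) (z s) (z s) / 4 with hD
  have hDc : ContinuousOn D (Icc 0 t) :=
    (𝒯.continuousOn_mass α hY hz).div_const _
  have hDI : IntegrableOn D (uIcc 0 t) := by
    rw [uIcc_of_le ht]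
    exact hDc.integrableOn_Icc
  have hDI' : ∀ s ∈ Icc 0 t, IntervalIntegrable D volume 0 s := fun s hs => by
    refine (hDc.mono ?_).intervalIntegrable
    rw [uIcc_of_le hs.1]
    exact Icc_subset_Icc_right hs.2
  have hD0 : ∀ s, 0 ≤ D s := fun s =>
    div_nonneg (𝒯.mass_self_nonneg h0.le hα1 _ _) (by norm_num)
  set I : ℝ → ℝ := fun s => ∫ r in (0)..s, D r with hI
  have hIc : ContinuousOn I (Icc 0 t) := by
    have := intervalIntegral.continuousOn_primitive_interval hDI
    rwa [uIcc_of_le ht] at this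
  -- Gronwall is applied to the energy plus the accumulated dissipation `I`, so one inequality
  -- controls both; adding `I ≥ 0` on the right is harmless.
  have hg := gronwall (Z := fun s => 𝒯.energy (E s) + I s)
    (Z' := fun s => 𝒯.stiff (E s) (z s) + 𝒯.gram (E s) (z s) + D s) (a := M / α)
    (b := C * h ^ 2 / α) (by positivity) ht
    ((𝒯.continuous_energy.comp_continuousOn hE).add hIc)
    (fun s hs => (𝒯.hasDerivAt_energy (hd s hs)).add
      (intervalIntegral.integral_hasDerivAt_right (hDI' s (Ioo_subset_Icc_self hs))
        ((hDc.mono Ioo_subset_Icc_self).stronglyMeasurableAtFilter isOpen_Ioo _ hs)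
        (hDc.continuousAt (Icc_mem_nhds hs.1 hs.2))))
    (fun s hs => by
      have h1 := hle s hs
      have h2 : 0 ≤ I s := intervalIntegral.integral_nonneg hs.1.le fun r _ => hD0 r
      have h3 : 0 ≤ M / α * I s := by positivity
      simp only [hD] at h1 ⊢
      rw [mul_add]
      linarith)
  have e0 : 𝒯.energy (E 0) = 0 := by
    rw [hE0, energy, ← stiffL_apply, ← gramL_apply]; simp
  -- Growth rate and source both carry `1/α`, which therefore cancels from the prefactor.
  have e1 : C * h ^ 2 / α / (M / α) = C / M * h ^ 2 := by field_simp
  simp only [hI, intervalIntegral.integral_same, e0, e1, zero_add, add_zero] at hg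
  linarith

end Mesh

/-! ### Existence for the scheme -/

/-- Quantitative bounds for a regular evolving curve. -/
structure FlowBounds (T : ℝ) (X : ℝ → ℝ → Plane) (m K B : ℝ) : Prop where
  m_pos : 0 < m
  K_nonneg : 0 ≤ K
  B_nonneg : 0 ≤ B
  le_deriv : ∀ t ∈ Icc 0 T, ∀ θ, 4 * m ≤ ‖deriv (X t) θ‖
  norm_le : ∀ t ∈ Icc 0 T, ∀ θ, ‖X t θ‖ ≤ K
  deriv_le : ∀ t ∈ Icc 0 T, ∀ θ, ‖deriv (X t) θ‖ ≤ K
  deriv2_le : ∀ t ∈ Icc 0 T, ∀ θ, ‖deriv (deriv (X t)) θ‖ ≤ K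
  timeDeriv_le : ∀ t ∈ Icc 0 T, ∀ θ, ‖timeDeriv T X t θ‖ ≤ K
  interp_le : ∀ t ∈ Icc 0 T, ∀ 𝒯 : Mesh,
    ∫ θ, ‖timeDeriv T X t θ - 𝒯.lift (𝒯.sample (timeDeriv T X t)) θ‖ ^ 2 ∂circleMeasure
      ≤ B * 𝒯.h ^ 2

theorem IsC21.exists_flowBounds {T : ℝ} {X : ℝ → ℝ → Plane} (hT : 0 < T) (hX : IsC21 T X)
    (hXt : MemBochnerSobolev 1 ∞ T (timeDeriv T X)) {c₀ : ℝ} (hc₀ : 0 < c₀)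
    (hb : ∀ t ∈ Icc 0 T, ∀ θ : ℝ, c₀ ≤ ‖deriv (X t) θ‖) :
    ∃ K B, FlowBounds T X (c₀ / 4) K B := by
  obtain ⟨B, hB0, hB⟩ := hX.exists_interp_bound hT hXt
  obtain ⟨K₀, h00, h0⟩ := exists_bound_of_periodic hX.periodic hX.continuousOn
  obtain ⟨K₁, h10, h1⟩ := exists_bound_of_periodic (f := fun t => deriv (X t))
    (fun t ht => periodic_deriv (hX.periodic t ht)) hX.continuousOn_deriv
  obtain ⟨K₂, h20, h2⟩ := exists_bound_of_periodic (f := fun t => deriv (deriv (X t)))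
    (fun t ht => periodic_deriv (periodic_deriv (hX.periodic t ht))) hX.continuousOn_deriv2
  obtain ⟨K₃, h30, h3⟩ := exists_bound_of_periodic hX.periodic_timeDeriv hX.continuousOn_timeDeriv
  refine ⟨K₀ + K₁ + K₂ + K₃, B, by positivity, by positivity, hB0, fun t ht θ => ?_,
    fun t ht θ => (h0 t ht θ).trans (by linarith), fun t ht θ => (h1 t ht θ).trans (by linarith),
    fun t ht θ => (h2 t ht θ).trans (by linarith), fun t ht θ => (h3 t ht θ).trans (by linarith),
    hB⟩
  linarith [hb t ht θ]

theorem norm_sub_le_of_norm_deriv_le {u : ℝ → Plane} (hu : Differentiable ℝ u) {K : ℝ}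
    (hK : ∀ x, ‖deriv u x‖ ≤ K) (a b : ℝ) : ‖u b - u a‖ ≤ K * |b - a| :=
  convex_univ.norm_image_sub_le_of_norm_deriv_le (fun x _ => hu x) (fun x _ => hK x)
    (mem_univ a) (mem_univ b)

namespace FlowBounds

variable {T : ℝ} {X : ℝ → ℝ → Plane} {m K B : ℝ}

theorem norm_sub_lift_le (hb : FlowBounds T X m K B) (hX : IsC21 T X) (𝒯 : Mesh) {t : ℝ}
    (ht : t ∈ Icc 0 T) (θ : ℝ) : ‖X t θ - 𝒯.lift (𝒯.sample (X t)) θ‖ ≤ K * 𝒯.h :=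
  𝒯.norm_sub_lift_sample_le_of_lipschitz (hX.periodic t ht) hb.K_nonneg
    (norm_sub_le_of_norm_deriv_le (hX.differentiable t ht) (hb.deriv_le t ht)) θ

theorem norm_deriv_sub_slope_le (hb : FlowBounds T X m K B) (hX : IsC21 T X) (𝒯 : Mesh) {t : ℝ}
    (ht : t ∈ Icc 0 T) (θ : ℝ) : ‖deriv (X t) θ - 𝒯.slope (𝒯.sample (X t)) θ‖ ≤ K * 𝒯.h :=
  𝒯.norm_deriv_sub_slope_sample_le (hX.differentiable t ht) (hX.periodic t ht) hb.K_nonneg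
    (norm_sub_le_of_norm_deriv_le (hX.differentiable_deriv t ht) (hb.deriv2_le t ht)) θ

/-- Of the lower bound `4 m` on `|X_θ|`, interpolation loses `m` and the nodal error another `m`. -/
theorem slope_bounds (hb : FlowBounds T X m K B) (hX : IsC21 T X) (𝒯 : Mesh) {t : ℝ}
    (ht : t ∈ Icc 0 T) (hh : K * 𝒯.h ≤ m) {Y : 𝒯.Nodal}
    (hE : ∀ θ, ‖𝒯.slope (𝒯.sample (X t) - Y) θ‖ ≤ m) (θ : ℝ) :
    2 * m ≤ ‖𝒯.slope Y θ‖ ∧ ‖𝒯.slope Y θ‖ ≤ K + 2 * m := by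
  have h1 := hb.norm_deriv_sub_slope_le hX 𝒯 ht θ
  have h2 := hE θ
  rw [Mesh.slope_sub] at h2
  have h3 := hb.le_deriv t ht θ
  have h4 := hb.deriv_le t ht θ
  have h5 := norm_sub_le_norm_sub_add_norm_sub (deriv (X t) θ) (𝒯.slope (𝒯.sample (X t)) θ)
    (𝒯.slope Y θ)
  have h6 := norm_sub_norm_le (deriv (X t) θ) (𝒯.slope Y θ)
  have h7 := norm_sub_norm_le (𝒯.slope Y θ) (deriv (X t) θ)
  rw [norm_sub_rev] at h7
  constructor <;> linarith

end FlowBounds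

/-! ### Small energy keeps a polygon in a compact set of regular polygons -/

namespace Mesh

variable (𝒯 : Mesh)

theorem slope_le_of_energy_le {E : 𝒯.Nodal} {m : ℝ} (hm : 0 ≤ m)
    (hE : 2 * 𝒯.energy E ≤ m ^ 2 * 𝒯.h) (θ : ℝ) : ‖𝒯.slope E θ‖ ≤ m := by
  have h1 := 𝒯.h_mul_norm_slope_sq_le E θ
  have h2 := 𝒯.gram_self_nonneg E
  rw [energy] at hE
  have h3 : 𝒯.h * ‖𝒯.slope E θ‖ ^ 2 ≤ 𝒯.h * m ^ 2 := by linarith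
  exact le_of_sq_le_sq (le_of_mul_le_mul_left h3 𝒯.h_pos) hm

theorem norm_le_of_energy_le {E : 𝒯.Nodal} {m : ℝ} (hm : 0 ≤ m)
    (hE : 2 * 𝒯.energy E ≤ m ^ 2 * 𝒯.h) : ‖E‖ ≤ 2 * m := by
  refine (pi_norm_le_iff_of_nonneg (by positivity)).2 fun j => ?_
  have h1 := 𝒯.h_mul_norm_sq_le E j
  have h2 := 𝒯.stiff_self_nonneg E
  rw [energy] at hE
  have h3 : 𝒯.h * ‖E j‖ ^ 2 ≤ 𝒯.h * (2 * m) ^ 2 := by nlinarith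
  exact le_of_sq_le_sq (le_of_mul_le_mul_left h3 𝒯.h_pos) (by positivity)

/-- A compact set of nondegenerate polygons. -/
def regularSet (m ρ : ℝ) : Set 𝒯.Nodal := {Y | ‖Y‖ ≤ ρ ∧ ∀ j, m ≤ ‖𝒯.edge Y j‖}

theorem isCompact_regularSet (m ρ : ℝ) : IsCompact (𝒯.regularSet m ρ) := by
  have h1 : 𝒯.regularSet m ρ = Metric.closedBall 0 ρ ∩ ⋂ j, {Y | m ≤ ‖𝒯.edge Y j‖} := by
    ext Y; simp [regularSet]
  rw [h1]
  exact (isCompact_closedBall _ _).inter_right (isClosed_iInter fun j =>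
    isClosed_le continuous_const (𝒯.continuous_edge j).norm)

theorem regularSet_subset {m : ℝ} (hm : 0 < m) (ρ : ℝ) :
    𝒯.regularSet m ρ ⊆ 𝒯.nondegenerate := fun Y hY j h => by
  have := hY.2 j
  rw [h, norm_zero] at this
  linarith

/-- An edge of `Z - Y` is at most `2 ‖Z - Y‖ / h ≤ m`, half of the lower bound on the edges of `Y`.
This supplies the neighbourhood used for uniqueness. -/
theorem mem_regularSet_of_near {m ρ : ℝ} {Y Z : 𝒯.Nodal} (hY : ‖Y‖ ≤ ρ)
    (hYe : ∀ θ, 2 * m ≤ ‖𝒯.slope Y θ‖) (h1 : ‖Z - Y‖ ≤ 1) (h2 : ‖Z - Y‖ ≤ m * 𝒯.h / 2) :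
    Z ∈ 𝒯.regularSet m (ρ + 1) := by
  refine ⟨?_, fun j => ?_⟩
  · have := norm_sub_norm_le Z Y
    linarith
  · have e1 : 𝒯.slope Y (𝒯.node (j.val : ℤ)) = 𝒯.edge Y j := by
      rw [slope, idx_node, Int.cast_natCast, ZMod.natCast_zmod_val]
    have h3 := hYe (𝒯.node (j.val : ℤ))
    rw [e1] at h3
    have h4 : ‖𝒯.edge (Z - Y) j‖ ≤ m := by
      rw [edge, norm_smul, norm_inv, Real.norm_of_nonneg 𝒯.h_pos.le, inv_mul_le_iff₀ 𝒯.h_pos]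
      refine (norm_sub_le _ _).trans ?_
      have := norm_le_pi_norm (Z - Y) (j + 1)
      have := norm_le_pi_norm (Z - Y) j
      linarith
    have e2 : 𝒯.edge Z j = 𝒯.edge Y j + 𝒯.edge (Z - Y) j := by rw [edge_sub]; abel
    have h5 := norm_sub_le_norm_add (𝒯.edge Y j) (𝒯.edge (Z - Y) j)
    rw [e2]
    linarith

end Mesh

/-- The constant in the exponent of the error estimate. -/
noncomputable def constM (m K : ℝ) : ℝ := (16 * (K + 2 * m) ^ 2 * K ^ 2 + 2) / (2 * m) ^ 2

/-- The consistency constant of the error estimate. -/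
noncomputable def constC (m K B : ℝ) : ℝ :=
  (K + 2 * m) ^ 2 * B + 16 * Real.pi * (K + 2 * m) ^ 2 * K ^ 2 * K ^ 2 / (2 * m) ^ 2

/-- The solution of the scheme, together with the energy estimate. -/
theorem FlowBounds.exists_discrete_flow {α T m K B : ℝ} {X : ℝ → ℝ → Plane} (hT : 0 < T)
    (hX : IsC21 T X) (hb : FlowBounds T X m K B) (h0 : 0 < α) (h1 : α ≤ 1)
    (hflow : SolvesFlow α T X) (𝒯 : Mesh) (hh1 : K * 𝒯.h ≤ m)
    (hh2 : 2 * (constC m K B / constM m K * Real.exp (constM m K / α * T)) * 𝒯.h < m ^ 2) :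
    ∃ (Y : ℝ → 𝒯.Nodal) (G : 𝒯.Nodal → 𝒯.Nodal) (L : NNReal) (η : ℝ), LipschitzWith L G ∧ 0 < η ∧
      Y 0 = 𝒯.sample (X 0) ∧
      (∀ t ∈ Icc 0 T, HasDerivWithinAt Y (G (Y t)) (Icc 0 T) t) ∧
      (∀ t ∈ Icc 0 T, ∀ θ, 2 * m ≤ ‖𝒯.slope (Y t) θ‖) ∧
      (∀ t ∈ Icc 0 T, ∀ Z, ‖Z - Y t‖ ≤ η → Z ∈ 𝒯.nondegenerate ∧ G Z = 𝒯.velocity α Z) ∧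
      ∀ t ∈ Icc 0 T, 𝒯.energy (𝒯.sample (X t) - Y t)
        + (∫ s in (0)..t, 𝒯.mass α (Y s) (𝒯.sample (timeDeriv T X s) - G (Y s))
            (𝒯.sample (timeDeriv T X s) - G (Y s)) / 4)
        ≤ constC m K B / constM m K * 𝒯.h ^ 2 * (Real.exp (constM m K / α * t) - 1) := by
  have hm := hb.m_pos
  have hK := hb.K_nonneg
  have hh := 𝒯.h_pos
  have hM : 0 < constM m K := by unfold constM; positivity
  have hC : 0 ≤ constC m K B := by
    have := hb.B_nonneg
    unfold constC; positivity
  set ρ := K + 2 * m with hρ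
  obtain ⟨G, hGF, ⟨L, hL⟩, Bd, hBd⟩ := exists_lipschitz_extension
    (𝒯.isCompact_regularSet m (ρ + 1)) 𝒯.isOpen_nondegenerate (𝒯.regularSet_subset hm (ρ + 1))
    fun Y hY => 𝒯.contDiffAt_velocity h0 h1 hY
  obtain ⟨Y, hY0, hYd⟩ := exists_ode_solution hL hBd hT.le (𝒯.sample (X 0))
  set η := min 1 (m * 𝒯.h / 2) with hη
  have hη0 : 0 < η := lt_min one_pos (by positivity)
  set E : ℝ → 𝒯.Nodal := fun t => 𝒯.sample (X t) - Y t with hE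
  have hYc : ContinuousOn Y (Icc 0 T) := fun t ht => (hYd t ht).continuousWithinAt
  have hEc : ContinuousOn E (Icc 0 T) := (𝒯.continuousOn_sample hX.continuousOn).sub hYc
  have hE0 : E 0 = 0 := by simp [hE, hY0]
  have hzc : ContinuousOn (fun s => 𝒯.sample (timeDeriv T X s) - G (Y s)) (Icc 0 T) :=
    (𝒯.continuousOn_sample hX.continuousOn_timeDeriv).sub (hL.continuous.comp_continuousOn hYc)
  -- At times with small energy, a whole `η`-ball around `Y t` lies in the set where the modified
  -- field `G` is the true velocity.
  have hreg : ∀ t ∈ Icc 0 T, 2 * 𝒯.energy (E t) ≤ m ^ 2 * 𝒯.h →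
      (∀ θ, 2 * m ≤ ‖𝒯.slope (Y t) θ‖ ∧ ‖𝒯.slope (Y t) θ‖ ≤ K + 2 * m) ∧
      ∀ Z, ‖Z - Y t‖ ≤ η → Z ∈ 𝒯.nondegenerate ∧ G Z = 𝒯.velocity α Z := by
    intro t ht hen
    have hs := hb.slope_bounds hX 𝒯 ht hh1 (𝒯.slope_le_of_energy_le hm.le hen)
    refine ⟨hs, fun Z hZ => ?_⟩
    have hYn : ‖Y t‖ ≤ ρ := by
      have h3 := 𝒯.norm_le_of_energy_le hm.le hen
      have h4 : ‖𝒯.sample (X t)‖ ≤ K :=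
        (pi_norm_le_iff_of_nonneg hK).2 fun j => hb.norm_le t ht _
      have e : Y t = 𝒯.sample (X t) - E t := by simp [hE]
      rw [e]
      exact (norm_sub_le _ _).trans (add_le_add h4 h3)
    have hmem := 𝒯.mem_regularSet_of_near hYn (fun θ => (hs θ).1) (hZ.trans (min_le_left _ _))
      (hZ.trans (min_le_right _ _))
    exact ⟨𝒯.regularSet_subset hm _ hmem, hGF hmem⟩
  -- Conditional estimate: as long as the energy has stayed small, the trajectory of `G` obeys the
  -- scheme and the energy inequality applies.
  have hest : ∀ t ∈ Icc 0 T, (∀ s ∈ Icc 0 t, 2 * 𝒯.energy (E s) ≤ m ^ 2 * 𝒯.h) →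
      𝒯.energy (E t)
        + (∫ s in (0)..t, 𝒯.mass α (Y s) (𝒯.sample (timeDeriv T X s) - G (Y s))
            (𝒯.sample (timeDeriv T X s) - G (Y s)) / 4)
        ≤ constC m K B / constM m K * 𝒯.h ^ 2 * (Real.exp (constM m K / α * t) - 1) := by
    intro t ht hen
    have hsub : Icc 0 t ⊆ Icc 0 T := Icc_subset_Icc_right ht.2
    have hsub' : Ioo 0 t ⊆ Ioo 0 T := Ioo_subset_Ioo_right ht.2
    refine 𝒯.energy_estimate h0 hM ht.1 (hEc.mono hsub) (hzc.mono hsub) (hYc.mono hsub)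
      (fun s hs => ?_) hE0 (fun s hs => ?_) h1
    · exact (𝒯.hasDerivAt_sample hX (hsub' hs)).sub
        ((hYd s (hsub (Ioo_subset_Icc_self hs))).hasDerivAt
          (Icc_mem_nhds (hsub' hs).1 (hsub' hs).2))
    · have hsT := hsub (Ioo_subset_Icc_self hs)
      obtain ⟨hr1, hr2⟩ := hreg s hsT (hen s (Ioo_subset_Icc_self hs))
      obtain ⟨hr3, hr4⟩ := hr2 (Y s) (by simpa using hη0.le)
      have hne : ∀ θ, deriv (X s) θ ≠ 0 := fun θ h => by
        have := hb.le_deriv s hsT θ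
        rw [h, norm_zero] at this
        linarith
      exact 𝒯.energy_inequality h0 h1 (c := 2 * m) (by positivity)
        (.of_periodic (continuous_slice hX.continuousOn_timeDeriv hsT)
          (hX.periodic_timeDeriv s hsT))
        (.of_periodic (continuous_slice (f := fun t => deriv (X t)) hX.continuousOn_deriv hsT)
          (periodic_deriv (hX.periodic s hsT)))
        (hflow.weak_form hX (hsub' hs) hne 𝒯) ((𝒯.velocity_spec h0 h1 hr3 _).2 hr4)
        (fun θ => (hb.deriv_le s hsT θ).trans (by linarith)) (fun θ => (hr1 θ).1)
        (fun θ => (hr1 θ).2) (hb.timeDeriv_le s hsT) (hb.interp_le s hsT 𝒯)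
        (hb.norm_deriv_sub_slope_le hX 𝒯 hsT) hb.B_nonneg
  -- Removal of the condition: the estimate is of order `h²`, the threshold of order `h`, and `hh2`
  -- makes the gap strict.
  have hen : ∀ t ∈ Icc 0 T, 2 * 𝒯.energy (E t) ≤ m ^ 2 * 𝒯.h := by
    refine le_of_bootstrap
      (continuousOn_const.mul (𝒯.continuous_energy.comp_continuousOn hEc)) ?_ fun t ht hs => ?_
    · have e0 : 𝒯.energy (0 : 𝒯.Nodal) = 0 := by
        rw [Mesh.energy, ← Mesh.stiffL_apply, ← Mesh.gramL_apply]; simp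
      rw [hE0, e0, mul_zero]
      positivity
    · have h3 := hest t ht hs
      have h4 : 0 ≤ ∫ s in (0)..t, 𝒯.mass α (Y s) (𝒯.sample (timeDeriv T X s) - G (Y s))
            (𝒯.sample (timeDeriv T X s) - G (Y s)) / 4 :=
        intervalIntegral.integral_nonneg ht.1 fun s _ =>
          div_nonneg (𝒯.mass_self_nonneg h0.le h1 _ _) (by norm_num)
      have h5 : Real.exp (constM m K / α * t) - 1 ≤ Real.exp (constM m K / α * T) := by
        have : Real.exp (constM m K / α * t) ≤ Real.exp (constM m K / α * T) := by
          have := ht.2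
          gcongr
        linarith
      have h6 : constC m K B / constM m K * 𝒯.h ^ 2 * (Real.exp (constM m K / α * t) - 1)
          ≤ constC m K B / constM m K * 𝒯.h ^ 2 * Real.exp (constM m K / α * T) := by gcongr
      have h7 := mul_lt_mul_of_pos_right hh2 hh
      calc 2 * 𝒯.energy (E t)
          ≤ 2 * (constC m K B / constM m K * 𝒯.h ^ 2 * Real.exp (constM m K / α * T)) := by linarith
        _ = 2 * (constC m K B / constM m K * Real.exp (constM m K / α * T)) * 𝒯.h * 𝒯.h := by ring
        _ < m ^ 2 * 𝒯.h := h7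
  exact ⟨Y, G, L, η, hL, hη0, hY0, hYd, fun t ht θ => ((hreg t ht (hen t ht)).1 θ).1,
    fun t ht => (hreg t ht (hen t ht)).2,
    fun t ht => hest t ht fun s hs => hen s ⟨hs.1, hs.2.trans ht.2⟩⟩

/-! ### Uniqueness for the scheme -/

namespace IsSemidiscreteSolution

theorem eq_lift {α T : ℝ} {𝒯 : Mesh} {X₀ : ℝ → Plane}
    {Z W : ℝ → ℝ → Plane} (hZ : IsSemidiscreteSolution α T 𝒯 X₀ Z W) {t : ℝ} (ht : t ∈ Icc 0 T) :
    Z t = 𝒯.lift (𝒯.sample (Z t)) := 𝒯.eq_lift_of_mem_space2 (hZ.mem t ht)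

/-- A weak solution coincides with a solution of the differential equation. -/
theorem eq_of_ode {α T : ℝ} (hT : 0 < T) (h0 : 0 < α) (h1 : α ≤ 1) {𝒯 : Mesh} {X₀ : ℝ → Plane}
    (hp : Function.Periodic X₀ (2 * Real.pi))
    {Z W : ℝ → ℝ → Plane} (hZ : IsSemidiscreteSolution α T 𝒯 X₀ Z W) {Y : ℝ → 𝒯.Nodal}
    {G : 𝒯.Nodal → 𝒯.Nodal} {L : NNReal} {η : ℝ} (hL : LipschitzWith L G) (hη : 0 < η)
    (hY0 : Y 0 = 𝒯.sample X₀)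
    (hYd : ∀ t ∈ Icc 0 T, HasDerivWithinAt Y (G (Y t)) (Icc 0 T) t)
    (hG : ∀ t ∈ Icc 0 T, ∀ Z, ‖Z - Y t‖ ≤ η → Z ∈ 𝒯.nondegenerate ∧ G Z = 𝒯.velocity α Z) :
    ∀ t ∈ Icc 0 T, Z t = 𝒯.lift (Y t) := by
  set y : ℝ → 𝒯.Nodal := fun t => 𝒯.sample (Z t) with hy
  have hyc : ContinuousOn y (Icc 0 T) := continuousOn_pi.2 fun j => hZ.continuousOn _
  have hYc : ContinuousOn Y (Icc 0 T) := fun t ht => (hYd t ht).continuousWithinAt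
  have hy0 : y 0 = Y 0 := by
    rw [hy, hY0]
    simp only
    rw [hZ.initial, 𝒯.interp_eq_lift hp, 𝒯.sample_lift]
  set d : ℝ → ℝ := fun t => ‖y t - Y t‖ with hd
  have hdc : ContinuousOn d (Icc 0 T) := (hyc.sub hYc).norm
  -- While the weak solution stays `η`-close to `Y`, both satisfy the integral equation of the
  -- Lipschitz field `G`, so the distance obeys `d ≤ L ∫ d` and vanishes.
  have hsmall : ∀ t ∈ Icc 0 T, (∀ s ∈ Icc 0 t, d s ≤ η) → d t ≤ 0 := by
    intro t ht hdη
    have hdI : ∀ s ∈ Icc 0 t, IntervalIntegrable d volume 0 s := fun s hs => by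
      refine (hdc.mono ?_).intervalIntegrable
      rw [uIcc_of_le hs.1]
      exact Icc_subset_Icc_right (hs.2.trans ht.2)
    have hbound : ∀ s ∈ Icc 0 t, d s ≤ L * ∫ r in (0)..s, d r := by
      intro s hs
      have hsT : s ∈ Icc 0 T := ⟨hs.1, hs.2.trans ht.2⟩
      have hsub : Icc 0 s ⊆ Icc 0 T := Icc_subset_Icc_right hsT.2
      refine (pi_norm_le_iff_of_nonneg (mul_nonneg L.2 (intervalIntegral.integral_nonneg hs.1
        fun _ _ => norm_nonneg _))).2 fun j => ?_
      have hGy : ContinuousOn (fun r => G (y r) j) (Icc 0 s) :=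
        (continuous_apply j).comp_continuousOn (hL.continuous.comp_continuousOn (hyc.mono hsub))
      have hGY : ContinuousOn (fun r => G (Y r) j) (Icc 0 s) :=
        (continuous_apply j).comp_continuousOn (hL.continuous.comp_continuousOn (hYc.mono hsub))
      have i1 : IntervalIntegrable (fun r => G (y r) j) volume 0 s :=
        ContinuousOn.intervalIntegrable (by rwa [uIcc_of_le hs.1])
      have i2 : IntervalIntegrable (fun r => G (Y r) j) volume 0 s :=
        ContinuousOn.intervalIntegrable (by rwa [uIcc_of_le hs.1])
      have e1 : y s j - y 0 j = ∫ r in (0)..s, G (y r) j := by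
        have h2 := (hZ.memH1 (𝒯.node (j.val : ℤ))).sub_eq_integral hT
          (hZ.continuousOn _) hsT
        change y s j - y 0 j = _ at h2
        rw [h2]
        refine intervalIntegral.integral_congr_ae ?_
        have h3 := (ae_restrict_iff' measurableSet_Ioo).1 hZ.equation
        -- The integral runs over a half-open interval that may contain `T`, where the scheme is not
        -- assumed.
        filter_upwards [h3, (countable_singleton T).ae_notMem volume] with r hr1 hr2 hr3
        rw [uIoc_of_le hs.1] at hr3
        have hrT : r ∈ Ioo 0 T := ⟨hr3.1, lt_of_le_of_ne (hr3.2.trans hsT.2) hr2⟩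
        have hrc := Ioo_subset_Icc_self hrT
        have h4 := hr1 hrT
        rw [hZ.eq_lift hrc, 𝒯.eq_lift_of_mem_space2 (hZ.mem_deriv r hrT),
          𝒯.schemeEquation_iff] at h4
        obtain ⟨h5, h6⟩ := hG r hrc (y r) (hdη r ⟨hr3.1.le, hr3.2.trans hs.2⟩)
        have h7 := (𝒯.velocity_spec h0 h1 h5 _).1 h4
        rw [h6, ← h7]
        rfl
      have e2 : Y s j - Y 0 j = ∫ r in (0)..s, G (Y r) j := by
        refine (intervalIntegral.integral_eq_sub_of_hasDerivAt_of_le hs.1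
          ((continuous_apply j).comp_continuousOn (hYc.mono hsub)) (fun r hr => ?_) i2).symm
        have hrT : r ∈ Ioo 0 T := ⟨hr.1, hr.2.trans_le hsT.2⟩
        exact hasDerivAt_pi.1 ((hYd r (Ioo_subset_Icc_self hrT)).hasDerivAt
          (Icc_mem_nhds hrT.1 hrT.2)) j
      have e3 : (y s - Y s) j = ∫ r in (0)..s, (G (y r) j - G (Y r) j) := by
        rw [intervalIntegral.integral_sub i1 i2, ← e1, ← e2, hy0, Pi.sub_apply]
        abel
      rw [e3, ← intervalIntegral.integral_const_mul]
      refine intervalIntegral.norm_integral_le_of_norm_le hs.1 (ae_of_all _ fun r _ => ?_)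
        ((hdI s hs).const_mul _)
      rw [← Pi.sub_apply]
      exact (norm_le_pi_norm _ j).trans (hL.norm_sub_le _ _)
    set I : ℝ → ℝ := fun s => ∫ r in (0)..s, d r with hI
    have hsub : Icc 0 t ⊆ Icc 0 T := Icc_subset_Icc_right ht.2
    have hIc : ContinuousOn I (Icc 0 t) := by
      have := intervalIntegral.continuousOn_primitive_interval (f := d) (μ := volume) (a := 0)
        (b := t) (by rw [uIcc_of_le ht.1]; exact (hdc.mono hsub).integrableOn_Icc)
      rwa [uIcc_of_le ht.1] at this
    -- The rate is `L + 1` because `L` may be zero and `gronwall` needs a positive rate.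
    have hg := gronwall (Z := I) (Z' := d) (a := L + 1) (b := 0) (by positivity) ht.1 hIc
      (fun s hs => intervalIntegral.integral_hasDerivAt_right (hdI s (Ioo_subset_Icc_self hs))
        (((hdc.mono hsub).mono Ioo_subset_Icc_self).stronglyMeasurableAtFilter isOpen_Ioo _ hs)
        ((hdc.mono hsub).continuousAt (Icc_mem_nhds hs.1 hs.2)))
      (fun s hs => by
        have h2 := hbound s (Ioo_subset_Icc_self hs)
        have h3 : 0 ≤ I s := intervalIntegral.integral_nonneg hs.1.le fun r _ => norm_nonneg _
        rw [add_mul, one_mul, add_zero]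
        linarith)
    simp only [hI, intervalIntegral.integral_same, zero_div, add_zero, zero_mul, sub_zero] at hg
    exact (hbound t ⟨ht.1, le_rfl⟩).trans (mul_nonpos_of_nonneg_of_nonpos L.2 hg)
  have hdη := le_of_bootstrap hdc (ε := η) (by simp [hd, hy0, hη.le]) fun t ht hs =>
    (hsmall t ht hs).trans_lt hη
  intro t ht
  have h2 := hsmall t ht fun s hs => hdη s ⟨hs.1, hs.2.trans ht.2⟩
  have h3 : y t = Y t := sub_eq_zero.1 (norm_le_zero_iff.1 h2)
  rw [hZ.eq_lift ht, ← h3]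

end IsSemidiscreteSolution

/-! ### Norms of the error -/

theorem ofReal_sq_norm {E : Type*} [NormedAddCommGroup E] (v : E) :
    ‖v‖ₑ ^ 2 = ENNReal.ofReal (‖v‖ ^ 2) := by
  rw [ENNReal.ofReal_pow (norm_nonneg _), ofReal_norm]

theorem l2NormSq_eq {f : ℝ → Plane} (hf : BddMeas f) :
    l2NormSq f = ENNReal.ofReal (∫ θ, ‖f θ‖ ^ 2 ∂circleMeasure) := by
  rw [ofReal_integral_eq_lintegral_ofReal (hf.norm_sq.integrable _)
    (ae_of_all _ fun _ => sq_nonneg _)]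
  simp only [l2NormSq, ofReal_sq_norm]

namespace Mesh

variable (𝒯 : Mesh)

theorem h1NormSq_sub_lift {u : ℝ → Plane} (hu : Differentiable ℝ u) (hu' : Continuous (deriv u))
    (hp : Function.Periodic u (2 * Real.pi)) (Y : 𝒯.Nodal) :
    h1NormSq (fun θ => u θ - 𝒯.lift Y θ)
      = ENNReal.ofReal (∫ θ, ‖u θ - 𝒯.lift Y θ‖ ^ 2 ∂circleMeasure
        + ∫ θ, ‖deriv u θ - 𝒯.slope Y θ‖ ^ 2 ∂circleMeasure) := by
  have b1 := (BddMeas.of_periodic hu.continuous hp).sub (𝒯.bddMeas_lift Y)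
  have b2 := (BddMeas.of_periodic hu' (periodic_deriv hp)).sub (𝒯.bddMeas_slope Y)
  rw [ENNReal.ofReal_add (integral_nonneg fun _ => sq_nonneg _)
    (integral_nonneg fun _ => sq_nonneg _), h1NormSq, l2NormSq_eq b1, ← l2NormSq_eq b2]
  congr 1
  refine lintegral_congr_ae ?_
  filter_upwards [ae_circle 𝒯.ae_ne_node] with θ hθ
  have h : HasDerivAt (fun θ => u θ - 𝒯.lift Y θ) (deriv u θ - 𝒯.slope Y θ) θ :=
    (hu θ).hasDerivAt.sub (𝒯.hasDerivAt_lift Y hθ)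
  rw [h.deriv]

theorem integral_norm_sub_lift_sq_le {u : ℝ → Plane} (hu : BddMeas u) (P Y : 𝒯.Nodal) {κ : ℝ}
    (hP : ∀ θ, ‖u θ - 𝒯.lift P θ‖ ≤ κ) :
    ∫ θ, ‖u θ - 𝒯.lift Y θ‖ ^ 2 ∂circleMeasure
      ≤ 2 * 𝒯.gram (P - Y) (P - Y) + 4 * Real.pi * κ ^ 2 := by
  have hE := 𝒯.bddMeas_lift (P - Y)
  have h1 : ∫ θ, ‖u θ - 𝒯.lift Y θ‖ ^ 2 ∂circleMeasure
      ≤ ∫ θ, (2 * ⟪𝒯.lift (P - Y) θ, 𝒯.lift (P - Y) θ⟫ + 2 * κ ^ 2) ∂circleMeasure := by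
    refine integral_mono ((hu.sub (𝒯.bddMeas_lift Y)).norm_sq.integrable _)
      ((((hE.inner hE).integrable _).const_mul _).add (integrable_const _)) fun θ => ?_
    have e : u θ - 𝒯.lift Y θ = (u θ - 𝒯.lift P θ) + 𝒯.lift (P - Y) θ := by
      rw [lift_sub]; abel
    simp only
    rw [e, real_inner_self_eq_norm_sq]
    have h3 : ‖u θ - 𝒯.lift P θ + 𝒯.lift (P - Y) θ‖ ≤ κ + ‖𝒯.lift (P - Y) θ‖ :=
      (norm_add_le _ _).trans (add_le_add_left (hP θ) _)
    have h4 := pow_le_pow_left₀ (norm_nonneg _) h3 2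
    nlinarith [sq_nonneg (κ - ‖𝒯.lift (P - Y) θ‖)]
  refine h1.trans (le_of_eq ?_)
  rw [integral_add (((hE.inner hE).integrable _).const_mul _) (integrable_const _),
    integral_const_mul, integral_circle_const, gram]
  ring

end Mesh

theorem norm_add_sq_le {E : Type*} [NormedAddCommGroup E] (a b : E) :
    ‖a + b‖ ^ 2 ≤ 2 * ‖a‖ ^ 2 + 2 * ‖b‖ ^ 2 := by
  have h := pow_le_pow_left₀ (norm_nonneg _) (norm_add_le a b) 2
  nlinarith [sq_nonneg (‖a‖ - ‖b‖)]

/-- Both parts of the velocity error are controlled by the form of the scheme. -/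
theorem velocity_error_le {α c : ℝ} (h0 : 0 < α) (h1 : α ≤ 1) (hc : 0 < c) {s n : Plane}
    (hs : c ≤ ‖s‖) (hn : ‖n‖ = 1) (hns : (⟪n, s⟫ : ℝ) = 0) (a b : Plane) :
    α * ‖a + b‖ ^ 2 ≤ 2 * ‖a‖ ^ 2 + 2 * (form α s b b / c ^ 2) ∧
    (1 - α) * ‖(⟪n, a + b⟫ : ℝ)‖ ^ 2 ≤ 2 * ‖a‖ ^ 2 + 2 * (form α s b b / c ^ 2) := by
  have hα : 0 ≤ 1 - α := sub_nonneg.2 h1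
  have e := form_eq_of_unit_normal hn hns α b b
  rw [real_inner_self_eq_norm_sq, real_inner_comm n b] at e
  set p : ℝ := ⟪n, b⟫ with hp
  have h2 : (α * ‖b‖ ^ 2 + (1 - α) * (p * p)) * c ^ 2 ≤ form α s b b := by
    rw [← e]
    have : 0 ≤ α * ‖b‖ ^ 2 + (1 - α) * (p * p) :=
      add_nonneg (by positivity) (mul_nonneg hα (mul_self_nonneg p))
    gcongr
  have h3 : α * ‖b‖ ^ 2 + (1 - α) * (p * p) ≤ form α s b b / c ^ 2 := by
    rwa [le_div_iff₀ (by positivity)]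
  have h4 : 0 ≤ α * ‖b‖ ^ 2 := by positivity
  have h5 : 0 ≤ (1 - α) * (p * p) := mul_nonneg hα (mul_self_nonneg p)
  constructor
  · have h6 := mul_le_mul_of_nonneg_left (norm_add_sq_le a b) h0.le
    have h7 : α * ‖a‖ ^ 2 ≤ ‖a‖ ^ 2 := mul_le_of_le_one_left (sq_nonneg _) h1
    linarith
  · have h6 := mul_le_mul_of_nonneg_left (norm_add_sq_le (⟪n, a⟫ : ℝ) p) hα
    have h8 : ‖(⟪n, a⟫ : ℝ)‖ ^ 2 ≤ ‖a‖ ^ 2 := by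
      have := norm_inner_le_norm (𝕜 := ℝ) n a
      rw [hn, one_mul] at this
      gcongr
    have h7 : (1 - α) * ‖(⟪n, a⟫ : ℝ)‖ ^ 2 ≤ ‖a‖ ^ 2 :=
      (mul_le_of_le_one_left (sq_nonneg _) (by linarith)).trans h8
    have h9 : ‖p‖ ^ 2 = p * p := by rw [Real.norm_eq_abs, sq_abs, sq]
    rw [inner_add_right, ← hp]
    rw [h9] at h6
    linarith

/-- The velocity error at a fixed time. -/
theorem Mesh.l2NormSq_velocity_error_le (𝒯 : Mesh) {α c κ : ℝ} (h0 : 0 < α) (h1 : α ≤ 1)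
    (hc : 0 < c) {u : ℝ → Plane} (hu : BddMeas u) {Y : 𝒯.Nodal} (Q V : 𝒯.Nodal)
    (hY : ∀ θ, c ≤ ‖𝒯.slope Y θ‖) {ν : ℝ → Plane} (hν : 𝒯.IsUnitNormalField (𝒯.lift Y) ν)
    (hQ : ∫ θ, ‖u θ - 𝒯.lift Q θ‖ ^ 2 ∂circleMeasure ≤ κ) :
    ENNReal.ofReal α * l2NormSq (fun θ => u θ - 𝒯.lift V θ)
        ≤ ENNReal.ofReal (2 * κ + 8 / c ^ 2 * (𝒯.mass α Y (Q - V) (Q - V) / 4)) ∧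
      ENNReal.ofReal (1 - α) * l2NormSq (fun θ => (⟪ν θ, u θ - 𝒯.lift V θ⟫ : ℝ))
        ≤ ENNReal.ofReal (2 * κ + 8 / c ^ 2 * (𝒯.mass α Y (Q - V) (Q - V) / 4)) := by
  set g : ℝ → ℝ := fun θ => 2 * ‖u θ - 𝒯.lift Q θ‖ ^ 2
    + 2 * (form α (𝒯.slope Y θ) (𝒯.lift (Q - V) θ) (𝒯.lift (Q - V) θ) / c ^ 2) with hg
  have i1 : Integrable (fun θ => ‖u θ - 𝒯.lift Q θ‖ ^ 2) circleMeasure :=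
    (hu.sub (𝒯.bddMeas_lift Q)).norm_sq.integrable _
  have i2 := 𝒯.integrable_form α Y (Q - V) (Q - V)
  have gI : Integrable g circleMeasure := (i1.const_mul _).add ((i2.div_const _).const_mul _)
  have g0 : ∀ θ, 0 ≤ g θ := fun θ => add_nonneg (by positivity)
    (mul_nonneg zero_le_two (div_nonneg (form_self_nonneg h0.le h1 _ _) (sq_nonneg c)))
  have hgle : ∫ θ, g θ ∂circleMeasure
      ≤ 2 * κ + 8 / c ^ 2 * (𝒯.mass α Y (Q - V) (Q - V) / 4) := by
    rw [hg, integral_add (i1.const_mul _) ((i2.div_const _).const_mul _), integral_const_mul,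
      integral_const_mul, integral_div, Mesh.mass]
    have : 2 * ((∫ θ, form α (𝒯.slope Y θ) (𝒯.lift (Q - V) θ) (𝒯.lift (Q - V) θ) ∂circleMeasure)
        / c ^ 2) = 8 / c ^ 2 * ((∫ θ, form α (𝒯.slope Y θ) (𝒯.lift (Q - V) θ)
          (𝒯.lift (Q - V) θ) ∂circleMeasure) / 4) := by ring
    linarith
  have key := fun θ => velocity_error_le h0 h1 hc (hY θ)
    (Mesh.IsUnitNormalField.norm_inner 𝒯 hν θ).1 (Mesh.IsUnitNormalField.norm_inner 𝒯 hν θ).2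
    (u θ - 𝒯.lift Q θ) (𝒯.lift (Q - V) θ)
  have e : ∀ θ, u θ - 𝒯.lift Q θ + 𝒯.lift (Q - V) θ = u θ - 𝒯.lift V θ := fun θ => by
    rw [𝒯.lift_sub]; abel
  simp only [e] at key
  have fin : ∫⁻ θ, ENNReal.ofReal (g θ) ∂circleMeasure
      ≤ ENNReal.ofReal (2 * κ + 8 / c ^ 2 * (𝒯.mass α Y (Q - V) (Q - V) / 4)) := by
    rw [← ofReal_integral_eq_lintegral_ofReal gI (ae_of_all _ g0)]
    exact ENNReal.ofReal_le_ofReal hgle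
  constructor
  -- The constant is pulled into the integral by finiteness, not measurability. In the companion
  -- bound this, with monotonicity of the lower integral, avoids measurability of the normal field.
  · rw [l2NormSq, ← lintegral_const_mul' _ _ ENNReal.ofReal_ne_top]
    refine (lintegral_mono fun θ => ?_).trans fin
    rw [ofReal_sq_norm, ← ENNReal.ofReal_mul h0.le]
    exact ENNReal.ofReal_le_ofReal (key θ).1
  · rw [l2NormSq, ← lintegral_const_mul' _ _ ENNReal.ofReal_ne_top]
    refine (lintegral_mono fun θ => ?_).trans fin
    rw [ofReal_sq_norm, ← ENNReal.ofReal_mul (sub_nonneg.2 h1)]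
    exact ENNReal.ofReal_le_ofReal (key θ).2

namespace Mesh

variable (𝒯 : Mesh)

theorem norm_lift_le (Y : 𝒯.Nodal) (θ : ℝ) : ‖𝒯.lift Y θ‖ ≤ ‖Y‖ := by
  rw [lift_eq_convex]
  set f := Int.fract ((θ - 𝒯.first) / 𝒯.h)
  have hf0 : 0 ≤ f := Int.fract_nonneg _
  have hf1 : 0 ≤ 1 - f := sub_nonneg.2 (Int.fract_lt_one _).le
  refine (norm_add_le _ _).trans ?_
  rw [norm_smul, norm_smul, Real.norm_of_nonneg hf0, Real.norm_of_nonneg hf1]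
  have h3 := mul_le_mul_of_nonneg_left (norm_le_pi_norm Y (𝒯.idx θ)) hf1
  have h4 := mul_le_mul_of_nonneg_left (norm_le_pi_norm Y (𝒯.idx θ + 1)) hf0
  linarith

theorem norm_slope_le (Y : 𝒯.Nodal) (θ : ℝ) : ‖𝒯.slope Y θ‖ ≤ 𝒯.h⁻¹ * (‖Y‖ + ‖Y‖) := by
  rw [slope, edge, norm_smul, norm_inv, Real.norm_of_nonneg 𝒯.h_pos.le]
  have := 𝒯.h_pos
  gcongr
  exact (norm_sub_le _ _).trans (add_le_add (norm_le_pi_norm Y _) (norm_le_pi_norm Y _))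

theorem continuousOn_h1_error {T m K B : ℝ} {X : ℝ → ℝ → Plane} (hX : IsC21 T X)
    (hb : FlowBounds T X m K B) {Y : ℝ → 𝒯.Nodal} (hY : ContinuousOn Y (Icc 0 T)) :
    ContinuousOn (fun t => ∫ θ, ‖X t θ - 𝒯.lift (Y t) θ‖ ^ 2 ∂circleMeasure
      + ∫ θ, ‖deriv (X t) θ - 𝒯.slope (Y t) θ‖ ^ 2 ∂circleMeasure) (Icc 0 T) := by
  obtain ⟨ρ, hρ⟩ := isCompact_Icc.exists_bound_of_continuousOn hY
  have hh := 𝒯.h_pos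
  refine ContinuousOn.add ?_ ?_
  · refine integral_circle_continuousOn (C := (K + ρ) ^ 2) (fun t ht => ?_) (fun t ht θ => ?_)
      fun θ => ?_
    · exact ((BddMeas.of_periodic (hX.differentiable t ht).continuous (hX.periodic t ht)).sub
        (𝒯.bddMeas_lift _)).norm_sq.1.aestronglyMeasurable
    · rw [norm_pow, norm_norm]
      have := (norm_sub_le (X t θ) (𝒯.lift (Y t) θ)).trans
        (add_le_add (hb.norm_le t ht θ) ((𝒯.norm_lift_le (Y t) θ).trans (hρ t ht)))
      gcongr
    · exact (((continuousOn_slice hX.continuousOn θ).sub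
        ((𝒯.continuous_lift_apply θ).comp_continuousOn hY)).norm).pow 2
  · refine integral_circle_continuousOn (C := (K + 𝒯.h⁻¹ * (ρ + ρ)) ^ 2) (fun t ht => ?_)
      (fun t ht θ => ?_) fun θ => ?_
    · exact ((BddMeas.of_periodic (continuous_slice (f := fun t => deriv (X t))
        hX.continuousOn_deriv ht) (periodic_deriv (hX.periodic t ht))).sub
        (𝒯.bddMeas_slope _)).norm_sq.1.aestronglyMeasurable
    · rw [norm_pow, norm_norm]
      have h1 : 𝒯.h⁻¹ * (‖Y t‖ + ‖Y t‖) ≤ 𝒯.h⁻¹ * (ρ + ρ) := by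
        have := hρ t ht
        gcongr
      have := (norm_sub_le (deriv (X t) θ) (𝒯.slope (Y t) θ)).trans
        (add_le_add (hb.deriv_le t ht θ) ((𝒯.norm_slope_le (Y t) θ).trans h1))
      gcongr
    · exact (((continuousOn_slice (f := fun t => deriv (X t)) hX.continuousOn_deriv θ).sub
        ((𝒯.continuous_slope_apply θ).comp_continuousOn hY)).norm).pow 2

end Mesh

end CurveFlow

/-! ### Choice of constants and assembly of the estimate -/

theorem mainTheorem1
    (T : ℝ) (hT : 0 < T)
    (X : ℝ → ℝ → CurveFlow.Plane) (X₀ : ℝ → CurveFlow.Plane)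
    (hX : CurveFlow.IsC21 T X) (hX₀ : X 0 = X₀)
    (hXt_H1 : CurveFlow.MemBochnerSobolev 1 ∞ T (CurveFlow.timeDeriv T X))
    (hXt_H2 : CurveFlow.MemBochnerSobolev 2 2 T (CurveFlow.timeDeriv T X))
    (c₀ : ℝ) (hc₀ : 0 < c₀) (hbound : ∀ t ∈ Icc 0 T, ∀ θ : ℝ, c₀ ≤ ‖deriv (X t) θ‖) :
    ∃ C M : ℝ, 0 < C ∧ 0 < M ∧
      ∀ α : ℝ, 0 < α → α ≤ 1 → CurveFlow.SolvesFlow α T X →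
        ∃ h₀ : ℝ, 0 < h₀ ∧ ∀ 𝒯 : CurveFlow.Mesh, 𝒯.h ≤ h₀ →
          ∃ Xh V : ℝ → ℝ → CurveFlow.Plane,
            CurveFlow.IsSemidiscreteSolution α T 𝒯 X₀ Xh V ∧
            (∀ t ∈ Ioo 0 T,
              (∀ θ : ℝ, HasDerivAt (fun s => Xh s θ) (V t θ) t) ∧
                CurveFlow.SchemeEquation α 𝒯 (Xh t) (V t)) ∧
            (∀ Y W : ℝ → ℝ → CurveFlow.Plane,
              CurveFlow.IsSemidiscreteSolution α T 𝒯 X₀ Y W → ∀ t ∈ Icc 0 T, Y t = Xh t) ∧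
            ∀ ν : ℝ → ℝ → CurveFlow.Plane,
              (∀ t ∈ Icc 0 T, 𝒯.IsUnitNormalField (Xh t) (ν t)) →
              ∃ m : ℝ≥0∞,
                IsGreatest
                  ((fun t => CurveFlow.h1NormSq (fun θ => X t θ - Xh t θ)) '' Icc 0 T) m ∧
                ENNReal.ofReal α *
                    (∫⁻ t in Ioo 0 T,
                      CurveFlow.l2NormSq (fun θ => CurveFlow.timeDeriv T X t θ - V t θ))
                  + ENNReal.ofReal (1 - α) *
                    (∫⁻ t in Ioo 0 T,
                      CurveFlow.l2NormSq
                        (fun θ => ⟪ν t θ, CurveFlow.timeDeriv T X t θ - V t θ⟫))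
                  + m
                  ≤ ENNReal.ofReal (C * Real.exp (M / α * T) * 𝒯.h ^ 2) := by
  open CurveFlow in
  subst hX₀
  obtain ⟨K, B, hb⟩ := hX.exists_flowBounds hT hXt_H1 hc₀ hbound
  set m := c₀ / 4
  have hm := hb.m_pos
  have hK := hb.K_nonneg
  have hB := hb.B_nonneg
  have hM : 0 < constM m K := by unfold constM; positivity
  have hC : 0 ≤ constC m K B := by unfold constC; positivity
  set q := constC m K B / constM m K with hq
  have hq0 : 0 ≤ q := div_nonneg hC hM.le
  -- Each velocity term contributes `2 B T + 8 q / (2 m)²`, the `H¹` error `4 q + 8 π K²`; the final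
  -- `1` ensures positivity. None of these involves `α`.
  refine ⟨4 * B * T + (16 / (2 * m) ^ 2 + 4) * q + 8 * Real.pi * K ^ 2 + 1, constM m K,
    by positivity, hM, fun α h0 h1 hflow => ?_⟩
  set e := Real.exp (constM m K / α * T) with he
  have he1 : 1 ≤ e := Real.one_le_exp (by positivity)
  have he0 : 0 < e := Real.exp_pos _
  -- The two entries give `K h ≤ m` and the strict bound `2 q e h < m²`; the added ones keep the
  -- denominators positive. The factor `e` is where `h₀` depends on `α`.
  refine ⟨min (m / (K + 1)) (m ^ 2 / (4 * (q * e + 1))), by positivity, fun 𝒯 hh => ?_⟩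
  have hhp := 𝒯.h_pos
  have hh1 : K * 𝒯.h ≤ m := by
    have h2 := hh.trans (min_le_left _ _)
    rw [le_div_iff₀ (by positivity)] at h2
    linarith
  have hh2 : 2 * (q * e) * 𝒯.h < m ^ 2 := by
    have h2 := hh.trans (min_le_right _ _)
    rw [le_div_iff₀ (by positivity)] at h2
    have : 0 ≤ q * e * 𝒯.h := by positivity
    linarith
  obtain ⟨Y, G, L, η, hL, hη, hY0, hYd, hYs, hG, hest⟩ :=
    hb.exists_discrete_flow hT hX h0 h1 hflow 𝒯 hh1 hh2
  have hYc : ContinuousOn Y (Icc 0 T) := fun t ht => (hYd t ht).continuousWithinAt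
  have hGc : ContinuousOn (fun t => G (Y t)) (Icc 0 T) := hL.continuous.comp_continuousOn hYc
  have h0mem : (0 : ℝ) ∈ Icc 0 T := ⟨le_rfl, hT.le⟩
  have hderiv : ∀ t ∈ Ioo 0 T, ∀ θ,
      HasDerivAt (fun s => 𝒯.lift (Y s) θ) (𝒯.lift (G (Y t)) θ) t := by
    intro t ht θ
    let ℓ : 𝒯.Nodal →ₗ[ℝ] Plane :=
      { toFun := fun Z => 𝒯.lift Z θ
        map_add' := fun Z Z' => 𝒯.lift_add Z Z' θ
        map_smul' := fun c Z => 𝒯.lift_smul c Z θ }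
    exact (LinearMap.toContinuousLinearMap ℓ).hasFDerivAt.comp_hasDerivAt t
      ((hYd t (Ioo_subset_Icc_self ht)).hasDerivAt (Icc_mem_nhds ht.1 ht.2))
  have hscheme : ∀ t ∈ Ioo 0 T, SchemeEquation α 𝒯 (𝒯.lift (Y t)) (𝒯.lift (G (Y t))) := by
    intro t ht
    obtain ⟨h2, h3⟩ := hG t (Ioo_subset_Icc_self ht) (Y t) (by simpa using hη.le)
    exact (𝒯.schemeEquation_iff α _ _).2 ((𝒯.velocity_spec h0 h1 h2 _).2 h3)
  have hlc : ∀ {Z : ℝ → 𝒯.Nodal}, ContinuousOn Z (Icc 0 T) → ∀ θ,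
      ContinuousOn (fun t => 𝒯.lift (Z t) θ) (Icc 0 T) := fun hZ θ =>
    (𝒯.continuous_lift_apply θ).comp_continuousOn hZ
  refine ⟨fun t => 𝒯.lift (Y t), fun t => 𝒯.lift (G (Y t)), ?_,
    fun t ht => ⟨hderiv t ht, hscheme t ht⟩, fun Z W hZ => ?_, fun ν hν => ?_⟩
  · exact
      { mem := fun t _ => 𝒯.lift_mem_space2 _
        mem_deriv := fun t _ => 𝒯.lift_mem_space2 _
        continuousOn := hlc hYc
        memH1 := fun θ => memH1Time_of_hasDerivAt hT (hlc hYc θ) (hlc hGc θ)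
          fun t ht => hderiv t ht θ
        equation := (ae_restrict_iff' measurableSet_Ioo).2 (ae_of_all _ hscheme)
        initial := by rw [hY0, 𝒯.interp_eq_lift (hX.periodic 0 h0mem)] }
  · exact hZ.eq_of_ode hT h0 h1 (hX.periodic 0 h0mem) hL hη hY0 hYd hG
  · set D : ℝ → ℝ := fun s => 𝒯.mass α (Y s) (𝒯.sample (timeDeriv T X s) - G (Y s))
      (𝒯.sample (timeDeriv T X s) - G (Y s)) / 4 with hD
    set N : ℝ → ℝ := fun t => ∫ θ, ‖X t θ - 𝒯.lift (Y t) θ‖ ^ 2 ∂circleMeasure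
      + ∫ θ, ‖deriv (X t) θ - 𝒯.slope (Y t) θ‖ ^ 2 ∂circleMeasure with hN
    have hNeq : ∀ t ∈ Icc 0 T,
        h1NormSq (fun θ => X t θ - 𝒯.lift (Y t) θ) = ENNReal.ofReal (N t) := fun t ht =>
      𝒯.h1NormSq_sub_lift (hX.differentiable t ht)
        (continuous_slice (f := fun t => deriv (X t)) hX.continuousOn_deriv ht)
        (hX.periodic t ht) (Y t)
    obtain ⟨t₀, ht₀, hmax⟩ := isCompact_Icc.exists_isMaxOn ⟨0, h0mem⟩
      (𝒯.continuousOn_h1_error hX hb hYc)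
    refine ⟨ENNReal.ofReal (N t₀), ⟨⟨t₀, ht₀, hNeq t₀ ht₀⟩, ?_⟩, ?_⟩
    · rintro _ ⟨t, ht, rfl⟩
      simp only
      rw [hNeq t ht]
      exact ENNReal.ofReal_le_ofReal (hmax ht)
    have hD0 : ∀ s, 0 ≤ D s := fun s =>
      div_nonneg (𝒯.mass_self_nonneg h0.le h1 _ _) (by norm_num)
    have hexp : ∀ t ∈ Icc 0 T,
        q * 𝒯.h ^ 2 * (Real.exp (constM m K / α * t) - 1) ≤ q * 𝒯.h ^ 2 * e := by
      intro t ht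
      have : Real.exp (constM m K / α * t) ≤ e := by
        have := ht.2
        rw [he]
        gcongr
      gcongr
      linarith
    have hNle : N t₀ ≤ 4 * (q * 𝒯.h ^ 2 * e) + 8 * Real.pi * (K * 𝒯.h) ^ 2 := by
      have a1 := 𝒯.integral_norm_sub_lift_sq_le
        (.of_periodic (hX.differentiable t₀ ht₀).continuous (hX.periodic t₀ ht₀))
        _ (Y t₀) (hb.norm_sub_lift_le hX 𝒯 ht₀)
      have a2 := 𝒯.integral_norm_sub_slope_sq_le
        (.of_periodic (continuous_slice (f := fun t => deriv (X t)) hX.continuousOn_deriv ht₀)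
          (periodic_deriv (hX.periodic t₀ ht₀)))
        _ (Y t₀) (hb.norm_deriv_sub_slope_le hX 𝒯 ht₀)
      have a3 := (hest t₀ ht₀).trans (hexp t₀ ht₀)
      have a4 : 0 ≤ ∫ s in (0)..t₀, D s :=
        intervalIntegral.integral_nonneg ht₀.1 fun s _ => hD0 s
      simp only [Mesh.energy] at a3
      simp only [hN]
      linarith
    set γ : ℝ → ℝ := fun s => 2 * (B * 𝒯.h ^ 2) + 8 / (2 * m) ^ 2 * D s with hγ
    have hDc : ContinuousOn D (Icc 0 T) :=
      (𝒯.continuousOn_mass α hYc ((𝒯.continuousOn_sample hX.continuousOn_timeDeriv).sub hGc))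
        |>.div_const _
    have hDI : IntervalIntegrable D volume 0 T :=
      ContinuousOn.intervalIntegrable (by rwa [uIcc_of_le hT.le])
    have hγc : ContinuousOn γ (Icc 0 T) := continuousOn_const.add (continuousOn_const.mul hDc)
    have hγ0 : ∀ s, 0 ≤ γ s := fun s => add_nonneg (by positivity)
      (mul_nonneg (by positivity) (hD0 s))
    have hγle : ∫⁻ t in Ioo 0 T, ENNReal.ofReal (γ t)
        ≤ ENNReal.ofReal (2 * B * T * 𝒯.h ^ 2 + 8 / (2 * m) ^ 2 * (q * 𝒯.h ^ 2 * e)) := by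
      rw [← ofReal_integral_eq_lintegral_ofReal
        (hγc.integrableOn_Icc.mono_set Ioo_subset_Icc_self) (ae_of_all _ hγ0)]
      refine ENNReal.ofReal_le_ofReal ?_
      rw [← integral_Ioc_eq_integral_Ioo, ← intervalIntegral.integral_of_le hT.le, hγ,
        intervalIntegral.integral_add intervalIntegrable_const (hDI.const_mul _),
        intervalIntegral.integral_const, intervalIntegral.integral_const_mul, smul_eq_mul]
      have a1 := (hest T ⟨hT.le, le_rfl⟩).trans (hexp T ⟨hT.le, le_rfl⟩)
      have a2 := 𝒯.energy_nonneg (𝒯.sample (X T) - Y T)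
      have a3 : ∫ s in (0)..T, D s ≤ q * 𝒯.h ^ 2 * e := by linarith
      have a4 := mul_le_mul_of_nonneg_left a3 (by positivity : 0 ≤ 8 / (2 * m) ^ 2)
      linarith
    have hvel := fun t (ht : t ∈ Ioo 0 T) =>
      𝒯.l2NormSq_velocity_error_le h0 h1 (c := 2 * m) (by positivity)
        (.of_periodic (continuous_slice hX.continuousOn_timeDeriv (Ioo_subset_Icc_self ht))
          (hX.periodic_timeDeriv t (Ioo_subset_Icc_self ht)))
        (𝒯.sample (timeDeriv T X t)) (G (Y t)) (hYs t (Ioo_subset_Icc_self ht))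
        (hν t (Ioo_subset_Icc_self ht)) (hb.interp_le t (Ioo_subset_Icc_self ht) 𝒯)
    have b1 : ENNReal.ofReal α * (∫⁻ t in Ioo 0 T,
        l2NormSq (fun θ => timeDeriv T X t θ - 𝒯.lift (G (Y t)) θ))
        ≤ ENNReal.ofReal (2 * B * T * 𝒯.h ^ 2 + 8 / (2 * m) ^ 2 * (q * 𝒯.h ^ 2 * e)) := by
      rw [← lintegral_const_mul' _ _ ENNReal.ofReal_ne_top]
      exact (setLIntegral_mono' measurableSet_Ioo fun t ht => (hvel t ht).1).trans hγle
    have b2 : ENNReal.ofReal (1 - α) * (∫⁻ t in Ioo 0 T,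
        l2NormSq (fun θ => (⟪ν t θ, timeDeriv T X t θ - 𝒯.lift (G (Y t)) θ⟫ : ℝ)))
        ≤ ENNReal.ofReal (2 * B * T * 𝒯.h ^ 2 + 8 / (2 * m) ^ 2 * (q * 𝒯.h ^ 2 * e)) := by
      -- The field `ν` is arbitrary at each time, so nothing is known about measurability in `t`;
      -- only a pointwise upper bound by the continuous `γ` is integrated.
      rw [← lintegral_const_mul' _ _ ENNReal.ofReal_ne_top]
      exact (setLIntegral_mono' measurableSet_Ioo fun t ht => (hvel t ht).2).trans hγle
    refine (add_le_add (add_le_add b1 b2) (ENNReal.ofReal_le_ofReal hNle)).trans ?_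
    rw [← ENNReal.ofReal_add (by positivity) (by positivity),
      ← ENNReal.ofReal_add (by positivity) (by positivity)]
    refine ENNReal.ofReal_le_ofReal ?_
    -- The pure interpolation errors carry no exponential; they are enlarged by the factor `e ≥ 1`.
    have c1 : 0 ≤ (4 * B * T + 8 * Real.pi * K ^ 2) * 𝒯.h ^ 2 * (e - 1) :=
      mul_nonneg (by positivity) (by linarith)
    have c2 : 0 ≤ e * 𝒯.h ^ 2 := by positivity
    have c3 : (4 * B * T + (16 / (2 * m) ^ 2 + 4) * q + 8 * Real.pi * K ^ 2 + 1) * e * 𝒯.h ^ 2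
        = 2 * (2 * B * T * 𝒯.h ^ 2 + 8 / (2 * m) ^ 2 * (q * 𝒯.h ^ 2 * e))
          + (4 * (q * 𝒯.h ^ 2 * e) + 8 * Real.pi * (K * 𝒯.h) ^ 2)
          + (4 * B * T + 8 * Real.pi * K ^ 2) * 𝒯.h ^ 2 * (e - 1) + e * 𝒯.h ^ 2 := by ring
    linarith
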